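/- **Conventions.** All time bounds are in the real RAM model: memory consists of integer registers and arrays and real registers and arrays (with indirect addressing by integers); integer addition, subtraction and comparison, real addition, subtraction, multiplication, division, square root and comparison, and every memory access take one time unit. Disks are open (a disk of radius $0$ is the single point at its centre). For a finite set $P\subset\mathbb{R}^2$ and $r:P\to\mathbb{R}_{\ge 0}$, let $G(P,r)$ be the intersection graph of the disks $D(p,r(p))$, $p\in P$; thus distinct $p,q\in P$ are adjacent if and only if $|pq|<r(p)+r(q)$. **Problem.** An instance of *Min $k$-Shrinking to Acyclicity* is a tuple $(P,k,\alpha,\mu)$ consisting of a finite set $P\subset\mathbb{R}^2$ of $n$ points, an integer $k\ge 0$, a real number $0\le\alpha\le 1$ and a budget $\mu\ge 0$. A *solution* is a pair $(S,r)$ with $S\subseteq P$, $|S|\le k$, $r:P\to\mathbb{R}_{\ge0}$ such that $r(p)=1$ for $p\notin S$, $\alpha\le r(p)\le 1$ for $p\in S$, the graph $G(P,r)$ is acyclic, and $\mathrm{cost}(S,r):=\sum_{p\in S}(1-r(p))\le\mu$. The instance is a *no-instance* if it has no solution. **Theorem.** There is an algorithm that takes as input an instance $(P,k,\alpha,\mu)$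 of Min $k$-Shrinking to Acyclicity and, in time $2^{\mathcal{O}(k^3\log k)}\cdot n^{\mathcal{O}(1)}$, either correctly reports that it is a no-instance, or returns a solution $(S,r)$ of smallest cost among all solutions (so it shrinks at most $k$ disks and has cost at most $\mu$). Explicitly, there are one real RAM program and one constant $C$ such that on every instance the program halts with such a correct answer after at most $C\cdot 2^{C k^3\log_2 k}\cdot (n+1)^{C}$ steps, where $k^3\log_2 k$ is read as $0$ for $k=0$. -/

import Mathlib

/-! ## Real RAM

The memory consists of integer registers, real registers, integer arrays and real arrays.
Programs are finite and use only natural-number constants.  Integers are only added, subtracted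
and compared (they serve for counting and addressing); reals are added, subtracted, multiplied,
divided, compared, and square roots can be taken.  There is no rounding and no conversion between
the two sorts.  Every operation, memory access and comparison takes one time unit. -/

namespace RealRAM

/-- Memory contents.  `natArr a i` and `realArr a i` are the cells with index `i` of the integer
array number `a` and of the real array number `a`. -/
structure State where
  natReg : ℕ → ℕ
  realReg : ℕ → ℝ
  natArr : ℕ → ℕ → ℕ
  realArr : ℕ → ℕ → ℝ

/-- Integer expressions; `sub` is truncated subtraction. -/
inductive NatExpr where
  | lit (c : ℕ)
  | reg (x : ℕ)
  | arr (a : ℕ) (i : NatExpr)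
  | add (e f : NatExpr)
  | sub (e f : NatExpr)

/-- Real expressions.  Division by zero and the square root of a negative number return zero. -/
inductive RealExpr where
  | lit (c : ℕ)
  | reg (x : ℕ)
  | arr (a : ℕ) (i : NatExpr)
  | add (e f : RealExpr)
  | sub (e f : RealExpr)
  | mul (e f : RealExpr)
  | div (e f : RealExpr)
  | sqrt (e : RealExpr)

/-- Tests: comparisons and their Boolean combinations. -/
inductive Test where
  | natLe (e f : NatExpr)
  | realLe (e f : RealExpr)
  | neg (b : Test)
  | conj (b c : Test)

/-- Programs. -/
inductive Program where
  | skip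
  | setNat (x : ℕ) (e : NatExpr)
  | setReal (x : ℕ) (e : RealExpr)
  | storeNat (a : ℕ) (i : NatExpr) (e : NatExpr)
  | storeReal (a : ℕ) (i : NatExpr) (e : RealExpr)
  | seq (p q : Program)
  | ite (b : Test) (p q : Program)
  | loop (b : Test) (p : Program)

def NatExpr.eval (s : State) : NatExpr → ℕ
  | lit c => c
  | reg x => s.natReg x
  | arr a i => s.natArr a (i.eval s)
  | add e f => e.eval s + f.eval s
  | sub e f => e.eval s - f.eval s

noncomputable def RealExpr.eval (s : State) : RealExpr → ℝ
  | lit c => (c : ℝ)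
  | reg x => s.realReg x
  | arr a i => s.realArr a (i.eval s)
  | add e f => e.eval s + f.eval s
  | sub e f => e.eval s - f.eval s
  | mul e f => e.eval s * f.eval s
  | div e f => e.eval s / f.eval s
  | sqrt e => Real.sqrt (e.eval s)

def Test.Holds (s : State) : Test → Prop
  | natLe e f => e.eval s ≤ f.eval s
  | realLe e f => e.eval s ≤ f.eval s
  | neg b => ¬ b.Holds s
  | conj b c => b.Holds s ∧ c.Holds s

/-! The cost of evaluating an expression or a test is its number of nodes. -/

def NatExpr.cost : NatExpr → ℕ
  | lit _ => 1
  | reg _ => 1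
  | arr _ i => i.cost + 1
  | add e f => e.cost + f.cost + 1
  | sub e f => e.cost + f.cost + 1

def RealExpr.cost : RealExpr → ℕ
  | lit _ => 1
  | reg _ => 1
  | arr _ i => i.cost + 1
  | add e f => e.cost + f.cost + 1
  | sub e f => e.cost + f.cost + 1
  | mul e f => e.cost + f.cost + 1
  | div e f => e.cost + f.cost + 1
  | sqrt e => e.cost + 1

def Test.cost : Test → ℕ
  | natLe e f => e.cost + f.cost + 1
  | realLe e f => e.cost + f.cost + 1
  | neg b => b.cost + 1
  | conj b c => b.cost + c.cost + 1

/-- `Runs p s s' t`: started in memory `s`, the program `p` halts with memory `s'` after exactly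
`t` time units.  The rules are deterministic; a program that does not halt has no run. -/
inductive Runs : Program → State → State → ℕ → Prop
  | skip (s : State) : Runs .skip s s 1
  | setNat (x : ℕ) (e : NatExpr) (s : State) :
      Runs (.setNat x e) s
        { s with natReg := Function.update s.natReg x (e.eval s) } (e.cost + 1)
  | setReal (x : ℕ) (e : RealExpr) (s : State) :
      Runs (.setReal x e) s
        { s with realReg := Function.update s.realReg x (e.eval s) } (e.cost + 1)
  | storeNat (a : ℕ) (i e : NatExpr) (s : State) :
      Runs (.storeNat a i e) s
        { s with natArr := Function.update s.natArr a
                  (Function.update (s.natArr a) (i.eval s) (e.eval s)) }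
        (i.cost + e.cost + 1)
  | storeReal (a : ℕ) (i : NatExpr) (e : RealExpr) (s : State) :
      Runs (.storeReal a i e) s
        { s with realArr := Function.update s.realArr a
                  (Function.update (s.realArr a) (i.eval s) (e.eval s)) }
        (i.cost + e.cost + 1)
  | seq {p q : Program} {s₁ s₂ s₃ : State} {t u : ℕ} :
      Runs p s₁ s₂ t → Runs q s₂ s₃ u → Runs (.seq p q) s₁ s₃ (t + u)
  | ite_true {b : Test} {p q : Program} {s s' : State} {t : ℕ} :
      b.Holds s → Runs p s s' t → Runs (.ite b p q) s s' (b.cost + 1 + t)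
  | ite_false {b : Test} {p q : Program} {s s' : State} {t : ℕ} :
      ¬ b.Holds s → Runs q s s' t → Runs (.ite b p q) s s' (b.cost + 1 + t)
  | loop_done {b : Test} {p : Program} {s : State} :
      ¬ b.Holds s → Runs (.loop b p) s s (b.cost + 1)
  | loop_step {b : Test} {p : Program} {s₁ s₂ s₃ : State} {t u : ℕ} :
      b.Holds s₁ → Runs p s₁ s₂ t → Runs (.loop b p) s₂ s₃ u →
        Runs (.loop b p) s₁ s₃ (b.cost + 1 + t + u)

end RealRAM

/-! ## Shrinking disks to acyclicity -/

namespace DiskShrinking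

/-- The Euclidean plane. -/
abbrev Plane : Type := EuclideanSpace ℝ (Fin 2)

/-- The open disk with centre `c` and radius `r`.  For `r = 0` it is the single point `c`
(for `r > 0` inserting the centre changes nothing). -/
def disk (c : Plane) (r : ℝ) : Set Plane := insert c (Metric.ball c r)

/-- The intersection graph of the disks with centres `P v` and radii `r v`. -/
def diskGraph {V : Type} (P : V → Plane) (r : V → ℝ) : SimpleGraph V where
  Adj u v := u ≠ v ∧ (disk (P u) (r u) ∩ disk (P v) (r v)).Nonempty
  symm := ⟨fun u v h => ⟨h.1.symm, by rw [Set.inter_comm]; exact h.2⟩⟩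
  loopless := ⟨fun _ h => h.1 rfl⟩

/-- An instance of Min `k`-Shrinking to Acyclicity: a set of `n` distinct points of the plane
(listed in some order), the lower bound `α` on the radii, the number `k` of disks that may be
shrunk, and the budget `μ`. -/
structure Instance where
  n : ℕ
  P : Fin n → Plane
  P_injective : Function.Injective P
  α : ℝ
  α_nonneg : 0 ≤ α
  α_le_one : α ≤ 1
  k : ℕ
  μ : ℝ
  μ_nonneg : 0 ≤ μ

/-- The total change of the radii. -/
def cost {V : Type} (S : Finset V) (r : V → ℝ) : ℝ := ∑ p ∈ S, (1 - r p)

/-- `(S, r)` is a solution of the instance `I`. -/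
structure IsSolution (I : Instance) (S : Finset (Fin I.n)) (r : Fin I.n → ℝ) : Prop where
  card_le : S.card ≤ I.k
  radius_eq_one : ∀ p, p ∉ S → r p = 1
  radius_mem : ∀ p ∈ S, I.α ≤ r p ∧ r p ≤ 1
  acyclic : (diskGraph I.P r).IsAcyclic
  cost_le : cost S r ≤ I.μ

/-- `(S, r)` is a solution of smallest cost. -/
def IsOptimalSolution (I : Instance) (S : Finset (Fin I.n)) (r : Fin I.n → ℝ) : Prop :=
  IsSolution I S r ∧ ∀ S' r', IsSolution I S' r' → cost S r ≤ cost S' r'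

def IsNoInstance (I : Instance) : Prop := ¬ ∃ S r, IsSolution I S r

/-- The initial memory: `n` and `k` are in the integer registers 0 and 1, `α` and `μ` in the real
registers 0 and 1, the two coordinates of the points in the real arrays 0 and 1; the rest is
zero. -/
noncomputable def input (I : Instance) : RealRAM.State where
  natReg x := if x = 0 then I.n else if x = 1 then I.k else 0
  realReg x := if x = 0 then I.α else if x = 1 then I.μ else 0
  natArr _ _ := 0
  realArr a i :=
    if h : i < I.n then
      if a = 0 then I.P ⟨i, h⟩ 0 else if a = 1 then I.P ⟨i, h⟩ 1 else 0
    else 0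

/-- The set of shrunken disks in the output: the nonzero entries of the integer array 0. -/
def outputSet (n : ℕ) (s : RealRAM.State) : Finset (Fin n) :=
  Finset.univ.filter fun i => s.natArr 0 i ≠ 0

/-- The radii in the output: the real array 0. -/
def outputRadii (n : ℕ) (s : RealRAM.State) : Fin n → ℝ := fun i => s.realArr 0 i

/-- The final memory `s` holds a correct answer for `I`: either integer register 0 is `0` ("no")
and `I` is a no-instance, or it is `1` and the output arrays describe a solution of smallest
cost. -/
def CorrectOutput (I : Instance) (s : RealRAM.State) : Prop :=
  (s.natReg 0 = 0 ∧ IsNoInstance I) ∨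
  (s.natReg 0 = 1 ∧ IsOptimalSolution I (outputSet I.n s) (outputRadii I.n s))

end DiskShrinking

namespace DiskShrinking

/-! ### Vertex sets of minimum degree two -/

/-! Let G be the intersection graph of the unit disks and K that of the disks of a solution.
Shrinking only deletes edges, and an edge uv is deleted exactly when the amounts taken off its two
radii sum to at least `demand`, that is 2 - |uv|. The proof confines the deleted edges to a small
computable vertex set, the pool, and then shows that the amounts needed there come from a finite
list.

Size of the pool. Three unshrunken centres in one unit cell would form a triangle, so degrees in G
are at most k + 32, and at most 2k(k+32) ordered pairs are deleted (`card_removed_le`). The core of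
G, its largest vertex set of minimum degree two, is therefore almost 2-regular: the excess of its
degrees over two sums to at most the number of deleted pairs (`sum_coreDeg_le`). Hence there are few
branching vertices and few chains of degree-two vertices. The pool consists of the branching
vertices, their core neighbours and the ends of one longest edge of each chain; `pool_card_le`
bounds its size by O(k^2). A larger pool certifies a no-instance.

Exchange. A vertex set of minimum degree two that meets a chain contains all of it (`TwoDeg.chain`),
so any edge of the chain is as good for breaking cycles as any other, and the longest one has the
least demand. Moving deletions to longest edges and permuting the amounts accordingly puts all
deletions into the pool (`exists_covers_removed_subset`). The bounds on the amounts are the same for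
all disks, so a permutation respects them and keeps the cost.

Amounts. For fixed deletions the feasible amounts on at most k disks form a polytope. At an extreme
point each amount strictly between 0 and 1 - α is linked by tight demands to an amount 0 or 1 - α,
or to itself by an odd closed walk. So it results from alternating subtraction along at most 2k pool
vertices, possibly followed by halving (`exists_walk_of_extreme`, `exists_walk_solution`).

Search. An anchor, a first vertex, 2k walk vertices and a halving flag are 2k + 3 digits per disk,
so k(2k+3) digits in base pool size plus two describe a candidate, and some candidate is at least as
cheap as any given solution (`exists_code`). The program tries all codes and keeps the cheapest one
that is admissible, acyclic and within the budget; every such candidate is a solution. The number of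
codes is k^{O(k^2)}, which is within the stated bound. No loop of the fixed program makes more than
n + `roundBound` k rounds, so the running time is polynomial in that number (`mainProgram_spec`,
`WP.runs`, `timeBound_le`). -/

/-- Every vertex of `A` has two neighbours in `A`. -/
def TwoDeg {V : Type*} (G : SimpleGraph V) (A : Set V) : Prop :=
  ∀ v ∈ A, ∃ a ∈ A, ∃ b ∈ A, a ≠ b ∧ G.Adj v a ∧ G.Adj v b

/-- The largest vertex set of minimum degree two. -/
def core {V : Type*} (G : SimpleGraph V) : Set V := {v | ∃ A, TwoDeg G A ∧ v ∈ A}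

section Core
variable {V : Type*} {G H : SimpleGraph V} {A : Set V}

lemma TwoDeg.subset_core (h : TwoDeg G A) : A ⊆ core G := fun _ hv => ⟨A, h, hv⟩

lemma twoDeg_core (G : SimpleGraph V) : TwoDeg G (core G) := by
  rintro v ⟨A, hA, hv⟩
  obtain ⟨a, ha, b, hb, h⟩ := hA v hv
  exact ⟨a, ⟨A, hA, ha⟩, b, ⟨A, hA, hb⟩, h⟩

lemma TwoDeg.of_adj (h : TwoDeg G A) (hGH : ∀ u ∈ A, ∀ v ∈ A, G.Adj u v → H.Adj u v) :
    TwoDeg H A := by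
  intro v hv
  obtain ⟨a, ha, b, hb, hab, h1, h2⟩ := h v hv
  exact ⟨a, ha, b, hb, hab, hGH v hv a ha h1, hGH v hv b hb h2⟩

lemma TwoDeg.mono (h : TwoDeg G A) (hGH : G ≤ H) : TwoDeg H A :=
  h.of_adj fun _ _ _ _ e => hGH e

/-- In a nonempty such set every path can be prolonged at its start, so a finite acyclic graph would
contain paths of every length. -/
lemma TwoDeg.eq_empty [Finite V] (h : TwoDeg G A) (hG : G.IsAcyclic) : A = ∅ := by
  have := Fintype.ofFinite V
  by_contra hne
  obtain ⟨v₀, hv₀⟩ := Set.nonempty_iff_ne_empty.2 hne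
  have key : ∀ n : ℕ, ∃ u ∈ A, ∃ w, ∃ p : G.Walk u w, p.IsPath ∧ p.length = n := by
    intro n
    induction n with
    | zero => exact ⟨v₀, hv₀, v₀, .nil, by simp, rfl⟩
    | succ n ih =>
      obtain ⟨u, hu, w, p, hp, hl⟩ := ih
      obtain ⟨a, ha, b, hb, hab, h1, h2⟩ := h u hu
      -- In an acyclic graph a neighbour of the start of a path that lies on the path is its second
      -- vertex, so one of two distinct neighbours is new.
      have : ∃ c ∈ A, G.Adj u c ∧ c ∉ p.support := by
        by_contra hcon
        push Not at hcon
        exact hab ((hG.eq_snd_of_adj_start hp h1 (hcon a ha h1)).trans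
          (hG.eq_snd_of_adj_start hp h2 (hcon b hb h2)).symm)
      obtain ⟨c, hc, hadj, hcs⟩ := this
      exact ⟨c, hc, w, .cons hadj.symm p, hp.cons hcs, by simp [hl]⟩
  obtain ⟨u, _, w, p, hp, hl⟩ := key (Fintype.card V)
  exact absurd hp.length_lt (by omega)

/-- The support of a cycle has minimum degree two. Acyclicity is handled through such sets
throughout, since they are stable under unions and easy to compute. -/
lemma isAcyclic_of_twoDeg (h : ∀ A, TwoDeg G A → A = ∅) : G.IsAcyclic := by
  intro u c hc
  have hT : TwoDeg G {v | v ∈ c.support} := by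
    intro v hv
    obtain ⟨a, b, hab, he⟩ := Set.ncard_eq_two.1 (hc.ncard_neighborSet_toSubgraph_eq_two hv)
    have ha : c.toSubgraph.Adj v a := by
      have : a ∈ c.toSubgraph.neighborSet v := by rw [he]; simp
      exact this
    have hb : c.toSubgraph.Adj v b := by
      have : b ∈ c.toSubgraph.neighborSet v := by rw [he]; simp
      exact this
    exact ⟨a, (c.mem_verts_toSubgraph).1 ha.snd_mem, b, (c.mem_verts_toSubgraph).1 hb.snd_mem,
      hab, ha.adj_sub, hb.adj_sub⟩
  have := h _ hT
  exact (Set.mem_empty_iff_false u).1 (this ▸ c.start_mem_support)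

lemma isAcyclic_iff_core_eq_empty [Finite V] : G.IsAcyclic ↔ core G = ∅ := by
  constructor
  · intro h; exact (twoDeg_core G).eq_empty h
  · intro h
    refine isAcyclic_of_twoDeg fun A hA => ?_
    exact Set.subset_empty_iff.1 (h ▸ hA.subset_core)

end Core

/-! ### Degrees in the core, branching vertices and chains -/

section Count
open Classical
variable {V : Type*} [Fintype V]

/-- The number of neighbours of `v` in the core. -/
noncomputable def coreDeg (G : SimpleGraph V) (v : V) : ℕ :=
  (Finset.univ.filter fun u => u ∈ core G ∧ G.Adj v u).card

/-- Core vertices with at least three neighbours in the core. -/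
def Branch (G : SimpleGraph V) (v : V) : Prop := v ∈ core G ∧ 3 ≤ coreDeg G v

/-- The edges of the core both of whose ends have degree two in it. -/
def chainGraph (G : SimpleGraph V) : SimpleGraph V where
  Adj u v := G.Adj u v ∧ u ∈ core G ∧ v ∈ core G ∧ ¬ Branch G u ∧ ¬ Branch G v
  symm := ⟨fun _ _ h => ⟨h.1.symm, h.2.2.1, h.2.1, h.2.2.2.2, h.2.2.2.1⟩⟩
  loopless := ⟨fun _ h => h.1.ne rfl⟩

lemma two_le_coreDeg {G : SimpleGraph V} {v : V} (hv : v ∈ core G) : 2 ≤ coreDeg G v := by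
  obtain ⟨a, ha, b, hb, hab, h1, h2⟩ := twoDeg_core G v hv
  rw [coreDeg, ← Finset.card_pair hab]
  apply Finset.card_le_card
  intro x hx
  simp only [Finset.mem_insert, Finset.mem_singleton] at hx
  rcases hx with rfl | rfl <;> simp [*]

/-- Two neighbours in the core are all the neighbours in the core of a vertex of degree two. -/
lemma eq_or_eq_of_not_branch {G : SimpleGraph V} {v a b y : V} (hv : v ∈ core G)
    (hb : ¬ Branch G v) (ha : a ∈ core G) (hb' : b ∈ core G) (hab : a ≠ b) (h1 : G.Adj v a)
    (h2 : G.Adj v b) (hy : y ∈ core G) (h3 : G.Adj v y) : y = a ∨ y = b := by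
  by_contra hne
  push Not at hne
  refine hb ⟨hv, ?_⟩
  rw [coreDeg, ← Finset.card_eq_three.2 ⟨a, b, y, hab, hne.1.symm, hne.2.symm, rfl⟩]
  apply Finset.card_le_card
  intro x hx
  simp only [Finset.mem_insert, Finset.mem_singleton] at hx
  rcases hx with rfl | rfl | rfl <;> simp [*]

/-- A vertex set of minimum degree two in a subgraph follows the chains of the core. -/
lemma TwoDeg.chain {G K : SimpleGraph V} (hK : K ≤ G) {A : Set V} (hA : TwoDeg K A) {u v : V}
    (hu : u ∈ A) (hub : ¬ Branch G u) (hr : (chainGraph G).Reachable u v) :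
    v ∈ A ∧ ∀ y ∈ core G, G.Adj v y → K.Adj v y := by
  have hAc : A ⊆ core G := (hA.mono hK).subset_core
  have nb : ∀ v ∈ A, ¬ Branch G v → ∀ y ∈ core G, G.Adj v y → K.Adj v y ∧ y ∈ A := by
    intro v hv hvb y hy hvy
    obtain ⟨a, ha, b, hb, hab, h1, h2⟩ := hA v hv
    rcases eq_or_eq_of_not_branch (hAc hv) hvb (hAc ha) (hAc hb) hab (hK h1) (hK h2) hy hvy
      with rfl | rfl
    · exact ⟨h1, ha⟩
    · exact ⟨h2, hb⟩
  have key : v ∈ A ∧ ¬ Branch G v := by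
    obtain ⟨p⟩ := hr
    induction p with
    | nil => exact ⟨hu, hub⟩
    | cons h p ih =>
      exact ih (nb _ hu hub _ h.2.2.1 h.1).2 h.2.2.2.2
  exact ⟨key.1, fun y hy hvy => (nb v key.1 key.2 y hy hvy).1⟩

/-- An acyclic graph has at most as many edges as vertices. -/
lemma card_adj_le_of_isAcyclic {K : SimpleGraph V} (hK : K.IsAcyclic) (A : Finset V) :
    ((A ×ˢ A).filter fun p => K.Adj p.1 p.2).card ≤ 2 * A.card := by
  induction A using Finset.strongInduction with
  | H A ih =>
    rcases A.eq_empty_or_nonempty with rfl | hne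
    · simp
    -- Otherwise `A` itself has minimum degree two in `K`. Removing such a vertex loses at most two
    -- ordered pairs.
    have : ∃ v ∈ A, (A.filter fun u => K.Adj v u).card ≤ 1 := by
      by_contra hcon
      push Not at hcon
      have hT : TwoDeg K (A : Set V) := by
        intro v hv
        obtain ⟨a, ha, b, hb, hab⟩ := Finset.one_lt_card.1 (hcon v hv)
        rw [Finset.mem_filter] at ha hb
        exact ⟨a, ha.1, b, hb.1, hab, ha.2, hb.2⟩
      have := hT.eq_empty hK
      simp only [Finset.coe_eq_empty] at this
      simp [this] at hne
    obtain ⟨v, hv, hd⟩ := this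
    have h1 := ih (A.erase v) (Finset.erase_ssubset hv)
    have h2 : ((A ×ˢ A).filter fun p => K.Adj p.1 p.2) ⊆
        (((A.erase v) ×ˢ (A.erase v)).filter fun p => K.Adj p.1 p.2) ∪
        ((A.filter fun u => K.Adj v u).image (fun u => (v, u)) ∪
         (A.filter fun u => K.Adj v u).image (fun u => (u, v))) := by
      rintro ⟨a, b⟩ hab
      simp only [Finset.mem_filter, Finset.mem_product, Finset.mem_union, Finset.mem_erase,
        Finset.mem_image, Prod.mk.injEq] at hab ⊢
      by_cases hav : a = v
      · subst hav; right; left; exact ⟨b, ⟨hab.1.2, hab.2⟩, rfl, rfl⟩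
      by_cases hbv : b = v
      · subst hbv; right; right; exact ⟨a, ⟨hab.1.1, hab.2.symm⟩, rfl, rfl⟩
      · left; exact ⟨⟨⟨hav, hab.1.1⟩, hbv, hab.1.2⟩, hab.2⟩
    have h3 := Finset.card_le_card h2
    have h4 := Finset.card_union_le
      (((A.erase v) ×ˢ (A.erase v)).filter fun p => K.Adj p.1 p.2)
        ((A.filter fun u => K.Adj v u).image (fun u => (v, u)) ∪
         (A.filter fun u => K.Adj v u).image (fun u => (u, v)))
    have h5 := Finset.card_union_le ((A.filter fun u => K.Adj v u).image (fun u => (v, u)))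
         ((A.filter fun u => K.Adj v u).image (fun u => (u, v)))
    have h6 := Finset.card_image_le (s := A.filter fun u => K.Adj v u) (f := fun u => (v, u))
    have h7 := Finset.card_image_le (s := A.filter fun u => K.Adj v u) (f := fun u => (u, v))
    have h8 := Finset.card_erase_add_one hv
    omega

/-- The ordered pairs of ends of the edges of `G` that are missing in `K`. -/
noncomputable def removed (G K : SimpleGraph V) : Finset (V × V) :=
  Finset.univ.filter fun p => G.Adj p.1 p.2 ∧ ¬ K.Adj p.1 p.2

lemma mem_removed {G K : SimpleGraph V} {u v : V} :
    (u, v) ∈ removed G K ↔ G.Adj u v ∧ ¬ K.Adj u v := by simp [removed]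

/-- Inside the core the forest `K` has at most two ordered adjacent pairs per vertex, so all further
adjacent pairs of `G` there must have been removed. -/
lemma sum_coreDeg_le {G K : SimpleGraph V} (hK : K.IsAcyclic) :
    ∑ v ∈ Finset.univ.filter (· ∈ core G), (coreDeg G v - 2) ≤ (removed G K).card := by
  set A := Finset.univ.filter (· ∈ core G) with hA
  have h1 : ∑ v ∈ A, coreDeg G v = ((A ×ˢ A).filter fun p => G.Adj p.1 p.2).card := by
    rw [Finset.card_filter, Finset.sum_product]
    refine Finset.sum_congr rfl fun v _ => ?_
    rw [← Finset.card_filter, coreDeg, hA, Finset.filter_filter]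
  have h2 : ∑ v ∈ A, (coreDeg G v - 2) + 2 * A.card = ∑ v ∈ A, coreDeg G v := by
    rw [mul_comm, ← smul_eq_mul, ← Finset.sum_const, ← Finset.sum_add_distrib]
    refine Finset.sum_congr rfl fun v hv => ?_
    have := two_le_coreDeg (G := G) (v := v) (by simpa [hA] using hv)
    omega
  have h3 : ((A ×ˢ A).filter fun p => G.Adj p.1 p.2).card ≤
      ((A ×ˢ A).filter fun p => K.Adj p.1 p.2).card + (removed G K).card := by
    refine (Finset.card_le_card ?_).trans (Finset.card_union_le _ _)
    intro p hp
    rw [Finset.mem_filter] at hp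
    by_cases h : K.Adj p.1 p.2
    · simp [h, hp.1]
    · simp [removed, h, hp.2]
  have := card_adj_le_of_isAcyclic hK A
  omega

/-- The number of entries of the pool: all pairs consisting of a branching vertex and a core
vertex that is equal or adjacent to it, and two entries for each label of a chain. -/
lemma pool_card_le {G K : SimpleGraph V} (hK : K.IsAcyclic) {L : Type*}
    (lab : V → L) (hlab : ∀ u v, (chainGraph G).Adj u v → lab u = lab v) :
    (Finset.univ.filter fun p : V × V => Branch G p.1 ∧ p.2 ∈ core G ∧
        (p.1 = p.2 ∨ G.Adj p.1 p.2)).card +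
      2 * ((Finset.univ.filter fun p : V × V => (chainGraph G).Adj p.1 p.2).image
        fun p => lab p.1).card ≤ 12 * (removed G K).card := by
  set ρ := (removed G K).card
  set Bs := Finset.univ.filter fun v => Branch G v with hBs
  have hsum : ∑ v ∈ Bs, (coreDeg G v - 2) ≤ ρ :=
    (Finset.sum_le_sum_of_subset (by
      intro v hv; simp only [hBs, Finset.mem_filter, Finset.mem_univ, true_and] at hv ⊢
      exact hv.1)).trans (sum_coreDeg_le hK)
  -- Every branching vertex contributes at least one to the excess; this bounds their number by `ρ`
  -- and then their total degree by `ρ + 2ρ`.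
  have hcard : Bs.card ≤ ∑ v ∈ Bs, (coreDeg G v - 2) := by
    rw [Finset.card_eq_sum_ones]
    refine Finset.sum_le_sum fun v hv => ?_
    have : Branch G v := by simpa [hBs] using hv
    have := this.2
    omega
  have hdeg : ∑ v ∈ Bs, coreDeg G v ≤ 3 * ρ := by
    have : ∑ v ∈ Bs, coreDeg G v = ∑ v ∈ Bs, (coreDeg G v - 2) + 2 * Bs.card := by
      rw [mul_comm, ← smul_eq_mul, ← Finset.sum_const, ← Finset.sum_add_distrib]
      refine Finset.sum_congr rfl fun v hv => ?_
      have : Branch G v := by simpa [hBs] using hv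
      have := this.2
      omega
    omega
  have hN : (Finset.univ.filter fun p : V × V => Branch G p.1 ∧ p.2 ∈ core G ∧
      G.Adj p.1 p.2).card ≤ ∑ v ∈ Bs, coreDeg G v := by
    have : (Finset.univ.filter fun p : V × V => Branch G p.1 ∧ p.2 ∈ core G ∧
        G.Adj p.1 p.2) ⊆ (Bs.sigma (fun v => Finset.univ.filter fun u =>
          u ∈ core G ∧ G.Adj v u)).image fun s => (s.1, s.2) := by
      rintro ⟨a, b⟩ h
      simp only [Finset.mem_filter, Finset.mem_univ, true_and] at h
      simp only [Finset.mem_image, Finset.mem_sigma, Finset.mem_filter, Finset.mem_univ,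
        true_and, hBs]
      exact ⟨⟨a, b⟩, h, rfl⟩
    refine (Finset.card_le_card this).trans (Finset.card_image_le.trans ?_)
    rw [Finset.card_sigma]
    rfl
  have h1 : (Finset.univ.filter fun p : V × V => Branch G p.1 ∧ p.2 ∈ core G ∧
        (p.1 = p.2 ∨ G.Adj p.1 p.2)).card ≤ 4 * ρ := by
    have : (Finset.univ.filter fun p : V × V => Branch G p.1 ∧ p.2 ∈ core G ∧
        (p.1 = p.2 ∨ G.Adj p.1 p.2)) ⊆ Bs.image (fun v => (v, v)) ∪
        (Finset.univ.filter fun p : V × V => Branch G p.1 ∧ p.2 ∈ core G ∧ G.Adj p.1 p.2) := by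
      rintro ⟨a, b⟩ h
      simp only [Finset.mem_filter, Finset.mem_univ, true_and, Finset.mem_union,
        Finset.mem_image, hBs] at h ⊢
      rcases h with ⟨h1, h2, h3 | h3⟩
      · exact Or.inl ⟨a, h1, by rw [h3]⟩
      · exact Or.inr ⟨h1, h2, h3⟩
    have a1 := Finset.card_le_card this
    have a2 := Finset.card_union_le (Bs.image (fun v => (v, v)))
      (Finset.univ.filter fun p : V × V => Branch G p.1 ∧ p.2 ∈ core G ∧ G.Adj p.1 p.2)
    have a3 := Finset.card_image_le (s := Bs) (f := fun v => (v, v))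
    omega
  -- Places where a chain can stop being a cycle of `K`: at most `3ρ` core neighbours of branching
  -- vertices and `ρ` first ends of removed pairs. Each label of a chain edge is charged to such a
  -- vertex, and labels count twice, which gives `4ρ + 2 * 4ρ = 12ρ`.
  set W := (Finset.univ.filter fun p : V × V => Branch G p.1 ∧ p.2 ∈ core G ∧
      G.Adj p.1 p.2).image Prod.snd ∪ (removed G K).image Prod.fst with hW
  have hWc : W.card ≤ 4 * ρ := by
    have a2 := Finset.card_union_le ((Finset.univ.filter fun p : V × V => Branch G p.1 ∧
      p.2 ∈ core G ∧ G.Adj p.1 p.2).image Prod.snd) ((removed G K).image Prod.fst)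
    have a3 := Finset.card_image_le (s := Finset.univ.filter fun p : V × V => Branch G p.1 ∧
      p.2 ∈ core G ∧ G.Adj p.1 p.2) (f := Prod.snd)
    have a4 := Finset.card_image_le (s := removed G K) (f := Prod.fst)
    rw [hW]
    omega
  have h2 : ((Finset.univ.filter fun p : V × V => (chainGraph G).Adj p.1 p.2).image
        fun p => lab p.1) ⊆ W.image lab := by
    intro l hl
    simp only [Finset.mem_image, Finset.mem_filter, Finset.mem_univ, true_and,
      Prod.exists] at hl
    obtain ⟨u, u', huu, rfl⟩ := hl
    rw [Finset.mem_image]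
    by_contra hcon
    push Not at hcon
    -- If no vertex with this label lies in `W`, then all core neighbours of the vertices in this
    -- set are in it and are still joined to them in `K`.
    have hT : TwoDeg K {v | v ∈ core G ∧ ¬ Branch G v ∧ lab v = lab u} := by
      rintro v ⟨hv, hvb, hvl⟩
      obtain ⟨a, ha, b, hb, hab, e1, e2⟩ := twoDeg_core G v hv
      have hvW : v ∉ W := fun h => hcon v h hvl
      have step : ∀ c ∈ core G, G.Adj v c → (¬ Branch G c ∧ lab c = lab u) ∧ K.Adj v c := by
        intro c hc e
        have hcb : ¬ Branch G c := by
          intro hcb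
          apply hvW
          rw [hW, Finset.mem_union]
          left
          rw [Finset.mem_image]
          exact ⟨(c, v), by simp [hcb, hv, e.symm], rfl⟩
        refine ⟨⟨hcb, ?_⟩, ?_⟩
        · rw [← hvl]; exact (hlab v c ⟨e, hv, hc, hvb, hcb⟩).symm
        · by_contra hk
          apply hvW
          rw [hW, Finset.mem_union]
          right
          rw [Finset.mem_image]
          exact ⟨(v, c), mem_removed.2 ⟨e, hk⟩, rfl⟩
      exact ⟨a, ⟨ha, (step a ha e1).1⟩, b, ⟨hb, (step b hb e2).1⟩, hab, (step a ha e1).2,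
        (step b hb e2).2⟩
    have := hT.eq_empty hK
    exact (Set.mem_empty_iff_false u).1 (this ▸ ⟨huu.2.1, huu.2.2.2.1, rfl⟩)
  have h3 := (Finset.card_le_card h2).trans Finset.card_image_le
  omega

end Count
end DiskShrinking

namespace DiskShrinking

/-! ### Moving the removed edges into the pool -/

section Exchange
open Classical
variable {V : Type*}

/-- Used to hand the amounts of a removed edge `uv` to the edge `bc` that replaces it, also when the
two edges share an end. -/
lemma exists_perm {u v b c : V} (huv : u ≠ v) (hbc : b ≠ c) :
    ∃ σ : Equiv.Perm V, σ b = u ∧ σ c = v ∧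
      ∀ p, p ≠ u → p ≠ v → p ≠ b → p ≠ c → σ p = p := by
  refine ⟨Equiv.swap (Equiv.swap b u c) v * Equiv.swap b u, ?_, ?_, ?_⟩
  · have : u ≠ Equiv.swap b u c := by
      intro h
      have := congrArg (Equiv.swap b u) h
      simp at this
      exact hbc this
    simp [Equiv.swap_apply_of_ne_of_ne this huv]
  · simp
  · intro p hu hv hb hc
    have h1 : Equiv.swap b u p = p := Equiv.swap_apply_of_ne_of_ne hb hu
    have : p ≠ Equiv.swap b u c := by
      intro h
      have := congrArg (Equiv.swap b u) h
      rw [h1] at this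
      simp at this
      exact hc this
    simp [h1, Equiv.swap_apply_of_ne_of_ne this hv]

variable [Fintype V]

/-- The shrinking amounts `x` lie between `0` and `a` and cover the edges of `G` that are missing
in `K` with respect to the demands `w`. -/
structure Covers (G K : SimpleGraph V) (w : V → V → ℝ) (a : ℝ) (x : V → ℝ) : Prop where
  nonneg : ∀ v, 0 ≤ x v
  le : ∀ v, x v ≤ a
  cover : ∀ u v, G.Adj u v → ¬ K.Adj u v → w u v ≤ x u + x v

/-- The removed edges, counted twice if they have an end outside the pool. -/
noncomputable def removedWeight (G K : SimpleGraph V) (pool : Set V) : ℕ :=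
  ∑ p ∈ removed G K, if p.1 ∈ pool ∧ p.2 ∈ pool then 1 else 2

/-- A set of minimum degree two that misses an end of the new edge would already have minimum degree
two in `K`. -/
lemma exists_twoDeg_of_not_isAcyclic {K : SimpleGraph V} (hK : K.IsAcyclic) {u v : V}
    (h : ¬ (K ⊔ SimpleGraph.edge u v).IsAcyclic) :
    ∃ A, TwoDeg (K ⊔ SimpleGraph.edge u v) A ∧ u ∈ A ∧ v ∈ A := by
  by_contra hcon
  push Not at hcon
  refine h (isAcyclic_of_twoDeg fun A hA => ?_)
  refine TwoDeg.eq_empty (hA.of_adj ?_) hK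
  intro p hp q hq e
  rw [SimpleGraph.sup_adj, SimpleGraph.edge_adj] at e
  rcases e with e | ⟨⟨rfl, rfl⟩ | ⟨rfl, rfl⟩, _⟩
  · exact e
  · exact absurd hq (hcon A hA hp)
  · exact absurd hp (hcon A hA hq)

/-- The two orientations of `uv` leave with weight two each, and those of `bc` enter with weight at
most one each. -/
lemma removedWeight_lt {G K K' : SimpleGraph V} {pool : Set V} {u v b c : V} (huv : G.Adj u v)
    (hn : ¬ K.Adj u v) (hbad : ¬ (u ∈ pool ∧ v ∈ pool)) (hbc : b ≠ c) (hbp : b ∈ pool)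
    (hcp : c ∈ pool) (h : ∀ p q, G.Adj p q → ¬ K'.Adj p q →
      (¬ K.Adj p q ∧ ¬ (p = u ∧ q = v) ∧ ¬ (p = v ∧ q = u)) ∨ (p = b ∧ q = c) ∨ (p = c ∧ q = b)) :
    removedWeight G K' pool < removedWeight G K pool := by
  have hsub : removed G K' ⊆ ((removed G K).erase (u, v)).erase (v, u) ∪ {(b, c), (c, b)} := by
    rintro ⟨p, q⟩ hpq
    rw [mem_removed] at hpq
    have h' := h p q hpq.1 hpq.2
    have h1 := hpq.1
    simp only [Finset.mem_union, Finset.mem_erase, mem_removed, Finset.mem_insert,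
      Finset.mem_singleton, Prod.mk.injEq, ne_eq]
    tauto
  have h1 := Finset.sum_le_sum_of_subset (f := fun p : V × V =>
    if p.1 ∈ pool ∧ p.2 ∈ pool then 1 else 2) hsub
  have h2 := Finset.sum_union_inter (s₁ := ((removed G K).erase (u, v)).erase (v, u))
    (s₂ := {(b, c), (c, b)}) (f := fun p : V × V =>
    if p.1 ∈ pool ∧ p.2 ∈ pool then 1 else 2)
  have h3 : (v, u) ∈ (removed G K).erase (u, v) := by
    simp only [Finset.mem_erase, mem_removed, ne_eq, Prod.mk.injEq]
    exact ⟨fun h => huv.ne h.2, huv.symm, fun h => hn h.symm⟩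
  have h4 := Finset.add_sum_erase _ (fun p : V × V =>
    if p.1 ∈ pool ∧ p.2 ∈ pool then 1 else 2) h3
  have h5 := Finset.add_sum_erase _ (fun p : V × V =>
    if p.1 ∈ pool ∧ p.2 ∈ pool then 1 else 2) (mem_removed.2 ⟨huv, hn⟩)
  have h6 : (∑ p ∈ ({(b, c), (c, b)} : Finset (V × V)),
      if p.1 ∈ pool ∧ p.2 ∈ pool then 1 else 2) = 2 := by
    rw [Finset.sum_pair (fun h => hbc (Prod.ext_iff.1 h).1)]
    simp [hbp, hcp]
  have h7 : (if u ∈ pool ∧ v ∈ pool then 1 else 2) = 2 := if_neg hbad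
  have h8 : (if v ∈ pool ∧ u ∈ pool then 1 else 2) = 2 := if_neg fun h => hbad ⟨h.2, h.1⟩
  simp only [removedWeight] at *
  omega

-- Take a pair of a forest and a permutation of the amounts that minimises `removedWeight`. A
-- removed edge outside the pool would have to be a chain edge, and exchanging it for a longest edge
-- of its chain would lower the weight. The intermediate forests need not be disk graphs; only the
-- covering condition is carried along.
set_option maxHeartbeats 1000000 in
theorem exists_covers_removed_subset {G K : SimpleGraph V} {w : V → V → ℝ} {a : ℝ} {x : V → ℝ}
    (hw : ∀ u v, w u v = w v u) (pool : Set V)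
    (hbranch : ∀ u v, Branch G u → v ∈ core G → (u = v ∨ G.Adj u v) → v ∈ pool)
    (hchain : ∀ u v, (chainGraph G).Adj u v → ∃ b c, (chainGraph G).Adj b c ∧
      (chainGraph G).Reachable u b ∧ b ∈ pool ∧ c ∈ pool ∧ w b c ≤ w u v)
    (hKG : K ≤ G) (hK : K.IsAcyclic) (hx : Covers G K w a x) :
    ∃ (K' : SimpleGraph V) (σ : Equiv.Perm V), K' ≤ G ∧ K'.IsAcyclic ∧
      Covers G K' w a (x ∘ σ) ∧ ∀ u v, G.Adj u v → ¬ K'.Adj u v → u ∈ pool ∧ v ∈ pool := by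
  let S : Set ℕ := {m | ∃ (K : SimpleGraph V) (σ : Equiv.Perm V), K ≤ G ∧ K.IsAcyclic ∧
      Covers G K w a (x ∘ σ) ∧ removedWeight G K pool = m}
  have hne : S.Nonempty := ⟨_, K, 1, hKG, hK, hx, rfl⟩
  obtain ⟨K, σ, hKG, hK, hx, hm⟩ := Nat.sInf_mem hne
  have hmin : ∀ (K' : SimpleGraph V) (τ : Equiv.Perm V), K' ≤ G → K'.IsAcyclic →
      Covers G K' w a (x ∘ τ) → removedWeight G K pool ≤ removedWeight G K' pool := by
    intro K' τ h1 h2 h3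
    rw [hm]
    exact Nat.sInf_le ⟨K', τ, h1, h2, h3, rfl⟩
  refine ⟨K, σ, hKG, hK, hx, ?_⟩
  clear hm hne
  have hsup : ∀ u v, G.Adj u v → K ⊔ SimpleGraph.edge u v ≤ G := by
    intro u v huv
    exact sup_le hKG (by rw [SimpleGraph.edge_le_iff]; exact Or.inr huv)
  -- By minimality no removed edge can be restored without closing a cycle.
  have hcyc : ∀ u v, G.Adj u v → ¬ K.Adj u v →
      ∃ A, TwoDeg (K ⊔ SimpleGraph.edge u v) A ∧ u ∈ A ∧ v ∈ A := by
    intro u v huv hn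
    refine exists_twoDeg_of_not_isAcyclic hK fun hac => ?_
    have := hmin _ σ (hsup u v huv) hac ⟨hx.nonneg, hx.le, fun p q h1 h2 =>
      hx.cover p q h1 fun h => h2 (Or.inl h)⟩
    refine absurd this (not_le.2 ?_)
    refine Finset.sum_lt_sum_of_subset (i := (u, v)) ?_ (mem_removed.2 ⟨huv, hn⟩) ?_ ?_ ?_
    · rintro ⟨p, q⟩ h
      rw [mem_removed] at h ⊢
      exact ⟨h.1, fun h' => h.2 (Or.inl h')⟩
    · rw [mem_removed, SimpleGraph.sup_adj, SimpleGraph.edge_adj]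
      simp [huv.ne]
    · split_ifs <;> omega
    · intros; exact Nat.zero_le _
  have hcore : ∀ u v, G.Adj u v → ¬ K.Adj u v → u ∈ core G ∧ v ∈ core G := by
    intro u v h1 h2
    obtain ⟨A, hA, hu, hv⟩ := hcyc u v h1 h2
    exact ⟨(hA.mono (hsup u v h1)).subset_core hu, (hA.mono (hsup u v h1)).subset_core hv⟩
  -- The cycle closed by `uv` uses every core edge at a vertex `u` that does not branch, so no
  -- second removed edge ends there.
  have hbr : ∀ u v v', G.Adj u v → ¬ K.Adj u v → G.Adj u v' → ¬ K.Adj u v' → v ≠ v' →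
      Branch G u := by
    intro u v v' h1 h2 h3 h4 hvv
    by_contra hb
    obtain ⟨A, hA, hu, hv⟩ := hcyc u v h1 h2
    obtain ⟨_, h⟩ := hA.chain (hsup u v h1) hu hb (SimpleGraph.Reachable.refl u)
    have := h v' (hcore u v' h3 h4).2 h3
    rw [SimpleGraph.sup_adj, SimpleGraph.edge_adj] at this
    rcases this with h | ⟨⟨-, h⟩ | ⟨-, h⟩, -⟩
    · exact h4 h
    · exact hvv h.symm
    · exact h3.ne h.symm
  intro u v huv hn
  by_contra hbad
  have hu : ¬ Branch G u := fun hb =>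
    hbad ⟨hbranch u u hb (hcore u v huv hn).1 (Or.inl rfl),
      hbranch u v hb (hcore u v huv hn).2 (Or.inr huv)⟩
  have hv : ¬ Branch G v := fun hb =>
    hbad ⟨hbranch v u hb (hcore u v huv hn).1 (Or.inr huv.symm),
      hbranch v v hb (hcore u v huv hn).2 (Or.inl rfl)⟩
  have hch : (chainGraph G).Adj u v := ⟨huv, (hcore u v huv hn).1, (hcore u v huv hn).2, hu, hv⟩
  obtain ⟨b, c, hbc, hub, hbp, hcp, hwbc⟩ := hchain u v hch
  obtain ⟨A, hA, huA, hvA⟩ := hcyc u v huv hn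
  have hB := hA.chain (hsup u v huv) huA hu hub
  have hC := hA.chain (hsup u v huv) huA hu (hub.trans hbc.reachable)
  have hne1 : ¬ (u = b ∧ v = c) := by rintro ⟨rfl, rfl⟩; exact hbad ⟨hbp, hcp⟩
  have hne2 : ¬ (u = c ∧ v = b) := by rintro ⟨rfl, rfl⟩; exact hbad ⟨hcp, hbp⟩
  -- The cycle closed by `uv` runs through the whole chain, so `uv` is the only edge of the chain
  -- that `K` lacks.
  have hKbc : K.Adj b c := by
    have := hB.2 c hbc.2.2.1 hbc.1
    rw [SimpleGraph.sup_adj, SimpleGraph.edge_adj] at this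
    rcases this with h | ⟨h | h, -⟩
    · exact h
    · exact absurd ⟨h.1.symm, h.2.symm⟩ hne1
    · exact absurd ⟨h.2.symm, h.1.symm⟩ hne2
  -- All other removed edges avoid the four vertices whose amounts will be moved, so their demands
  -- stay covered.
  have hfar : ∀ p q, G.Adj p q → ¬ K.Adj p q → ¬ (p = u ∧ q = v) → ¬ (p = v ∧ q = u) →
      p ≠ u ∧ p ≠ v ∧ p ≠ b ∧ p ≠ c := by
    intro p q h1 h2 h3 h4
    refine ⟨?_, ?_, ?_, ?_⟩
    · rintro rfl
      exact hu (hbr p v q huv hn h1 h2 fun h => h3 ⟨rfl, h.symm⟩)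
    · rintro rfl
      exact hv (hbr p u q huv.symm (fun h => hn h.symm) h1 h2 fun h => h4 ⟨rfl, h.symm⟩)
    · rintro rfl
      have := hB.2 q (hcore p q h1 h2).2 h1
      rw [SimpleGraph.sup_adj, SimpleGraph.edge_adj] at this
      rcases this with h | ⟨⟨e, e'⟩ | ⟨e, e'⟩, -⟩
      · exact h2 h
      · exact h3 ⟨e, e'⟩
      · exact h4 ⟨e, e'⟩
    · rintro rfl
      have := hC.2 q (hcore p q h1 h2).2 h1
      rw [SimpleGraph.sup_adj, SimpleGraph.edge_adj] at this
      rcases this with h | ⟨⟨e, e'⟩ | ⟨e, e'⟩, -⟩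
      · exact h2 h
      · exact h3 ⟨e, e'⟩
      · exact h4 ⟨e, e'⟩
  set K' := (K ⊔ SimpleGraph.edge u v) \ SimpleGraph.edge b c with hK'
  have hK'G : K' ≤ G := sdiff_le.trans (hsup u v huv)
  have hK'adj : ∀ p q, G.Adj p q → (K'.Adj p q ↔ (K.Adj p q ∨ (p = u ∧ q = v) ∨ (p = v ∧ q = u)) ∧
      ¬ ((p = b ∧ q = c) ∨ (p = c ∧ q = b))) := by
    intro p q hpq
    rw [hK', SimpleGraph.sdiff_adj, SimpleGraph.sup_adj, SimpleGraph.edge_adj,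
      SimpleGraph.edge_adj]
    have := hpq.ne
    grind
  -- A set of minimum degree two through `u` would follow the chain and need the deleted edge `bc`;
  -- one that avoids `u` does not use the edge `uv`.
  have hK'ac : K'.IsAcyclic := by
    refine isAcyclic_of_twoDeg fun D hD => ?_
    by_cases huD : u ∈ D
    · have h := (hD.chain hK'G huD hu hub).2 c hbc.2.2.1 hbc.1
      exact absurd (Or.inl ⟨rfl, rfl⟩) ((hK'adj b c hbc.1).1 h).2
    · refine TwoDeg.eq_empty (hD.of_adj ?_) hK
      intro p hp q hq e
      rcases ((hK'adj p q (hK'G e)).1 e).1 with h | ⟨rfl, -⟩ | ⟨-, rfl⟩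
      · exact h
      · exact absurd hp huD
      · exact absurd hq huD
  obtain ⟨τ, hτb, hτc, hτ⟩ := exists_perm huv.ne hbc.ne
  have hcov : Covers G K' w a (x ∘ (σ * τ)) := by
    refine ⟨fun p => hx.nonneg (τ p), fun p => hx.le (τ p), ?_⟩
    intro p q hpq hpq'
    rw [hK'adj p q hpq] at hpq'
    have hxuv := hx.cover u v huv hn
    simp only [Function.comp_apply, Equiv.Perm.coe_mul] at hxuv ⊢
    by_cases h1 : p = b ∧ q = c
    · rw [h1.1, h1.2, hτb, hτc]; exact hwbc.trans hxuv
    by_cases h2 : p = c ∧ q = b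
    · rw [h2.1, h2.2, hτb, hτc, hw, add_comm]; exact hwbc.trans hxuv
    have h3 : ¬ K.Adj p q ∧ ¬ (p = u ∧ q = v) ∧ ¬ (p = v ∧ q = u) := by
      have h12 : ¬ (p = b ∧ q = c ∨ p = c ∧ q = b) := fun h => h.elim h1 h2
      exact ⟨fun h => hpq' ⟨Or.inl h, h12⟩, fun h => hpq' ⟨Or.inr (Or.inl h), h12⟩,
        fun h => hpq' ⟨Or.inr (Or.inr h), h12⟩⟩
    obtain ⟨e1, e2, e3, e4⟩ := hfar p q hpq h3.1 h3.2.1 h3.2.2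
    obtain ⟨f1, f2, f3, f4⟩ := hfar q p hpq.symm (fun h => h3.1 h.symm)
      (fun h => h3.2.2 ⟨h.2, h.1⟩) (fun h => h3.2.1 ⟨h.2, h.1⟩)
    rw [hτ p e1 e2 e3 e4, hτ q f1 f2 f3 f4]
    exact hx.cover p q hpq h3.1
  have hlt : removedWeight G K' pool < removedWeight G K pool := by
    refine removedWeight_lt huv hn hbad hbc.ne hbp hcp fun p q h1 h2 => ?_
    rw [hK'adj p q h1] at h2
    tauto
  exact absurd (hmin K' (σ * τ) hK'G hK'ac hcov) (not_le.2 hlt)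

end Exchange
end DiskShrinking

namespace DiskShrinking

/-! ### Vertices of the covering polytope -/

section Cover
open Classical
variable {V : Type*}

/-- One step of the evaluation of a walk: at `v`, an amount that makes the demand tight. -/
noncomputable def walkStep (w : V → V → ℝ) (s : V × ℝ) (v : V) : V × ℝ :=
  -- Repeating the current vertex does nothing, which permits padding a walk to a fixed length.
  if v = s.1 then s else (v, w s.1 v - s.2)

/-- The double cover of the tight pairs within `N`. -/
def tightCover (t : V → V → Prop) (ht : ∀ u v, t u v → t v u) (N : Set V) :
    SimpleGraph (V × Bool) where
  Adj p q := t p.1 q.1 ∧ p.1 ∈ N ∧ q.1 ∈ N ∧ q.2 = !p.2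
  symm := ⟨fun p q h => ⟨ht _ _ h.1, h.2.2.1, h.2.1, by simp [h.2.2.2]⟩⟩
  loopless := ⟨fun p h => by have := h.2.2.2; simp at this⟩

/-- Along tight pairs an error `η` in the starting amount only changes its sign at each step. The
Boolean layer of the double cover records this sign. -/
lemma foldl_walkStep {w : V → V → ℝ} {z : V → ℝ} {t : V → V → Prop}
    (ht : ∀ u v, t u v → t v u) (N : Set V) (hne : ∀ u v, t u v → u ≠ v)
    (htw : ∀ u v, t u v → w u v = z u + z v) {p q : V × Bool}
    (W : (tightCover t ht N).Walk p q) (η : ℝ) :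
    List.foldl (walkStep w) (p.1, z p.1 + (if p.2 then η else -η)) (W.support.tail.map Prod.fst) =
      (q.1, z q.1 + (if q.2 then η else -η)) := by
  induction W with
  | nil => simp
  | @cons p r q h W ih =>
    have e : W.support = r :: W.support.tail := by
      cases W <;> simp
    rw [SimpleGraph.Walk.support_cons, List.tail_cons, e, List.map_cons, List.foldl_cons]
    have : walkStep w (p.1, z p.1 + (if p.2 then η else -η)) r.1 =
        (r.1, z r.1 + (if r.2 then η else -η)) := by
      rw [walkStep, if_neg (hne _ _ h.1).symm]
      refine Prod.ext rfl ?_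
      change w p.1 r.1 - (z p.1 + (if p.2 then η else -η)) = z r.1 + (if r.2 then η else -η)
      rw [htw _ _ h.1, h.2.2.2]
      cases p.2
      · simp
      · simp
        ring
    rw [this]
    exact ih

variable [Fintype V]

/-- The amounts in `[0, a]`, supported on `T`, that meet the demands `w` on the pairs in `R`. -/
def coverPolytope (R : V → V → Prop) (w : V → V → ℝ) (a : ℝ) (T : Finset V) : Set (V → ℝ) :=
  {y | (∀ v, 0 ≤ y v ∧ y v ≤ a) ∧ (∀ v, v ∉ T → y v = 0) ∧ ∀ u v, R u v → w u v ≤ y u + y v}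

/-- An extreme point of the compact set of minimisers works: if both `z + d` and `z - d` are
feasible, neither can be cheaper than `z`, so both are minimisers too. -/
lemma exists_extreme_min {R : V → V → Prop} {w : V → V → ℝ} {a : ℝ} {T : Finset V} {x : V → ℝ}
    (hx : x ∈ coverPolytope R w a T) :
    ∃ z ∈ coverPolytope R w a T, ∑ v, z v ≤ ∑ v, x v ∧
      ∀ d : V → ℝ, z + d ∈ coverPolytope R w a T → z - d ∈ coverPolytope R w a T → d = 0 := by
  set Q := coverPolytope R w a T with hQ
  have hclosed : IsClosed Q := by
    have : Q = (⋂ v, {y : V → ℝ | 0 ≤ y v} ∩ {y | y v ≤ a}) ∩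
        ((⋂ v, ⋂ (_ : v ∉ T), {y | y v = 0}) ∩
          ⋂ u, ⋂ v, ⋂ (_ : R u v), {y | w u v ≤ y u + y v}) := by
      ext y
      simp [hQ, coverPolytope]
    rw [this]
    refine IsClosed.inter (isClosed_iInter fun v => ?_) (IsClosed.inter ?_ ?_)
    · exact (isClosed_le continuous_const (continuous_apply v)).inter
        (isClosed_le (continuous_apply v) continuous_const)
    · exact isClosed_iInter fun v => isClosed_iInter fun _ =>
        isClosed_eq (continuous_apply v) continuous_const
    · exact isClosed_iInter fun u => isClosed_iInter fun v => isClosed_iInter fun _ =>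
        isClosed_le continuous_const ((continuous_apply u).add (continuous_apply v))
  have hcomp : IsCompact Q := by
    refine IsCompact.of_isClosed_subset (isCompact_Icc (a := (0 : V → ℝ)) (b := fun _ => a))
      hclosed ?_
    intro y hy
    exact ⟨fun v => (hy.1 v).1, fun v => (hy.1 v).2⟩
  have hcont : Continuous fun y : V → ℝ => ∑ v, y v :=
    continuous_finsetSum _ fun v _ => continuous_apply v
  obtain ⟨y₀, hy₀, hmin⟩ := hcomp.exists_isMinOn ⟨x, hx⟩ hcont.continuousOn
  have hmin' : ∀ y ∈ Q, ∑ v, y₀ v ≤ ∑ v, y v := fun y hy => hmin hy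
  have hMc : IsCompact (Q ∩ {y | ∑ v, y v ≤ ∑ v, y₀ v}) :=
    hcomp.inter_right (isClosed_le hcont continuous_const)
  obtain ⟨z, hz⟩ := hMc.extremePoints_nonempty ⟨y₀, hy₀, le_refl (∑ v, y₀ v)⟩
  rw [mem_extremePoints] at hz
  obtain ⟨⟨hzQ, hzm⟩, hext⟩ := hz
  refine ⟨z, hzQ, le_trans hzm (hmin' x hx), fun d h1 h2 => ?_⟩
  have s1 := hmin' _ h1
  have s2 := hmin' _ h2
  simp only [Pi.add_apply, Pi.sub_apply, Finset.sum_add_distrib, Finset.sum_sub_distrib] at s1 s2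
  have hzm' : ∑ v, z v ≤ ∑ v, y₀ v := hzm
  have m1 : z + d ∈ Q ∩ {y | ∑ v, y v ≤ ∑ v, y₀ v} := by
    refine ⟨h1, ?_⟩
    simp only [Set.mem_ofPred_eq, Pi.add_apply, Finset.sum_add_distrib]
    linarith
  have m2 : z - d ∈ Q ∩ {y | ∑ v, y v ≤ ∑ v, y₀ v} := by
    refine ⟨h2, ?_⟩
    simp only [Set.mem_ofPred_eq, Pi.sub_apply, Finset.sum_sub_distrib]
    linarith
  have := (hext _ m1 _ m2 ⟨1 / 2, 1 / 2, by norm_num, by norm_num, by norm_num, by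
    ext v
    simp
    ring⟩).1
  simpa using this

/-- At a vertex of the polytope every amount comes from the evaluation of a short walk. -/
theorem exists_walk_of_extreme {R : V → V → Prop} (hR : ∀ u v, R u v → R v u)
    (hRne : ∀ u v, R u v → u ≠ v) {w : V → V → ℝ} (hw : ∀ u v, w u v = w v u) {a : ℝ}
    {T : Finset V} {pool : Set V} (hpool : ∀ u v, R u v → u ∈ pool) (hT : ∀ v ∈ T, v ∈ pool)
    {z : V → ℝ} (hz : z ∈ coverPolytope R w a T)
    (hext : ∀ d : V → ℝ, z + d ∈ coverPolytope R w a T → z - d ∈ coverPolytope R w a T → d = 0)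
    {p : V} (hp : p ∈ T) :
    ∃ v ∈ pool, ∃ (y y' : ℝ) (l : List V), (y = 0 ∨ y = a) ∧ (∀ u ∈ l, u ∈ pool) ∧
      l.length ≤ 2 * T.card ∧ List.foldl (walkStep w) (v, y) l = (p, y') ∧
      (z p = y' ∨ z p = y' / 2) := by
  set t : V → V → Prop := fun u v => R u v ∧ w u v = z u + z v with ht
  have htsymm : ∀ u v, t u v → t v u := fun u v h => ⟨hR u v h.1, by rw [hw, h.2, add_comm]⟩
  set N : Set V := {v | 0 < z v ∧ z v < a} with hN
  have hNT : ∀ v ∈ N, v ∈ T := by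
    intro v hv
    by_contra h
    have := hz.2.1 v h
    exact absurd hv.1 (by rw [this]; exact lt_irrefl _)
  have hanchor : ∀ v, v ∉ N → z v = 0 ∨ z v = a := by
    intro v hv
    have h1 := hz.1 v
    by_contra hcon
    push Not at hcon
    exact hv ⟨lt_of_le_of_ne h1.1 hcon.1.symm, lt_of_le_of_ne h1.2 hcon.2⟩
  by_cases hpN : p ∉ N
  · exact ⟨p, hT p hp, z p, z p, [], hanchor p hpN, by simp, by simp, rfl, Or.inl rfl⟩
  rw [not_not] at hpN
  set C := tightCover t htsymm N with hC
  have hsupp' : ∀ {q r : V × Bool} (W : C.Walk q r), r.1 ∈ N → ∀ u ∈ W.support, u.1 ∈ N := by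
    intro q r W hr
    induction W with
    | nil => intro u hu; rw [SimpleGraph.Walk.mem_support_nil_iff] at hu; rwa [hu]
    | cons h W ih =>
      intro u hu
      rw [SimpleGraph.Walk.support_cons, List.mem_cons] at hu
      rcases hu with rfl | hu
      · exact h.2.1
      · exact ih hr u hu
  have hsupp : ∀ {q : V × Bool} (W : C.Walk q (p, true)), ∀ u ∈ W.support, u.1 ∈ N :=
    fun W => hsupp' W hpN
  have hlen : ∀ {q : V × Bool} (W : C.Walk q (p, true)), W.IsPath →
      W.support.length ≤ 2 * T.card := by
    intro q W hW
    rw [← List.toFinset_card_of_nodup hW.support_nodup]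
    have : W.support.toFinset ⊆ T ×ˢ (Finset.univ : Finset Bool) := by
      intro u hu
      rw [List.mem_toFinset] at hu
      rw [Finset.mem_product]
      exact ⟨hNT _ (hsupp W u hu), Finset.mem_univ _⟩
    refine (Finset.card_le_card this).trans ?_
    rw [Finset.card_product]
    simp [mul_comm]
  have hfold := fun {q : V × Bool} (W : C.Walk q (p, true)) (η : ℝ) =>
    foldl_walkStep htsymm N (fun u v h => hRne u v h.1) (fun u v h => h.2) W η
  -- This is a closed walk of odd length at `p`. Started with amount 0, that is with error `η = z p`
  -- in the negative layer, it returns with `2 * z p`.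
  by_cases hA : C.Reachable (p, false) (p, true)
  · obtain ⟨W, hW⟩ := hA.exists_isPath
    refine ⟨p, hT p hp, 0, 2 * z p, W.support.tail.map Prod.fst, Or.inl rfl, ?_, ?_, ?_, ?_⟩
    · intro u hu
      obtain ⟨x, hx, rfl⟩ := List.mem_map.1 hu
      exact hT _ (hNT _ (hsupp W x (List.mem_of_mem_tail hx)))
    · have := hlen W hW
      rw [List.length_map, List.length_tail]
      omega
    · have := hfold W (z p)
      simpa [two_mul] using this
    · right; ring
  -- Here a tight pair leads from an amount 0 or `a` into the component of `p`; starting at that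
  -- vertex there is no error.
  by_cases hB : ∃ (q : V) (v : V × Bool), q ∉ N ∧ t q v.1 ∧ C.Reachable v (p, true)
  · obtain ⟨q, v, hq, hqv, hr⟩ := hB
    obtain ⟨W, hW⟩ := hr.exists_isPath
    refine ⟨q, hpool q v.1 hqv.1, z q, z p, v.1 :: W.support.tail.map Prod.fst, hanchor q hq,
      ?_, ?_, ?_, Or.inl rfl⟩
    · intro u hu
      rcases List.mem_cons.1 hu with rfl | hu
      · exact hpool _ _ (hR _ _ hqv.1)
      · obtain ⟨x, hx, rfl⟩ := List.mem_map.1 hu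
        exact hT _ (hNT _ (hsupp W x (List.mem_of_mem_tail hx)))
    · have := hlen W hW
      have h2 : 0 < W.support.length := List.length_pos_of_ne_nil W.support_ne_nil
      rw [List.length_cons, List.length_map, List.length_tail]
      omega
    · have := hfold W 0
      rw [List.foldl_cons]
      have e : walkStep w (q, z q) v.1 = (v.1, z v.1) := by
        rw [walkStep, if_neg (hRne _ _ hqv.1).symm]
        refine Prod.ext rfl ?_
        change w q v.1 - z q = z v.1
        rw [hqv.2]; ring
      rw [e]
      simpa using this
  exfalso
  push Not at hB
  -- If neither case holds, `z` can move: up on one side of the component of `p` and down on the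
  -- other. The two layers are separate, so `d p = 1`; tight sums are preserved because the
  -- component has no tight neighbour outside `N`.
  set d : V → ℝ := fun q => (if C.Reachable (q, true) (p, true) then 1 else 0) -
    (if C.Reachable (q, false) (p, true) then 1 else 0) with hd
  have hdN : ∀ q, q ∉ N → d q = 0 := by
    intro q hq
    have : ∀ b, ¬ C.Reachable (q, b) (p, true) := by
      rintro b ⟨W⟩
      exact hq (hsupp W _ W.start_mem_support)
    simp [hd, this]
  have hdt : ∀ u v, t u v → d u + d v = 0 := by
    intro u v huv
    by_cases hu : u ∈ N
    · by_cases hv : v ∈ N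
      · have e : ∀ b, C.Reachable (u, b) (p, true) ↔ C.Reachable (v, !b) (p, true) := by
          intro b
          have : C.Adj (u, b) (v, !b) := ⟨huv, hu, hv, rfl⟩
          exact ⟨fun h => this.symm.reachable.trans h, fun h => this.reachable.trans h⟩
        have e1 := e true
        have e2 := e false
        simp only [Bool.not_true, Bool.not_false] at e1 e2
        simp only [hd, e1, e2]
        ring
      · rw [hdN v hv]
        have : ∀ b, ¬ C.Reachable (u, b) (p, true) := fun b => hB v (u, b) hv (htsymm _ _ huv)
        simp [hd, this]
    · rw [hdN u hu]
      have : ∀ b, ¬ C.Reachable (v, b) (p, true) := fun b => hB u (v, b) hu huv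
      simp [hd, this]
  have hdp : d p = 1 := by simp [hd, hA]
  -- The constraints that `d` does not preserve are strict, so a small step in either direction
  -- respects them.
  have hev : ∀ᶠ ε in nhdsWithin (0 : ℝ) (Set.Ioi 0),
      (∀ v, v ∈ N → 0 < z v + ε * d v ∧ z v + ε * d v < a ∧ 0 < z v - ε * d v ∧
        z v - ε * d v < a) ∧
      (∀ u v, R u v → ¬ t u v → w u v < z u + ε * d u + (z v + ε * d v) ∧
        w u v < z u - ε * d u + (z v - ε * d v)) := by
    have key : ∀ (c e m : ℝ), c < e → ∀ᶠ ε in nhdsWithin (0 : ℝ) (Set.Ioi 0), c < e + ε * m := by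
      intro c e m h
      have : Filter.Tendsto (fun ε : ℝ => e + ε * m) (nhdsWithin 0 (Set.Ioi 0))
          (nhds (e + 0 * m)) := by
        apply Filter.Tendsto.mono_left _ nhdsWithin_le_nhds
        exact (Continuous.tendsto (by fun_prop) 0)
      exact this.eventually (lt_mem_nhds (by simpa using h))
    rw [Filter.eventually_and, Filter.eventually_all, Filter.eventually_all]
    constructor
    · intro v
      by_cases hv : v ∈ N
      · filter_upwards [key 0 (z v) (d v) hv.1, key (-a) (-z v) (-d v) (by linarith [hv.2]),
          key 0 (z v) (-d v) hv.1, key (-a) (-z v) (d v) (by linarith [hv.2])] with ε h1 h2 h3 h4 _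
        refine ⟨by linarith, by linarith, by linarith, by linarith⟩
      · exact Filter.Eventually.of_forall fun _ h => absurd h hv
    · intro u
      rw [Filter.eventually_all]
      intro v
      by_cases huv : R u v ∧ ¬ t u v
      · have hlt : w u v < z u + z v := by
          refine lt_of_le_of_ne (hz.2.2 u v huv.1) fun h => huv.2 ⟨huv.1, h⟩
        filter_upwards [key _ _ (d u + d v) hlt, key _ _ (-(d u + d v)) hlt] with ε h1 h2 _ _
        refine ⟨by linarith, by linarith⟩
      · exact Filter.Eventually.of_forall fun _ h1 h2 => absurd ⟨h1, h2⟩ huv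
  obtain ⟨ε, ⟨hε1, hε2⟩, hε⟩ := (hev.and self_mem_nhdsWithin).exists
  have hmem : ∀ s : ℝ, s = 1 ∨ s = -1 → (fun v => z v + s * (ε * d v)) ∈ coverPolytope R w a T := by
    intro s hs
    refine ⟨fun v => ?_, fun v hv => ?_, fun u v huv => ?_⟩
    · by_cases hv : v ∈ N
      · have := hε1 v hv
        rcases hs with rfl | rfl <;> constructor <;> linarith
      · change 0 ≤ z v + s * (ε * d v) ∧ z v + s * (ε * d v) ≤ a
        rw [hdN v hv]; simpa using hz.1 v
    · change z v + s * (ε * d v) = 0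
      rw [hdN v (fun h => hv (hNT v h)), hz.2.1 v hv]; simp
    · change w u v ≤ z u + s * (ε * d u) + (z v + s * (ε * d v))
      by_cases htt : t u v
      · have e : s * (ε * d u) + s * (ε * d v) = 0 := by
          rw [← mul_add, ← mul_add, hdt u v htt]; simp
        have := htt.2
        linarith
      · have := hε2 u v huv htt
        rcases hs with rfl | rfl <;> linarith
  have e1 : z + (fun v => ε * d v) = fun v => z v + 1 * (ε * d v) := by
    ext v; simp
  have e2 : z - (fun v => ε * d v) = fun v => z v + -1 * (ε * d v) := by
    ext v; simp [sub_eq_add_neg]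
  have := hext (fun v => ε * d v) (e1 ▸ hmem 1 (Or.inl rfl)) (e2 ▸ hmem (-1) (Or.inr rfl))
  have h := congrFun this p
  simp only [hdp, mul_one, Pi.zero_apply] at h
  exact absurd h (ne_of_gt hε)

end Cover
end DiskShrinking

namespace DiskShrinking

/-! ### Disks -/

section Disks
open Classical

/-- Disks of radius 0 are single points and need separate cases. Two of them never meet at distinct
vertices since the centres are distinct. -/
lemma diskGraph_adj {V : Type} {P : V → Plane} (hP : Function.Injective P) {r : V → ℝ}
    (hr : ∀ v, 0 ≤ r v) {u v : V} :
    (diskGraph P r).Adj u v ↔ u ≠ v ∧ dist (P u) (P v) < r u + r v := by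
  change (u ≠ v ∧ _) ↔ _
  refine and_congr_right fun huv => ?_
  have hpos : 0 < dist (P u) (P v) := dist_pos.2 fun h => huv (hP h)
  constructor
  · rintro ⟨z, hu, hv⟩
    rcases hu with rfl | hu <;> rcases hv with hv | hv
    · rw [← hv, dist_self] at hpos; exact absurd hpos (lt_irrefl _)
    · have := hr u; rw [Metric.mem_ball] at hv; linarith
    · subst hv
      have := hr v; rw [Metric.mem_ball, dist_comm] at hu; linarith
    · rw [Metric.mem_ball] at hu hv
      have := dist_triangle (P u) z (P v)
      rw [dist_comm (P u) z] at this
      linarith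
  · intro h
    rcases (hr u).eq_or_lt with h0 | h0
    · exact ⟨P u, Or.inl rfl, Or.inr (by rw [Metric.mem_ball]; linarith)⟩
    rcases (hr v).eq_or_lt with h1 | h1
    · exact ⟨P v, Or.inr (by rw [Metric.mem_ball, dist_comm]; linarith), Or.inl rfl⟩
    have : ¬ Disjoint (Metric.ball (P u) (r u)) (Metric.ball (P v) (r v)) := by
      rw [disjoint_ball_ball_iff h0 h1]; exact not_le.2 h
    obtain ⟨z, hz1, hz2⟩ := Set.not_disjoint_iff.1 this
    exact ⟨z, Or.inr hz1, Or.inr hz2⟩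

lemma plane_dist (p q : Plane) :
    dist p q = Real.sqrt ((p 0 - q 0) * (p 0 - q 0) + (p 1 - q 1) * (p 1 - q 1)) := by
  rw [EuclideanSpace.dist_eq, Fin.sum_univ_two, Real.dist_eq, Real.dist_eq, sq_abs, sq_abs, sq, sq]

lemma dist_lt_two_of_floor_eq {p q : Plane} (h0 : ⌊p 0⌋ = ⌊q 0⌋) (h1 : ⌊p 1⌋ = ⌊q 1⌋) :
    dist p q < 2 := by
  have a0 := Int.abs_sub_lt_one_of_floor_eq_floor h0
  have a1 := Int.abs_sub_lt_one_of_floor_eq_floor h1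
  rw [abs_lt] at a0 a1
  rw [plane_dist, Real.sqrt_lt' (by norm_num)]
  nlinarith

lemma floor_mem_of_dist_lt_two {p q : Plane} (h : dist p q < 2) (i : Fin 2) :
    ⌊q i - p i⌋ ∈ Finset.Ico (-2 : ℤ) 2 := by
  have h1 : |q i - p i| < 2 := by
    have := EuclideanSpace.dist_eq q p
    rw [dist_comm] at h
    refine lt_of_le_of_lt ?_ h
    rw [this, ← Real.dist_eq]
    apply Real.le_sqrt_of_sq_le
    exact Finset.single_le_sum (f := fun i => dist (q i) (p i) ^ 2)
      (fun j _ => sq_nonneg _) (Finset.mem_univ i)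
  rw [abs_lt] at h1
  rw [Finset.mem_Ico]
  refine ⟨Int.le_floor.2 (by push_cast; linarith), Int.floor_lt.2 (by push_cast; linarith)⟩

/-- Each removed edge has an end in `S`, and the degrees in `G` are bounded because the unshrunken
neighbours of any vertex must not contain a triangle. -/
lemma card_removed_le (I : Instance) {S : Finset (Fin I.n)} {r : Fin I.n → ℝ}
    (h : IsSolution I S r) :
    (removed (diskGraph I.P fun _ => 1) (diskGraph I.P r)).card ≤ 2 * (I.k * (I.k + 32)) := by
  have hr : ∀ v, 0 ≤ r v := by
    intro v
    by_cases hv : v ∈ S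
    · exact I.α_nonneg.trans (h.radius_mem v hv).1
    · rw [h.radius_eq_one v hv]; exact zero_le_one
  set G := diskGraph I.P fun _ => 1 with hG
  have hGadj : ∀ u v, G.Adj u v ↔ u ≠ v ∧ dist (I.P u) (I.P v) < 1 + 1 := fun u v =>
    diskGraph_adj I.P_injective fun _ => zero_le_one
  have hdeg : ∀ p, (Finset.univ.filter fun q => G.Adj p q).card ≤ I.k + 32 := by
    intro p
    set B := Finset.univ.filter fun q => G.Adj p q ∧ q ∉ S with hB
    have h1 : (Finset.univ.filter fun q => G.Adj p q) ⊆ S ∪ B := by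
      intro q hq
      simp only [hB, Finset.mem_union, Finset.mem_filter, Finset.mem_univ, true_and] at hq ⊢
      tauto
    -- The neighbours lie in 16 unit cells around `p`, and two points of one cell are at distance
    -- less than 2. Hence a cell holds at most two unshrunken disks.
    have h2 : B.card ≤ 32 := by
      by_contra hcon
      push Not at hcon
      set cell : Fin I.n → ℤ × ℤ := fun q => (⌊I.P q 0 - I.P p 0⌋, ⌊I.P q 1 - I.P p 1⌋)
      have hmaps : ∀ q ∈ B, cell q ∈ Finset.Ico (-2 : ℤ) 2 ×ˢ Finset.Ico (-2 : ℤ) 2 := by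
        intro q hq
        simp only [hB, Finset.mem_filter, Finset.mem_univ, true_and, hGadj] at hq
        have : dist (I.P p) (I.P q) < 2 := by linarith [hq.1.2]
        exact Finset.mem_product.2 ⟨floor_mem_of_dist_lt_two this 0,
          floor_mem_of_dist_lt_two this 1⟩
      obtain ⟨y, -, hy⟩ := Finset.exists_lt_card_fiber_of_mul_lt_card_of_maps_to
        (n := 2) hmaps (by simpa using hcon)
      obtain ⟨a, ha, b, hb, c, hc, hab, hac, hbc⟩ := Finset.two_lt_card.1 hy
      have hadj : ∀ u v, u ∈ B.filter (fun q => cell q = y) → v ∈ B.filter (fun q => cell q = y) →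
          u ≠ v → (diskGraph I.P r).Adj u v := by
        intro u v hu hv huv
        rw [Finset.mem_filter] at hu hv
        rw [diskGraph_adj I.P_injective hr]
        have e := hu.2.trans hv.2.symm
        simp only [cell, Prod.mk.injEq] at e
        have hu' := hu.1
        have hv' := hv.1
        simp only [hB, Finset.mem_filter, Finset.mem_univ, true_and] at hu' hv'
        rw [h.radius_eq_one u hu'.2, h.radius_eq_one v hv'.2]
        refine ⟨huv, ?_⟩
        have := dist_lt_two_of_floor_eq (p := I.P u - I.P p) (q := I.P v - I.P p)
          (by simpa using e.1) (by simpa using e.2)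
        rw [dist_sub_right] at this
        linarith
      have hT : TwoDeg (diskGraph I.P r) {a, b, c} := by
        rintro v (rfl | rfl | rfl)
        · exact ⟨b, by simp, c, by simp, hbc, hadj _ _ ha hb hab, hadj _ _ ha hc hac⟩
        · exact ⟨a, by simp, c, by simp, hac, hadj _ _ hb ha hab.symm, hadj _ _ hb hc hbc⟩
        · exact ⟨a, by simp, b, by simp, hab, hadj _ _ hc ha hac.symm, hadj _ _ hc hb hbc.symm⟩
      have := hT.eq_empty h.acyclic
      exact (Set.mem_empty_iff_false a).1 (this ▸ Set.mem_insert a _)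
    have h3 := Finset.card_le_card h1
    have h4 := Finset.card_union_le S B
    have := h.card_le
    omega
  have hsub : removed G (diskGraph I.P r) ⊆
      (S.sigma fun p => Finset.univ.filter fun q => G.Adj p q).image (fun s => (s.1, s.2)) ∪
      (S.sigma fun p => Finset.univ.filter fun q => G.Adj p q).image (fun s => (s.2, s.1)) := by
    rintro ⟨u, v⟩ huv
    rw [mem_removed] at huv
    have : u ∈ S ∨ v ∈ S := by
      by_contra hcon
      push Not at hcon
      apply huv.2
      rw [diskGraph_adj I.P_injective hr, h.radius_eq_one u hcon.1, h.radius_eq_one v hcon.2]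
      exact (hGadj u v).1 huv.1
    rw [Finset.mem_union, Finset.mem_image, Finset.mem_image]
    rcases this with hS | hS
    · exact Or.inl ⟨⟨u, v⟩, by simp [hS, huv.1], rfl⟩
    · exact Or.inr ⟨⟨v, u⟩, by simp [hS, huv.1.symm], rfl⟩
  have hs : (S.sigma fun p => Finset.univ.filter fun q => G.Adj p q).card ≤
      I.k * (I.k + 32) := by
    rw [Finset.card_sigma]
    refine (Finset.sum_le_card_nsmul _ _ _ fun p _ => hdeg p).trans ?_
    rw [smul_eq_mul]
    exact Nat.mul_le_mul_right _ h.card_le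
  have h1 := Finset.card_le_card hsub
  have h2 := Finset.card_union_le
    ((S.sigma fun p => Finset.univ.filter fun q => G.Adj p q).image fun s => (s.1, s.2))
    ((S.sigma fun p => Finset.univ.filter fun q => G.Adj p q).image fun s => (s.2, s.1))
  have h3 := Finset.card_image_le (s := S.sigma fun p => Finset.univ.filter fun q => G.Adj p q)
    (f := fun s => (s.1, s.2))
  have h4 := Finset.card_image_le (s := S.sigma fun p => Finset.univ.filter fun q => G.Adj p q)
    (f := fun s => (s.2, s.1))
  omega

/-- The demand of a pair of disks. -/
noncomputable def demand (I : Instance) (u v : Fin I.n) : ℝ := 2 - dist (I.P u) (I.P v)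

/-- Every solution can be replaced by one that shrinks pool disks only, each by an amount that
comes from a short walk in the pool, without increasing the cost. -/
theorem exists_walk_solution (I : Instance) (pool : Set (Fin I.n))
    (hbranch : ∀ u v, Branch (diskGraph I.P fun _ => 1) u → v ∈ core (diskGraph I.P fun _ => 1) →
      (u = v ∨ (diskGraph I.P fun _ => 1).Adj u v) → v ∈ pool)
    (hchain : ∀ u v, (chainGraph (diskGraph I.P fun _ => 1)).Adj u v →
      ∃ b c, (chainGraph (diskGraph I.P fun _ => 1)).Adj b c ∧
      (chainGraph (diskGraph I.P fun _ => 1)).Reachable u b ∧ b ∈ pool ∧ c ∈ pool ∧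
      dist (I.P u) (I.P v) ≤ dist (I.P b) (I.P c))
    {S : Finset (Fin I.n)} {r : Fin I.n → ℝ} (h : IsSolution I S r) :
    ∃ (T : Finset (Fin I.n)) (z : Fin I.n → ℝ), T.card ≤ I.k ∧ (∀ v, v ∉ T → z v = 0) ∧
      (∀ v, 0 ≤ z v ∧ z v ≤ 1 - I.α) ∧ (diskGraph I.P fun v => 1 - z v).IsAcyclic ∧
      ∑ v, z v ≤ cost S r ∧
      ∀ p ∈ T, p ∈ pool ∧ ∃ v ∈ pool, ∃ (y y' : ℝ) (l : List (Fin I.n)), (y = 0 ∨ y = 1 - I.α) ∧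
        (∀ u ∈ l, u ∈ pool) ∧ l.length ≤ 2 * I.k ∧
        List.foldl (walkStep (demand I)) (v, y) l = (p, y') ∧ (z p = y' ∨ z p = y' / 2) := by
  have hr1 : ∀ v, I.α ≤ r v ∧ r v ≤ 1 := by
    intro v
    by_cases hv : v ∈ S
    · exact h.radius_mem v hv
    · rw [h.radius_eq_one v hv]; exact ⟨I.α_le_one, le_refl _⟩
  have hr : ∀ v, 0 ≤ r v := fun v => I.α_nonneg.trans (hr1 v).1
  set G := diskGraph I.P fun _ => 1 with hG
  have hGadj : ∀ u v, G.Adj u v ↔ u ≠ v ∧ dist (I.P u) (I.P v) < 1 + 1 := fun u v =>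
    diskGraph_adj I.P_injective fun _ => zero_le_one
  have hKG : diskGraph I.P r ≤ G := by
    intro u v huv
    rw [diskGraph_adj I.P_injective hr] at huv
    rw [hGadj]
    exact ⟨huv.1, by linarith [(hr1 u).2, (hr1 v).2, huv.2]⟩
  have hsymm : ∀ u v, demand I u v = demand I v u := fun u v => by
    rw [demand, demand, dist_comm]
  have hcov : Covers G (diskGraph I.P r) (demand I) (1 - I.α) fun v => 1 - r v := by
    refine ⟨fun v => by linarith [(hr1 v).2], fun v => by linarith [(hr1 v).1], ?_⟩
    intro u v huv hn
    rw [diskGraph_adj I.P_injective hr] at hn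
    have := (hGadj u v).1 huv
    rw [not_and, not_lt] at hn
    have := hn this.1
    rw [demand]
    linarith
  obtain ⟨K, σ, hK1, hK2, hK3, hK4⟩ := exists_covers_removed_subset hsymm pool hbranch
    (fun u v huv => by
      obtain ⟨b, c, h1, h2, h3, h4, h5⟩ := hchain u v huv
      exact ⟨b, c, h1, h2, h3, h4, by rw [demand, demand]; linarith⟩) hKG h.acyclic hcov
  set x : Fin I.n → ℝ := fun v => 1 - r v with hx
  -- Amounts outside the pool cover nothing any more and are dropped. The permutation injects the
  -- remaining support into `S`.
  set T := Finset.univ.filter fun v => v ∈ pool ∧ x (σ v) ≠ 0 with hT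
  set R : Fin I.n → Fin I.n → Prop := fun u v => G.Adj u v ∧ ¬ K.Adj u v with hR
  have hTc : T.card ≤ I.k := by
    refine le_trans ?_ h.card_le
    rw [← Finset.card_map σ.toEmbedding]
    apply Finset.card_le_card
    intro v hv
    rw [Finset.mem_map] at hv
    obtain ⟨u, hu, rfl⟩ := hv
    simp only [hT, Finset.mem_filter, Finset.mem_univ, true_and] at hu
    by_contra hS
    apply hu.2
    have := h.radius_eq_one _ hS
    simp only [Equiv.coe_toEmbedding] at this
    simp [hx, this]
  have hy : (fun v => if v ∈ pool then x (σ v) else 0) ∈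
      coverPolytope R (demand I) (1 - I.α) T := by
    refine ⟨fun v => ?_, fun v hv => ?_, fun u v huv => ?_⟩
    · have h1 := hK3.nonneg v
      have h2 := hK3.le v
      by_cases hv : v ∈ pool
      · simp only [hv, if_true]; exact ⟨h1, h2⟩
      · simp only [hv, if_false]; exact ⟨le_refl _, h1.trans h2⟩
    · by_cases hv' : v ∈ pool
      · simp only [hv', if_true]
        by_contra hne
        exact hv (by simp [hT, hv', hne])
      · simp [hv']
    · have h1 := hK4 u v huv.1 huv.2
      simp only [h1.1, h1.2, if_true]
      exact hK3.cover u v huv.1 huv.2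
  obtain ⟨z, hz, hzs, hext⟩ := exists_extreme_min hy
  refine ⟨T, z, hTc, hz.2.1, hz.1, ?_, ?_, ?_⟩
  -- The new disk graph need not be `K`, but since all removed edges stay covered it is a subgraph
  -- of `K`.
  · refine hK2.anti ?_
    intro u v huv
    rw [diskGraph_adj I.P_injective (fun v => by linarith [(hz.1 v).2, I.α_nonneg])] at huv
    by_contra hn
    have hadj : G.Adj u v := (hGadj u v).2 ⟨huv.1, by linarith [(hz.1 u).1, (hz.1 v).1, huv.2]⟩
    have := hz.2.2 u v ⟨hadj, hn⟩
    rw [demand] at this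
    linarith [huv.2]
  · refine hzs.trans ?_
    have h1 : ∑ v, (if v ∈ pool then x (σ v) else 0) ≤ ∑ v, x (σ v) := by
      refine Finset.sum_le_sum fun v _ => ?_
      split_ifs
      · exact le_refl _
      · exact hK3.nonneg v
    refine h1.trans (le_of_eq ?_)
    rw [Equiv.sum_comp σ x, cost]
    refine (Finset.sum_subset (Finset.subset_univ S) fun v _ hv => ?_).symm
    change 1 - r v = 0
    rw [h.radius_eq_one v hv, sub_self]
  · intro p hp
    obtain ⟨v, hv, y, y', l, h1, h2, h3, h4, h5⟩ := exists_walk_of_extreme (R := R) (pool := pool)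
      (fun u v huv => ⟨huv.1.symm, fun h => huv.2 h.symm⟩) (fun u v huv => huv.1.ne) hsymm
      (fun u v huv => (hK4 u v huv.1 huv.2).1)
      (fun v hv => by simp only [hT, Finset.mem_filter] at hv; exact hv.2.1) hz hext hp
    refine ⟨by simp only [hT, Finset.mem_filter] at hp; exact hp.2.1, v, hv, y, y', l, h1, h2,
      h3.trans (Nat.mul_le_mul_left _ hTc), h4, h5⟩

end Disks
end DiskShrinking

namespace RealRAM

/-! ### Program verification -/

section Verification

/-- Assign an integer register. -/
def State.setN (s : State) (x v : ℕ) : State := { s with natReg := Function.update s.natReg x v }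

/-- Assign a real register. -/
noncomputable def State.setR (s : State) (x : ℕ) (v : ℝ) : State :=
  { s with realReg := Function.update s.realReg x v }

/-- Assign a cell of an integer array. -/
def State.putN (s : State) (a i v : ℕ) : State :=
  { s with natArr := Function.update s.natArr a (Function.update (s.natArr a) i v) }

/-- Assign a cell of a real array. -/
noncomputable def State.putR (s : State) (a i : ℕ) (v : ℝ) : State :=
  { s with realArr := Function.update s.realArr a (Function.update (s.realArr a) i v) }

section Projections
variable (s : State) (x y v a b i : ℕ) (w : ℝ)

@[simp] lemma setN_natReg : (s.setN x v).natReg y = if y = x then v else s.natReg y := by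
  simp [State.setN, Function.update_apply]
@[simp] lemma setN_realReg : (s.setN x v).realReg = s.realReg := rfl
@[simp] lemma setN_natArr : (s.setN x v).natArr = s.natArr := rfl
@[simp] lemma setN_realArr : (s.setN x v).realArr = s.realArr := rfl
@[simp] lemma setR_natReg : (s.setR x w).natReg = s.natReg := rfl
@[simp] lemma setR_realReg : (s.setR x w).realReg y = if y = x then w else s.realReg y := by
  simp [State.setR, Function.update_apply]
@[simp] lemma setR_natArr : (s.setR x w).natArr = s.natArr := rfl
@[simp] lemma setR_realArr : (s.setR x w).realArr = s.realArr := rfl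
@[simp] lemma putN_natReg : (s.putN a i v).natReg = s.natReg := rfl
@[simp] lemma putN_realReg : (s.putN a i v).realReg = s.realReg := rfl
@[simp] lemma putN_natArr : (s.putN a i v).natArr b =
    if b = a then Function.update (s.natArr a) i v else s.natArr b := by
  simp [State.putN, Function.update_apply]
@[simp] lemma putN_realArr : (s.putN a i v).realArr = s.realArr := rfl
@[simp] lemma putR_natReg : (s.putR a i w).natReg = s.natReg := rfl
@[simp] lemma putR_realReg : (s.putR a i w).realReg = s.realReg := rfl
@[simp] lemma putR_natArr : (s.putR a i w).natArr = s.natArr := rfl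
@[simp] lemma putR_realArr : (s.putR a i w).realArr b =
    if b = a then Function.update (s.realArr a) i w else s.realArr b := by
  simp [State.putR, Function.update_apply]

end Projections

attribute [simp] NatExpr.eval RealExpr.eval Test.Holds

namespace Program

/-- The integer registers that a program assigns. -/
def natWrites : Program → List ℕ
  | setNat x _ => [x]
  | seq p q => natWrites p ++ natWrites q
  | ite _ p q => natWrites p ++ natWrites q
  | loop _ p => natWrites p
  | _ => []

/-- The real registers that a program assigns. -/
def realWrites : Program → List ℕ
  | setReal x _ => [x]
  | seq p q => realWrites p ++ realWrites q
  | ite _ p q => realWrites p ++ realWrites q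
  | loop _ p => realWrites p
  | _ => []

/-- The integer arrays that a program changes. -/
def natArrWrites : Program → List ℕ
  | storeNat a _ _ => [a]
  | seq p q => natArrWrites p ++ natArrWrites q
  | ite _ p q => natArrWrites p ++ natArrWrites q
  | loop _ p => natArrWrites p
  | _ => []

/-- The real arrays that a program changes. -/
def realArrWrites : Program → List ℕ
  | storeReal a _ _ => [a]
  | seq p q => realArrWrites p ++ realArrWrites q
  | ite _ p q => realArrWrites p ++ realArrWrites q
  | loop _ p => realArrWrites p
  | _ => []

/-- A bound for the running time when no loop makes more than `M` rounds. -/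
def timeBound (M : ℕ) : Program → ℕ
  | skip => 1
  | setNat _ e => e.cost + 1
  | setReal _ e => e.cost + 1
  | storeNat _ i e => i.cost + e.cost + 1
  | storeReal _ i e => i.cost + e.cost + 1
  | seq p q => timeBound M p + timeBound M q
  | ite b p q => b.cost + 1 + (timeBound M p + timeBound M q)
  | loop b p => (M + 1) * (b.cost + 1 + timeBound M p)

lemma timeBound_le (p : Program) : ∃ c, ∀ M, timeBound M p ≤ c * (M + 1) ^ c := by
  have lift : ∀ (c d M : ℕ), c ≤ d → c * (M + 1) ^ c ≤ d * (M + 1) ^ d := fun c d M h =>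
    Nat.mul_le_mul h (Nat.pow_le_pow_right (Nat.succ_pos M) h)
  have one : ∀ (d M : ℕ), d ≤ d * (M + 1) ^ d := fun d M =>
    Nat.le_mul_of_pos_right _ (Nat.pow_pos (Nat.succ_pos M))
  induction p with
  | skip => exact ⟨1, fun M => one 1 M⟩
  | setNat _ e => exact ⟨e.cost + 1, fun M => one _ M⟩
  | setReal _ e => exact ⟨e.cost + 1, fun M => one _ M⟩
  | storeNat _ i e => exact ⟨i.cost + e.cost + 1, fun M => one _ M⟩
  | storeReal _ i e => exact ⟨i.cost + e.cost + 1, fun M => one _ M⟩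
  | seq p q ihp ihq =>
    obtain ⟨c, hc⟩ := ihp
    obtain ⟨d, hd⟩ := ihq
    refine ⟨c + d, fun M => ?_⟩
    have h1 : c * (M + 1) ^ c ≤ c * (M + 1) ^ (c + d) :=
      Nat.mul_le_mul_left _ (Nat.pow_le_pow_right (Nat.succ_pos M) (Nat.le_add_right _ _))
    have h2 : d * (M + 1) ^ d ≤ d * (M + 1) ^ (c + d) :=
      Nat.mul_le_mul_left _ (Nat.pow_le_pow_right (Nat.succ_pos M) (Nat.le_add_left _ _))
    have := hc M
    have := hd M
    rw [add_mul]
    change timeBound M p + timeBound M q ≤ _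
    omega
  | ite b p q ihp ihq =>
    obtain ⟨c, hc⟩ := ihp
    obtain ⟨d, hd⟩ := ihq
    refine ⟨b.cost + 1 + (c + d), fun M => ?_⟩
    have h1 : c * (M + 1) ^ c ≤ c * (M + 1) ^ (b.cost + 1 + (c + d)) :=
      Nat.mul_le_mul_left _ (Nat.pow_le_pow_right (Nat.succ_pos M) (by omega))
    have h2 : d * (M + 1) ^ d ≤ d * (M + 1) ^ (b.cost + 1 + (c + d)) :=
      Nat.mul_le_mul_left _ (Nat.pow_le_pow_right (Nat.succ_pos M) (by omega))
    have h3 : b.cost + 1 ≤ (b.cost + 1) * (M + 1) ^ (b.cost + 1 + (c + d)) :=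
      Nat.le_mul_of_pos_right _ (Nat.pow_pos (Nat.succ_pos M))
    have := hc M
    have := hd M
    rw [add_mul (b.cost + 1), add_mul c]
    change b.cost + 1 + (timeBound M p + timeBound M q) ≤ _
    omega
  | loop b p ih =>
    obtain ⟨c, hc⟩ := ih
    refine ⟨b.cost + 1 + c, fun M => ?_⟩
    change (M + 1) * (b.cost + 1 + timeBound M p) ≤ _
    have h1 : b.cost + 1 + timeBound M p ≤ (b.cost + 1 + c) * (M + 1) ^ c := by
      have h3 : b.cost + 1 ≤ (b.cost + 1) * (M + 1) ^ c :=
        Nat.le_mul_of_pos_right _ (Nat.pow_pos (Nat.succ_pos M))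
      have := hc M
      rw [add_mul]
      omega
    calc (M + 1) * (b.cost + 1 + timeBound M p)
        ≤ (M + 1) * ((b.cost + 1 + c) * (M + 1) ^ c) := Nat.mul_le_mul_left _ h1
      _ = (b.cost + 1 + c) * (M + 1) ^ (c + 1) := by ring
      _ ≤ _ := Nat.mul_le_mul_left _ (Nat.pow_le_pow_right (Nat.succ_pos M) (by omega))

end Program

/-- The memory that `p` does not write is the same in `s` and `s'`. -/
structure Frame (p : Program) (s s' : State) : Prop where
  natReg : ∀ x, x ∉ p.natWrites → s'.natReg x = s.natReg x
  realReg : ∀ x, x ∉ p.realWrites → s'.realReg x = s.realReg x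
  natArr : ∀ a, a ∉ p.natArrWrites → s'.natArr a = s.natArr a
  realArr : ∀ a, a ∉ p.realArrWrites → s'.realArr a = s.realArr a

lemma Frame.refl (p : Program) (s : State) : Frame p s s :=
  ⟨fun _ _ => rfl, fun _ _ => rfl, fun _ _ => rfl, fun _ _ => rfl⟩

lemma Frame.trans {p q : Program} {s₁ s₂ s₃ : State} (h : Frame p s₁ s₂) (h' : Frame q s₂ s₃) :
    Frame (.seq p q) s₁ s₃ where
  natReg x hx := by
    simp only [Program.natWrites, List.mem_append, not_or] at hx
    rw [h'.natReg x hx.2, h.natReg x hx.1]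
  realReg x hx := by
    simp only [Program.realWrites, List.mem_append, not_or] at hx
    rw [h'.realReg x hx.2, h.realReg x hx.1]
  natArr x hx := by
    simp only [Program.natArrWrites, List.mem_append, not_or] at hx
    rw [h'.natArr x hx.2, h.natArr x hx.1]
  realArr x hx := by
    simp only [Program.realArrWrites, List.mem_append, not_or] at hx
    rw [h'.realArr x hx.2, h.realArr x hx.1]

lemma Frame.of_subset {p q : Program} {s s' : State} (h : Frame p s s')
    (h1 : p.natWrites ⊆ q.natWrites) (h2 : p.realWrites ⊆ q.realWrites)
    (h3 : p.natArrWrites ⊆ q.natArrWrites) (h4 : p.realArrWrites ⊆ q.realArrWrites) :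
    Frame q s s' :=
  ⟨fun x hx => h.natReg x fun h => hx (h1 h), fun x hx => h.realReg x fun h => hx (h2 h),
    fun x hx => h.natArr x fun h => hx (h3 h), fun x hx => h.realArr x fun h => hx (h4 h)⟩

/-- The program `p`, started in the memory `s`, halts in a memory with the property `Q`, and no
loop makes more than `M` rounds. -/
def WP (M : ℕ) : Program → (State → Prop) → State → Prop
  | .skip, Q, s => Q s
  | .setNat x e, Q, s => Q (s.setN x (e.eval s))
  | .setReal x e, Q, s => Q (s.setR x (e.eval s))
  | .storeNat a i e, Q, s => Q (s.putN a (i.eval s) (e.eval s))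
  | .storeReal a i e, Q, s => Q (s.putR a (i.eval s) (e.eval s))
  | .seq p q, Q, s => WP M p (WP M q Q) s
  | .ite b p q, Q, s => (b.Holds s → WP M p Q s) ∧ (¬ b.Holds s → WP M q Q s)
  | .loop b p, Q, s => ∃ m ≤ M, ∃ Inv : ℕ → State → Prop, Inv 0 s ∧
      (∀ i < m, ∀ s', Inv i s' → b.Holds s' ∧ WP M p (Inv (i + 1)) s') ∧
      ∀ s', Inv m s' → ¬ b.Holds s' ∧ Q s'

/-- Induction on the program. For a loop the rounds that are left are counted down, each costing at
most the bound for one round. -/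
theorem WP.runs {M : ℕ} {p : Program} {Q : State → Prop} {s : State} (h : WP M p Q s) :
    ∃ s' t, Runs p s s' t ∧ t ≤ p.timeBound M ∧ Q s' := by
  induction p generalizing Q s with
  | skip => exact ⟨s, 1, .skip s, le_refl _, h⟩
  | setNat x e => exact ⟨_, _, .setNat x e s, le_refl _, h⟩
  | setReal x e => exact ⟨_, _, .setReal x e s, le_refl _, h⟩
  | storeNat a i e => exact ⟨_, _, .storeNat a i e s, le_refl _, h⟩
  | storeReal a i e => exact ⟨_, _, .storeReal a i e s, le_refl _, h⟩
  | seq p q ihp ihq =>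
    obtain ⟨s₁, t, h1, h2, h3⟩ := ihp h
    obtain ⟨s₂, u, h4, h5, h6⟩ := ihq h3
    exact ⟨s₂, t + u, .seq h1 h4, Nat.add_le_add h2 h5, h6⟩
  | ite b p q ihp ihq =>
    by_cases hb : b.Holds s
    · obtain ⟨s₁, t, h1, h2, h3⟩ := ihp (h.1 hb)
      refine ⟨s₁, _, .ite_true hb h1, ?_, h3⟩
      simp only [Program.timeBound]
      omega
    · obtain ⟨s₁, t, h1, h2, h3⟩ := ihq (h.2 hb)
      refine ⟨s₁, _, .ite_false hb h1, ?_, h3⟩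
      simp only [Program.timeBound]
      omega
  | loop b p ih =>
    obtain ⟨m, hm, Inv, h0, hstep, hend⟩ := h
    have key : ∀ j i s, i + j = m → Inv i s → ∃ s' t, Runs (.loop b p) s s' t ∧
        t ≤ j * (b.cost + 1 + p.timeBound M) + (b.cost + 1) ∧ Q s' := by
      intro j
      induction j with
      | zero =>
        intro i s hi hs
        obtain rfl : i = m := by omega
        have := hend s hs
        exact ⟨s, _, .loop_done this.1, by omega, this.2⟩
      | succ j ihj =>
        intro i s hi hs
        obtain ⟨hb, hw⟩ := hstep i (by omega) s hs
        obtain ⟨s₁, t, h1, h2, h3⟩ := ih hw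
        obtain ⟨s₂, u, h4, h5, h6⟩ := ihj (i + 1) s₁ (by omega) h3
        refine ⟨s₂, _, .loop_step hb h1 h4, ?_, h6⟩
        rw [Nat.succ_mul]
        omega
    obtain ⟨s', t, h1, h2, h3⟩ := key m 0 s (by omega) h0
    refine ⟨s', t, h1, h2.trans ?_, h3⟩
    have := Nat.mul_le_mul_right (b.cost + 1 + p.timeBound M) hm
    simp only [Program.timeBound, Nat.succ_mul]
    omega

/-- Consequence rule; unwritten memory keeps its contents. -/
theorem WP.mono {M : ℕ} {p : Program} {Q Q' : State → Prop} {s : State} (h : WP M p Q s)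
    (hQ : ∀ s', Frame p s s' → Q s' → Q' s') : WP M p Q' s := by
  induction p generalizing Q Q' s with
  | skip => exact hQ _ (Frame.refl _ s) h
  | setNat x e =>
    exact hQ _ ⟨fun y hy => by
      have : y ≠ x := by simpa [Program.natWrites] using hy
      simp [this], fun _ _ => rfl, fun _ _ => rfl, fun _ _ => rfl⟩ h
  | setReal x e =>
    exact hQ _ ⟨fun _ _ => rfl, fun y hy => by
      have : y ≠ x := by simpa [Program.realWrites] using hy
      simp [this], fun _ _ => rfl, fun _ _ => rfl⟩ h
  | storeNat x i e =>
    exact hQ _ ⟨fun _ _ => rfl, fun _ _ => rfl, fun y hy => by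
      have : y ≠ x := by simpa [Program.natArrWrites] using hy
      simp [this], fun _ _ => rfl⟩ h
  | storeReal x i e =>
    exact hQ _ ⟨fun _ _ => rfl, fun _ _ => rfl, fun _ _ => rfl, fun y hy => by
      have : y ≠ x := by simpa [Program.realArrWrites] using hy
      simp [this]⟩ h
  | seq p q ihp ihq =>
    exact ihp h fun s₁ f₁ h₁ => ihq h₁ fun s₂ f₂ h₂ => hQ s₂ (f₁.trans f₂) h₂
  | ite b p q ihp ihq =>
    refine ⟨fun hb => ihp (h.1 hb) fun s' f h' => hQ s' ?_ h',
      fun hb => ihq (h.2 hb) fun s' f h' => hQ s' ?_ h'⟩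
    · exact f.of_subset (by simp [Program.natWrites]) (by simp [Program.realWrites])
        (by simp [Program.natArrWrites]) (by simp [Program.realArrWrites])
    · exact f.of_subset (by simp [Program.natWrites]) (by simp [Program.realWrites])
        (by simp [Program.natArrWrites]) (by simp [Program.realArrWrites])
  | loop b p ih =>
    obtain ⟨m, hm, Inv, h0, hstep, hend⟩ := h
    -- The frame is added to the loop invariant; the sets of written locations are the same after
    -- any number of rounds.
    refine ⟨m, hm, fun i s' => Inv i s' ∧ Frame (.loop b p) s s', ⟨h0, Frame.refl _ s⟩, ?_, ?_⟩
    · rintro i hi s₁ ⟨h1, f1⟩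
      refine ⟨(hstep i hi s₁ h1).1, ih (hstep i hi s₁ h1).2 fun s₂ f2 h2 => ⟨h2, ?_⟩⟩
      exact (f1.trans f2).of_subset (by simp [Program.natWrites]) (by simp [Program.realWrites])
        (by simp [Program.natArrWrites]) (by simp [Program.realArrWrites])
    · rintro s₁ ⟨h1, f1⟩
      exact ⟨(hend s₁ h1).1, hQ s₁ f1 (hend s₁ h1).2⟩

/-- Run `p` for each value of the register `x` from `0` below that of the register `y`. -/
def Program.count (x y : ℕ) (p : Program) : Program :=
  .seq (.setNat x (.lit 0)) (.loop (.natLe (.add (.reg x) (.lit 1)) (.reg y))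
    (.seq p (.setNat x (.add (.reg x) (.lit 1)))))

/-- The body must write neither the counter nor the bound. Each step may assume the frame with
respect to the state before the whole loop, so invariants mention changing memory only. -/
theorem WP.count {M x y : ℕ} {p : Program} {Q : State → Prop} {s : State}
    (Inv : ℕ → State → Prop) (hx : x ∉ p.natWrites) (hy : y ∉ p.natWrites) (hxy : y ≠ x)
    (hM : s.natReg y ≤ M) (h0 : Inv 0 (s.setN x 0))
    (hstep : ∀ i < s.natReg y, ∀ s', Frame (p.count x y) s s' → s'.natReg x = i → Inv i s' →
      WP M p (fun s'' => Inv (i + 1) (s''.setN x (i + 1))) s')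
    (hQ : ∀ s', Frame (p.count x y) s s' → Inv (s.natReg y) s' → Q s') :
    WP M (p.count x y) Q s := by
  suffices h : WP M (p.count x y) (Inv (s.natReg y)) s from h.mono hQ
  have hw1 : (p.count x y).natWrites = x :: (p.natWrites ++ [x]) := by
    simp [Program.count, Program.natWrites]
  have hw2 : (p.count x y).realWrites = p.realWrites := by
    simp [Program.count, Program.realWrites]
  have hw3 : (p.count x y).natArrWrites = p.natArrWrites := by
    simp [Program.count, Program.natArrWrites]
  have hw4 : (p.count x y).realArrWrites = p.realArrWrites := by
    simp [Program.count, Program.realArrWrites]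
  have hset : ∀ s' v, Frame (p.count x y) s s' → Frame (p.count x y) s (s'.setN x v) := by
    intro s' v f
    refine ⟨fun z hz => ?_, f.realReg, f.natArr, f.realArr⟩
    rw [← f.natReg z hz]
    rw [hw1] at hz
    have : z ≠ x := fun h => hz (by simp [h])
    simp [this]
  refine ⟨s.natReg y, hM, fun i s' => Inv i s' ∧ s'.natReg x = i ∧ Frame (p.count x y) s s',
    ⟨h0, by simp, hset s 0 (Frame.refl _ s)⟩, ?_, ?_⟩
  · rintro i hi s₁ ⟨h1, h2, f1⟩
    have hy1 : s₁.natReg y = s.natReg y := f1.natReg y (by rw [hw1]; simp [hy, hxy])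
    refine ⟨by simp [h2, hy1]; omega, ?_⟩
    refine (hstep i hi s₁ f1 h2 h1).mono fun s₂ f2 h3 => ?_
    have hx2 : s₂.natReg x = i := by rw [f2.natReg x hx, h2]
    simp only [WP, NatExpr.eval, hx2]
    refine ⟨h3, by simp, hset _ _ ?_⟩
    exact (f1.trans f2).of_subset
      (by rw [Program.natWrites, hw1]; intro z; simp; tauto)
      (by rw [Program.realWrites, hw2]; simp)
      (by rw [Program.natArrWrites, hw3]; simp)
      (by rw [Program.realArrWrites, hw4]; simp)
  · rintro s₁ ⟨h1, h2, f1⟩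
    have hy1 : s₁.natReg y = s.natReg y := f1.natReg y (by rw [hw1]; simp [hy, hxy])
    refine ⟨?_, h1⟩
    simp [h2, hy1]

end Verification
end RealRAM

namespace DiskShrinking
open RealRAM

/-! ### The core of the disk graph -/

infixr:60 " ;; " => Program.seq

/-- The distance of the points with given indices. -/
def distExpr (u v : NatExpr) : RealExpr :=
  .sqrt (.add (.mul (.sub (.arr 2 u) (.arr 2 v)) (.sub (.arr 2 u) (.arr 2 v)))
    (.mul (.sub (.arr 1 u) (.arr 1 v)) (.sub (.arr 1 u) (.arr 1 v))))

/-- The disks with given indices have indices `u ≠ v` and intersect. -/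
def adjTest (u v : NatExpr) : Test :=
  .conj (.neg (.conj (.natLe u v) (.natLe v u)))
    (.neg (.realLe (.add (.arr 0 u) (.arr 0 v)) (distExpr u v)))

/-- Delete repeatedly vertices with at most one remaining neighbour; count the neighbours. -/
def corePass : Program :=
  .count 3 0 (.ite (.natLe (.lit 1) (.arr 1 (.reg 3)))
    (.setNat 5 (.lit 0) ;;
      .count 4 0 (.ite (.conj (.natLe (.lit 1) (.arr 1 (.reg 4))) (adjTest (.reg 3) (.reg 4)))
        (.setNat 5 (.add (.reg 5) (.lit 1))) .skip) ;;
      .storeNat 2 (.reg 3) (.reg 5) ;;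
      .ite (.natLe (.reg 5) (.lit 1)) (.storeNat 1 (.reg 3) (.lit 0)) .skip)
    .skip)

def coreProgram : Program :=
  .count 3 0 (.storeNat 1 (.reg 3) (.lit 1)) ;; .count 2 0 corePass

section CoreProgram
open Classical
variable {n : ℕ}

/-- The points stored in the real arrays 1 and 2. -/
noncomputable def storedDist (s : State) (u v : ℕ) : ℝ :=
  Real.sqrt ((s.realArr 2 u - s.realArr 2 v) * (s.realArr 2 u - s.realArr 2 v) +
    (s.realArr 1 u - s.realArr 1 v) * (s.realArr 1 u - s.realArr 1 v))

@[simp] lemma distExpr_eval (s : State) (u v : NatExpr) :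
    (distExpr u v).eval s = storedDist s (u.eval s) (v.eval s) := rfl

lemma adjTest_holds (s : State) (u v : NatExpr) : (adjTest u v).Holds s ↔ u.eval s ≠ v.eval s ∧
    storedDist s (u.eval s) (v.eval s) < s.realArr 0 (u.eval s) + s.realArr 0 (v.eval s) := by
  simp only [adjTest, Test.Holds, RealExpr.eval, distExpr_eval, not_le]
  refine and_congr ?_ Iff.rfl
  omega

/-- `G` is the intersection graph of the stored disks. -/
structure StoresGraph (G : SimpleGraph (Fin n)) (s : State) : Prop where
  size : s.natReg 0 = n
  adj : ∀ u v : Fin n, G.Adj u v ↔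
    u ≠ v ∧ storedDist s u v < s.realArr 0 u + s.realArr 0 v

/-- Programs are concrete, so the default arguments decide that the relevant memory is not written.
-/
lemma StoresGraph.of_frame {G : SimpleGraph (Fin n)} {s s' : State} {p : Program}
    (h : StoresGraph G s) (f : Frame p s s') (h0 : 0 ∉ p.natWrites := by decide)
    (h1 : 0 ∉ p.realArrWrites := by decide) (h2 : 1 ∉ p.realArrWrites := by decide)
    (h3 : 2 ∉ p.realArrWrites := by decide) : StoresGraph G s' :=
  ⟨by rw [f.natReg 0 h0, h.size], fun u v => by
    rw [h.adj, storedDist, storedDist, f.realArr 0 h1, f.realArr 1 h2, f.realArr 2 h3]⟩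

lemma StoresGraph.adjTest {G : SimpleGraph (Fin n)} {s : State} (h : StoresGraph G s)
    {u v : NatExpr} {a b : Fin n} (hu : u.eval s = a) (hv : v.eval s = b) :
    (adjTest u v).Holds s ↔ G.Adj a b := by
  rw [adjTest_holds, h.adj, hu, hv, ne_eq, Fin.val_inj]

/-- The vertices that are still present. -/
def aliveSet (n : ℕ) (s : State) : Set (Fin n) := {v | 1 ≤ s.natArr 1 v}

/-- The number of neighbours in a set. -/
noncomputable def degIn (G : SimpleGraph (Fin n)) (A : Set (Fin n)) (v : Fin n) : ℕ :=
  (Finset.univ.filter fun u => u ∈ A ∧ G.Adj v u).card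

/-- Two neighbours for all vertices, with correct neighbour counts. -/
def Stable (G : SimpleGraph (Fin n)) (A : Set (Fin n)) (s : State) (i : ℕ) : Prop :=
  ∀ v ∈ A, (v : ℕ) < i → s.natArr 2 v = degIn G A v ∧ 2 ≤ degIn G A v

/-- The number of indices below `i` with the property `p`. -/
noncomputable def countBelow (p : Fin n → Prop) (i : ℕ) : ℕ :=
  (Finset.univ.filter fun u : Fin n => (u : ℕ) < i ∧ p u).card

lemma countBelow_zero (p : Fin n → Prop) : countBelow p 0 = 0 := by simp [countBelow]

lemma countBelow_size (p : Fin n → Prop) [DecidablePred p] :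
    countBelow p n = (Finset.univ.filter p).card := by
  rw [countBelow]
  congr 1
  ext u
  simp

lemma countBelow_succ (p : Fin n → Prop) {i : ℕ} (hi : i < n) :
    countBelow p (i + 1) = countBelow p i + if p ⟨i, hi⟩ then 1 else 0 := by
  rw [countBelow, countBelow]
  split_ifs with h
  · rw [← Finset.card_insert_of_notMem (a := (⟨i, hi⟩ : Fin n)) (by simp)]
    congr 1
    ext u
    simp only [Finset.mem_filter, Finset.mem_univ, true_and, Finset.mem_insert, Fin.ext_iff]
    constructor
    · rintro ⟨h1, h2⟩
      by_cases e : (u : ℕ) = i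
      · exact Or.inl e
      · exact Or.inr ⟨by omega, h2⟩
    · rintro (e | ⟨h1, h2⟩)
      · have : u = ⟨i, hi⟩ := Fin.ext e
        exact ⟨by omega, this ▸ h⟩
      · exact ⟨by omega, h2⟩
  · rw [add_zero]
    congr 1
    ext u
    simp only [Finset.mem_filter, Finset.mem_univ, true_and]
    constructor
    · rintro ⟨h1, h2⟩
      refine ⟨?_, h2⟩
      by_contra e
      have : u = ⟨i, hi⟩ := Fin.ext (by simp; omega)
      exact h (this ▸ h2)
    · rintro ⟨h1, h2⟩
      exact ⟨by omega, h2⟩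

lemma stable_iff_twoDeg {G : SimpleGraph (Fin n)} {A : Set (Fin n)} {s : State}
    (h : Stable G A s n) : TwoDeg G A := by
  intro v hv
  have := (h v hv v.2).2
  obtain ⟨a, ha, b, hb, hab⟩ := Finset.one_lt_card.1 (show 1 < degIn G A v by omega)
  rw [Finset.mem_filter] at ha hb
  exact ⟨a, ha.2.1, b, hb.2.1, hab, ha.2.2, hb.2.2⟩

/-- As long as all core vertices are present, none of them meets the deletion criterion. -/
lemma degIn_lt_two {G : SimpleGraph (Fin n)} {A : Set (Fin n)} {v : Fin n}
    (hA : core G ⊆ A) (hv : v ∈ core G) : 2 ≤ degIn G A v := by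
  refine (two_le_coreDeg hv).trans (Finset.card_le_card ?_)
  intro u hu
  simp only [Finset.mem_filter, Finset.mem_univ, true_and] at hu ⊢
  exact ⟨hA hu.1, hu.2⟩

/-- The counts refer to the set that is current during the pass. If the pass ends with the set it
started from, this set never changed and all counts are valid for it. -/
lemma corePass_spec {M : ℕ} {G : SimpleGraph (Fin n)} {s : State} (hM : n ≤ M)
    (hG : StoresGraph G s) (hc : core G ⊆ aliveSet n s) :
    WP M corePass (fun s' => core G ⊆ aliveSet n s' ∧ aliveSet n s' ⊆ aliveSet n s ∧
      (aliveSet n s' = aliveSet n s → Stable G (aliveSet n s) s' n)) s := by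
  set A := aliveSet n s with hA
  refine WP.count (Inv := fun i s' => core G ⊆ aliveSet n s' ∧ aliveSet n s' ⊆ A ∧
      (aliveSet n s' = A → Stable G A s' i)) (by decide) (by decide) (by decide)
      (by rw [hG.size]; exact hM) ?_ ?_ ?_
  · exact ⟨hc, subset_rfl, fun _ v _ h => absurd h (Nat.not_lt_zero _)⟩
  · rintro i hi s₁ f₁ hi₁ ⟨h1, h2, h3⟩
    rw [hG.size] at hi
    have hG₁ := hG.of_frame f₁
    set v : Fin n := ⟨i, hi⟩ with hv
    simp only [WP, Test.Holds, NatExpr.eval, hi₁]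
    refine ⟨fun hb => ?_, fun hb => ?_⟩
    · refine (WP.count (Q := fun s₂ => s₂.natReg 5 = degIn G (aliveSet n s₁) v)
        (Inv := fun j s₂ => s₂.natReg 5 =
        countBelow (fun u => u ∈ aliveSet n s₁ ∧ G.Adj v u) j)
        (by decide) (by decide) (by decide) ?_ ?_ ?_ ?_).mono ?_
      · simpa [hG₁.size] using hM
      · simp [countBelow_zero]
      · intro j hj s₂ f₂ hj₂ h5
        have hj' : j < n := by simpa [hG₁.size] using hj
        have hG₂ : StoresGraph G s₂ := by
          refine StoresGraph.of_frame (s := s₁.setN 5 0) ⟨?_, hG₁.adj⟩ f₂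
          simpa using hG₁.size
        have ha := f₂.natArr 1 (by decide)
        have h3' := f₂.natReg 3 (by decide)
        rw [setN_natArr] at ha
        simp only [setN_natReg] at h3'
        have e1 : (1 ≤ s₂.natArr 1 j) ↔ (⟨j, hj'⟩ : Fin n) ∈ aliveSet n s₁ := by
          rw [ha]; rfl
        have e2 : (adjTest (.reg 3) (.reg 4)).Holds s₂ ↔ G.Adj v ⟨j, hj'⟩ :=
          hG₂.adjTest (by simp [h3', hi₁, hv]) (by simp [hj₂])
        have := countBelow_succ (fun u => u ∈ aliveSet n s₁ ∧ G.Adj v u) hj'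
        simp only [WP, Test.Holds, NatExpr.eval, hj₂, e1, e2]
        refine ⟨fun h => ?_, fun h => ?_⟩
        · rw [if_pos h] at this
          simpa [h5] using this.symm
        · rw [if_neg h] at this
          simpa [h5] using this.symm
      · intro s₂ f₂ h5
        have : (s₁.setN 5 0).natReg 0 = n := by simpa using hG₁.size
        rw [h5, degIn, this, countBelow_size]
      · intro s₂ f₂ h5
        have ha := f₂.natArr 1 (by decide)
        have hcn := f₂.natArr 2 (by decide)
        have h3' := f₂.natReg 3 (by decide)
        simp only [setN_natArr, setN_natReg] at ha hcn h3'
        have h3' : s₂.natReg 3 = i := by rw [← hi₁]; simpa using h3'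
        have hvA : v ∈ aliveSet n s₁ := hb
        have hSt : ∀ s₃ : State, s₃.natArr 2 = Function.update (s₂.natArr 2) i (s₂.natReg 5) →
            aliveSet n s₁ = A → 2 ≤ degIn G A v → Stable G A s₃ (i + 1) := by
          intro s₃ hs hAe hdeg u hu hui
          rw [hs, hcn]
          by_cases e : u = v
          · subst e
            rw [hv, Function.update_self, h5, hAe]
            exact ⟨rfl, hdeg⟩
          · have e' : (u : ℕ) ≠ i := fun h => e (Fin.ext h)
            rw [Function.update_of_ne e']
            exact h3 hAe u hu (by omega)
        simp only [putN_natReg, h3', h5]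
        refine ⟨fun hle => ?_, fun hle => ?_⟩
        · have hal : aliveSet n (((s₂.putN 2 i (degIn G (aliveSet n s₁) v)).putN 1 i 0).setN 3
              (i + 1)) = aliveSet n s₁ \ {v} := by
            ext u
            simp only [aliveSet, setN_natArr, putN_natArr, if_true, Set.mem_ofPred_eq,
              Set.mem_sdiff, Set.mem_singleton_iff]
            by_cases e : u = v
            · subst e
              simp [hv]
            · have e' : (u : ℕ) ≠ i := fun h => e (Fin.ext h)
              simp [Function.update_of_ne e', e, ha]
          rw [hal]
          refine ⟨fun u hu => ⟨h1 hu, ?_⟩, Set.sdiff_subset.trans h2, fun he => ?_⟩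
          · rintro rfl
            have := degIn_lt_two h1 hu
            omega
          · exact absurd (he ▸ h2 hvA : v ∈ aliveSet n s₁ \ {v}) (fun h => h.2 rfl)
        · have hal : aliveSet n ((s₂.putN 2 i (degIn G (aliveSet n s₁) v)).setN 3 (i + 1)) =
              aliveSet n s₁ := by
            ext u
            simp [aliveSet, ha]
          rw [hal]
          refine ⟨h1, h2, fun he => hSt _ (by simp [h5]) he ?_⟩
          rw [← he]; omega
    · have hal : aliveSet n (s₁.setN 3 (i + 1)) = aliveSet n s₁ := rfl
      rw [hal]
      refine ⟨h1, h2, fun he u hu hui => ?_⟩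
      by_cases e : u = v
      · subst e
        exact absurd (show v ∈ aliveSet n s₁ from he ▸ hu) hb
      · have e' : (u : ℕ) ≠ i := fun h => e (Fin.ext h)
        exact h3 he u hu (by omega)
  · intro s' _ h
    rwa [hG.size] at h

/-- The core and the degrees in it are stored. -/
structure StoresCore (G : SimpleGraph (Fin n)) (s : State) : Prop where
  mem : ∀ v : Fin n, 1 ≤ s.natArr 1 v ↔ v ∈ core G
  deg : ∀ v ∈ core G, s.natArr 2 v = coreDeg G v

theorem coreProgram_spec {M : ℕ} {G : SimpleGraph (Fin n)} {s : State} (hM : n ≤ M)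
    (hG : StoresGraph G s) : WP M coreProgram (StoresCore G) s := by
  refine (WP.count (Q := fun s' => aliveSet n s' = Set.univ)
    (Inv := fun i s' => ∀ j < i, s'.natArr 1 j = 1)
    (by decide) (by decide) (by decide) (by rw [hG.size]; exact hM) (by simp) ?_ ?_).mono ?_
  · intro i hi s₁ f hi₁ h j hj
    simp only [NatExpr.eval, hi₁, setN_natArr, putN_natArr, if_true]
    by_cases e : j = i
    · simp [e]
    · rw [Function.update_of_ne e]; exact h j (by omega)
  · intro s₁ f h
    ext v
    simp [aliveSet, h v (by rw [hG.size]; exact v.2)]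
  intro s₁ f₁ h₁
  have hG₁ := hG.of_frame f₁
  -- Each pass either deletes a vertex or finds a stable set, which then equals the core and stays
  -- fixed. Hence `n` passes suffice.
  refine WP.count (Inv := fun i s' => core G ⊆ aliveSet n s' ∧
    ((aliveSet n s').ncard ≤ n - i ∨ Stable G (aliveSet n s') s' n)) (by decide) (by decide)
    (by decide) (by rw [hG₁.size]; exact hM) ?_ ?_ ?_
  · have : aliveSet n (s₁.setN 2 0) = Set.univ := h₁
    rw [this]
    refine ⟨Set.subset_univ _, Or.inl ?_⟩
    rw [Set.ncard_univ]; simp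
  · rintro i hi s₂ f₂ hi₂ ⟨h1, h2⟩
    rw [hG₁.size] at hi
    refine (corePass_spec hM (hG₁.of_frame f₂) h1).mono fun s₃ f₃ h3 => ?_
    obtain ⟨h4, h5, h6⟩ := h3
    change core G ⊆ aliveSet n s₃ ∧ ((aliveSet n s₃).ncard ≤ n - (i + 1) ∨
      Stable G (aliveSet n s₃) s₃ n)
    refine ⟨h4, ?_⟩
    by_cases he : aliveSet n s₃ = aliveSet n s₂
    · right; rw [he]; exact h6 he
    · rcases h2 with h2 | h2
      · left
        have := Set.ncard_lt_ncard (lt_of_le_of_ne h5 he)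
        omega
      · exfalso
        apply he
        exact h5.antisymm ((stable_iff_twoDeg h2).subset_core.trans h4)
  · rintro s₂ f₂ ⟨h1, h2⟩
    rw [hG₁.size] at h2
    have hst : Stable G (aliveSet n s₂) s₂ n := by
      rcases h2 with h2 | h2
      · rw [Nat.sub_self, Nat.le_zero, Set.ncard_eq_zero] at h2
        rw [h2]
        intro v hv
        exact absurd hv (Set.notMem_empty v)
      · exact h2
    have he : aliveSet n s₂ = core G := (stable_iff_twoDeg hst).subset_core.antisymm h1
    refine ⟨fun v => ?_, fun v hv => ?_⟩
    · rw [← he]; rfl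
    · rw [(hst v (he ▸ hv) v.2).1, he]; rfl

end CoreProgram
end DiskShrinking

namespace DiskShrinking
open RealRAM

/-! ### Labels of the chains -/

/-- Run `p` for all pairs of values of the registers 2 and 3 below the register 0. -/
def pairs (p : Program) : Program := .count 2 0 (.count 3 0 p)

/-- The two integers are equal. -/
def eqTest (e f : NatExpr) : Test := .conj (.natLe e f) (.natLe f e)

/-- The vertices are adjacent in the chain graph. -/
def chainTest (u v : NatExpr) : Test :=
  .conj (adjTest u v) (.conj (.conj (.natLe (.lit 1) (.arr 1 u)) (.natLe (.lit 1) (.arr 1 v)))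
    (.conj (.natLe (.arr 2 u) (.lit 2)) (.natLe (.arr 2 v) (.lit 2))))

/-- Replace the label stored in register 6 by the one in register 5. -/
def relabel : Program :=
  .count 4 0 (.ite (eqTest (.arr 3 (.reg 4)) (.reg 6)) (.storeNat 3 (.reg 4) (.reg 5)) .skip)

def labelProgram : Program :=
  -- Connected components by repeated merging: all labels start distinct, and each chain edge
  -- identifies the labels of its two ends.
  .count 2 0 (.storeNat 3 (.reg 2) (.reg 2)) ;;
  pairs (.ite (chainTest (.reg 2) (.reg 3))
    (.setNat 5 (.arr 3 (.reg 2)) ;; .setNat 6 (.arr 3 (.reg 3)) ;; relabel) .skip)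

section Labels
open Classical
variable {n M : ℕ} {G : SimpleGraph (Fin n)} {s s' : State}

/-- The double loop is described by the set `C` of pairs already visited, so that invariants need
not mention the order of the visits. -/
theorem WP_pairs {p : Program} {Q : State → Prop} (Inv : Set (Fin n × Fin n) → State → Prop)
    (h0 : 0 ∉ p.natWrites) (h2 : 2 ∉ p.natWrites) (h3 : 3 ∉ p.natWrites)
    (hn : s.natReg 0 = n) (hM : n ≤ M)
    (hset : ∀ C s v, Inv C s → Inv C (s.setN 2 v) ∧ Inv C (s.setN 3 v)) (hs : Inv ∅ s)
    (hstep : ∀ (C : Set (Fin n × Fin n)) (a b : Fin n) s', (a, b) ∉ C → Frame (pairs p) s s' →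
      s'.natReg 2 = a → s'.natReg 3 = b → Inv C s' → WP M p (Inv (insert (a, b) C)) s')
    (hQ : ∀ s', Frame (pairs p) s s' → Inv Set.univ s' → Q s') : WP M (pairs p) Q s := by
  have w1 : (Program.count 3 0 p).natWrites = 3 :: (p.natWrites ++ [3]) := by
    simp [Program.count, Program.natWrites]
  have hC0 : ∀ i, {p : Fin n × Fin n | (p.1 : ℕ) < i ∨ (p.1 : ℕ) = i ∧ (p.2 : ℕ) < 0} =
      {p : Fin n × Fin n | (p.1 : ℕ) < i} := by intro i; ext p; simp
  have hCn : ∀ i, {p : Fin n × Fin n | (p.1 : ℕ) < i ∨ (p.1 : ℕ) = i ∧ (p.2 : ℕ) < n} =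
      {p : Fin n × Fin n | (p.1 : ℕ) < i + 1} := by
    intro i; ext p
    have := p.2.2
    simp only [Set.mem_ofPred_eq]
    omega
  refine WP.count (Inv := fun i s' => Inv {p | (p.1 : ℕ) < i} s')
    (by rw [w1]; simp [h2]) (by rw [w1]; simp [h0]) (by decide) (by rw [hn]; exact hM) ?_ ?_ ?_
  · have := (hset ∅ s 0 hs).1
    convert this using 1
    ext p; simp
  · intro i hi s₁ f₁ hi₁ h₁
    rw [hn] at hi
    have hn₁ : s₁.natReg 0 = n := by
      rw [← hn]
      exact f₁.natReg 0 (by simp [Program.count, Program.natWrites, h0])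
    refine WP.count (Inv := fun j s' =>
        Inv {p | (p.1 : ℕ) < i ∨ (p.1 : ℕ) = i ∧ (p.2 : ℕ) < j} s')
      h3 h0 (by decide) (by rw [hn₁]; exact hM) ?_ ?_ ?_
    · rw [hC0]
      exact (hset _ _ 0 h₁).2
    · intro j hj s₂ f₂ hj₂ h₂
      rw [hn₁] at hj
      have hi₂ : s₂.natReg 2 = i := by rw [f₂.natReg 2 (by rw [w1]; simp [h2]), hi₁]
      have f : Frame (pairs p) s s₂ := (f₁.trans f₂).of_subset
        (by intro z; simp [pairs, Program.count, Program.natWrites]; tauto)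
        (by simp [pairs, Program.count, Program.realWrites])
        (by simp [pairs, Program.count, Program.natArrWrites])
        (by simp [pairs, Program.count, Program.realArrWrites])
      refine (hstep _ ⟨i, hi⟩ ⟨j, hj⟩ s₂ (by simp) f hi₂ hj₂ h₂).mono fun s₃ _ h₃ => ?_
      refine (hset _ _ (j + 1) ?_).2
      convert h₃ using 1
      ext ⟨a, b⟩
      simp only [Set.mem_ofPred_eq, Set.mem_insert_iff, Prod.mk.injEq, Fin.ext_iff]
      omega
    · intro s₂ _ h₂
      rw [hn₁, hCn] at h₂
      exact (hset _ _ _ h₂).1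
  · intro s' f h
    refine hQ s' f ?_
    convert h using 1
    ext p
    simp [hn]

@[simp] lemma eqTest_holds (e f : NatExpr) : (eqTest e f).Holds s ↔ e.eval s = f.eval s := by
  simp only [eqTest, Test.Holds]
  omega

lemma StoresCore.of_eq (h : StoresCore G s) (h1 : s'.natArr 1 = s.natArr 1)
    (h2 : s'.natArr 2 = s.natArr 2) : StoresCore G s' :=
  ⟨fun v => by rw [h1]; exact h.mem v, fun v hv => by rw [h2]; exact h.deg v hv⟩

lemma StoresGraph.chainTest (hG : StoresGraph G s) (hC : StoresCore G s) {u v : NatExpr}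
    {a b : Fin n} (hu : u.eval s = a) (hv : v.eval s = b) :
    (chainTest u v).Holds s ↔ (chainGraph G).Adj a b := by
  have hd : ∀ v ∈ core G, s.natArr 2 v ≤ 2 ↔ ¬ Branch G v := by
    intro v hv
    rw [hC.deg v hv, Branch, not_and, not_le]
    exact ⟨fun h _ => by omega, fun h => by have := h hv; omega⟩
  simp only [DiskShrinking.chainTest, Test.Holds, hG.adjTest hu hv, NatExpr.eval, hu, hv, hC.mem]
  constructor
  · rintro ⟨h1, ⟨h2, h3⟩, h4, h5⟩
    exact ⟨h1, h2, h3, (hd _ h2).1 h4, (hd _ h3).1 h5⟩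
  · rintro ⟨h1, h2, h3, h4, h5⟩
    exact ⟨h1, ⟨h2, h3⟩, (hd _ h2).2 h4, (hd _ h3).2 h5⟩

/-- Equal labels mean connected by a chain; the converse holds for the pairs in `C`. -/
structure LabelInv (G : SimpleGraph (Fin n)) (C : Set (Fin n × Fin n)) (s : State) : Prop where
  lt : ∀ v : Fin n, s.natArr 3 v < n
  reach : ∀ u v : Fin n, s.natArr 3 u = s.natArr 3 v → (chainGraph G).Reachable u v
  eq : ∀ u v : Fin n, (u, v) ∈ C → (chainGraph G).Adj u v → s.natArr 3 u = s.natArr 3 v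

lemma relabel_spec (hM : n ≤ M) (hn : s.natReg 0 = n) :
    WP M relabel (fun s' => ∀ v : Fin n, s'.natArr 3 v =
      if s.natArr 3 v = s.natReg 6 then s.natReg 5 else s.natArr 3 v) s := by
  refine WP.count (Inv := fun i s' => ∀ v : Fin n, s'.natArr 3 v =
      if (v : ℕ) < i ∧ s.natArr 3 v = s.natReg 6 then s.natReg 5 else s.natArr 3 v)
    (by decide) (by decide) (by decide) (by rw [hn]; exact hM) (by simp) ?_ ?_
  · intro i hi s₁ f hi₁ h
    rw [hn] at hi
    have e5 := f.natReg 5 (by decide)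
    have e6 := f.natReg 6 (by decide)
    have hii := h ⟨i, hi⟩
    simp only [lt_irrefl, false_and, if_false] at hii
    simp only [WP, eqTest_holds, NatExpr.eval, hi₁, e5, e6, hii, setN_natArr, putN_natArr, if_true]
    refine ⟨fun hb v => ?_, fun hb v => ?_⟩
    · by_cases e : v = ⟨i, hi⟩
      · subst e; simp [hb]
      · have e' : (v : ℕ) ≠ i := fun h => e (Fin.ext h)
        rw [Function.update_of_ne e', h v]
        have : (v : ℕ) < i + 1 ↔ (v : ℕ) < i := by omega
        simp only [this]
    · rw [h v]
      by_cases e : v = ⟨i, hi⟩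
      · subst e; simp [hb]
      · have e' : (v : ℕ) ≠ i := fun h => e (Fin.ext h)
        have : (v : ℕ) < i + 1 ↔ (v : ℕ) < i := by omega
        simp only [this]
  · intro s₁ f h v
    rw [h v, hn]
    simp

theorem labelProgram_spec (hM : n ≤ M) (hG : StoresGraph G s) (hC : StoresCore G s) :
    WP M labelProgram (LabelInv G Set.univ) s := by
  refine (WP.count (Q := fun s' => ∀ v : Fin n, s'.natArr 3 v = v)
    (Inv := fun i s' => ∀ j < i, s'.natArr 3 j = j)
    (by decide) (by decide) (by decide) (by rw [hG.size]; exact hM) (by simp) ?_ ?_).mono ?_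
  · intro i hi s₁ f hi₁ h j hj
    simp only [NatExpr.eval, hi₁, setN_natArr, putN_natArr, if_true]
    by_cases e : j = i
    · simp [e]
    · rw [Function.update_of_ne e]; exact h j (by omega)
  · intro s₁ f h v
    exact h v (by rw [hG.size]; exact v.2)
  intro s₁ f₁ h₁
  have hG₁ := hG.of_frame f₁
  have hC₁ : StoresCore G s₁ :=
    hC.of_eq (f₁.natArr 1 (by decide)) (f₁.natArr 2 (by decide))
  refine WP_pairs (Inv := LabelInv G) (by decide) (by decide) (by decide) hG₁.size hM ?_ ?_ ?_ ?_
  · exact fun C s v h => ⟨⟨h.lt, h.reach, h.eq⟩, ⟨h.lt, h.reach, h.eq⟩⟩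
  · refine ⟨fun v => by rw [h₁]; exact v.2, fun u v h => ?_, fun u v h => absurd h (by simp)⟩
    rw [h₁, h₁, Fin.val_inj] at h
    rw [h]
  · intro C a b s₂ _ f₂ ha hb h₂
    have hG₂ := hG₁.of_frame f₂
    have hC₂ : StoresCore G s₂ :=
      hC₁.of_eq (f₂.natArr 1 (by decide)) (f₂.natArr 2 (by decide))
    simp only [WP, hG₂.chainTest hC₂ (show (NatExpr.reg 2).eval s₂ = a from ha)
      (show (NatExpr.reg 3).eval s₂ = b from hb), NatExpr.eval, ha, setN_natReg, setN_natArr]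
    refine ⟨fun hab => ?_, fun hab => ⟨h₂.lt, h₂.reach, fun u v huv e => ?_⟩⟩
    · refine (relabel_spec hM (by simpa using hG₂.size)).mono fun s₃ _ h₃ => ?_
      simp only [setN_natArr, setN_natReg, hb] at h₃
      norm_num at h₃
      refine ⟨fun v => ?_, fun u v h => ?_, fun u v huv e => ?_⟩
      · rw [h₃]; split_ifs
        · exact h₂.lt a
        · exact h₂.lt v
      · rw [h₃, h₃] at h
        split_ifs at h with e1 e2 e2
        · exact h₂.reach u v (e1.trans e2.symm)
        · exact (h₂.reach u b e1).trans (hab.symm.reachable.trans (h₂.reach a v h))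
        · exact (h₂.reach u a h).trans (hab.reachable.trans (h₂.reach b v e2.symm))
        · exact h₂.reach u v h
      · rw [h₃, h₃]
        rcases Set.mem_insert_iff.1 huv with h | h
        · obtain ⟨rfl, rfl⟩ := Prod.mk.inj h
          simp
        · rw [h₂.eq u v h e]
    · rcases Set.mem_insert_iff.1 huv with h | h
      · obtain ⟨rfl, rfl⟩ := Prod.mk.inj h
        exact absurd e hab
      · exact h₂.eq u v h e
  · intro s₂ _ h
    exact h

end Labels
end DiskShrinking

namespace DiskShrinking
open RealRAM

/-! ### The pool -/

/-- Append a vertex to the pool. -/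
def poolAdd (e : NatExpr) : Program :=
  .storeNat 4 (.reg 7) e ;; .setNat 7 (.add (.reg 7) (.lit 1))

/-- The first vertex is a branching vertex, the second one is in the core, and the disks meet. -/
def branchTest (u v : NatExpr) : Test :=
  .conj (.conj (.natLe (.lit 1) (.arr 1 u)) (.natLe (.lit 3) (.arr 2 u)))
    (.conj (.natLe (.lit 1) (.arr 1 v))
      (.neg (.realLe (.add (.arr 0 u) (.arr 0 v)) (distExpr u v))))

/-- Find the longest edge of the chain with the label in register 8. -/
def longestEdge : Program :=
  -- A value below every distance; it survives only if no chain edge has this label.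
  .setReal 2 (.sub (.lit 0) (.lit 1)) ;;
  pairs (.ite (.conj (chainTest (.reg 2) (.reg 3)) (.conj (eqTest (.arr 3 (.reg 2)) (.reg 8))
      (.neg (.realLe (distExpr (.reg 2) (.reg 3)) (.reg 2)))))
    (.setReal 2 (distExpr (.reg 2) (.reg 3)) ;; .setNat 9 (.reg 2) ;; .setNat 10 (.reg 3)) .skip)

def branchPool : Program :=
  .setNat 7 (.lit 0) ;; pairs (.ite (branchTest (.reg 2) (.reg 3)) (poolAdd (.reg 3)) .skip)

/-- All labels are vertex indices, so a loop over the indices meets every chain. A nonnegative real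
register 2 signals that the label occurs. -/
def chainPool : Program :=
  .count 8 0 (longestEdge ;;
    .ite (.realLe (.lit 0) (.reg 2)) (poolAdd (.reg 9) ;; poolAdd (.reg 10)) .skip)

section Pool
open Classical
variable {n M : ℕ} {G : SimpleGraph (Fin n)} {s s' : State}

/-- The vertices in the pool. -/
def poolSet (n : ℕ) (s : State) : Set (Fin n) := {v | ∃ i < s.natReg 7, s.natArr 4 i = v}

lemma poolAdd_spec {e : NatExpr} {Q : State → Prop} {v : ℕ} (he : e.eval s = v)
    (hQ : ∀ s', Frame (poolAdd e) s s' → s'.natReg 7 = s.natReg 7 + 1 →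
      (∀ i < s.natReg 7, s'.natArr 4 i = s.natArr 4 i) → s'.natArr 4 (s.natReg 7) = v → Q s') :
    WP M (poolAdd e) Q s := by
  have h : WP M (poolAdd e) (fun s' => s'.natReg 7 = s.natReg 7 + 1 ∧
      (∀ i < s.natReg 7, s'.natArr 4 i = s.natArr 4 i) ∧ s'.natArr 4 (s.natReg 7) = v) s := by
    simp only [poolAdd, WP, NatExpr.eval, he, setN_natReg, putN_natReg, setN_natArr, putN_natArr,
      if_true]
    refine ⟨trivial, fun i hi => ?_, by simp⟩
    rw [Function.update_of_ne (by omega)]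
  exact h.mono fun s' f h => hQ s' f h.1 h.2.1 h.2.2

/-- A pair that gives rise to a pool entry because of a branching vertex. -/
def BranchPair (G : SimpleGraph (Fin n)) (p : Fin n × Fin n) : Prop :=
  Branch G p.1 ∧ p.2 ∈ core G ∧ (p.1 = p.2 ∨ G.Adj p.1 p.2)

/-- The test leaves out the comparison of the indices: a disk of positive radius meets itself, so
the pair of a branching vertex with itself is accepted too. -/
lemma branchTest_holds (hG : StoresGraph G s) (hC : StoresCore G s)
    (hr : ∀ v : Fin n, 0 < s.realArr 0 v) {u v : NatExpr} {a b : Fin n}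
    (hu : u.eval s = a) (hv : v.eval s = b) :
    (branchTest u v).Holds s ↔ BranchPair G (a, b) := by
  simp only [branchTest, Test.Holds, NatExpr.eval, hu, hv, hC.mem, RealExpr.eval, distExpr_eval,
    not_le, BranchPair, Branch, hG.adj]
  have h1 : a = b → storedDist s a b < s.realArr 0 a + s.realArr 0 b := by
    rintro rfl
    simp only [storedDist, sub_self, mul_zero, add_zero, Real.sqrt_zero]
    linarith [hr a]
  constructor
  · rintro ⟨⟨h2, h3⟩, h4, h5⟩
    rw [hC.deg a h2] at h3
    exact ⟨⟨h2, h3⟩, h4, or_iff_not_imp_left.2 fun h => ⟨h, h5⟩⟩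
  · rintro ⟨⟨h2, h3⟩, h4, h5⟩
    rw [hC.deg a h2]
    exact ⟨⟨h2, h3⟩, h4, h5.elim h1 fun h => h.2⟩

/-- Pool entries for the pairs in `C`. -/
structure BranchInv (G : SimpleGraph (Fin n)) (C : Set (Fin n × Fin n)) (s : State) : Prop where
  lt : ∀ i < s.natReg 7, s.natArr 4 i < n
  mem : ∀ p ∈ C, BranchPair G p → p.2 ∈ poolSet n s
  size : s.natReg 7 ≤ (Finset.univ.filter fun p => p ∈ C ∧ BranchPair G p).card

theorem branchPool_spec (hM : n ≤ M) (hG : StoresGraph G s) (hC : StoresCore G s)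
    (hr : ∀ v : Fin n, 0 < s.realArr 0 v) : WP M branchPool (BranchInv G Set.univ) s := by
  simp only [branchPool, WP, NatExpr.eval]
  refine WP_pairs (Inv := BranchInv G) (by decide) (by decide) (by decide)
    (by simpa using hG.size) hM ?_ ?_ ?_ fun s' _ h => h
  · exact fun C s v h => ⟨⟨h.lt, h.mem, h.size⟩, ⟨h.lt, h.mem, h.size⟩⟩
  · exact ⟨by simp, by simp, by simp⟩
  · intro C a b s₁ hab f ha hb h
    have hG₁ : StoresGraph G s₁ := by
      refine StoresGraph.of_frame (s := s.setN 7 0) ⟨?_, hG.adj⟩ f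
      simpa using hG.size
    have hC₁ : StoresCore G s₁ :=
      hC.of_eq (f.natArr 1 (by decide)) (f.natArr 2 (by decide))
    have hr₁ : ∀ v : Fin n, 0 < s₁.realArr 0 v := by
      intro v; rw [f.realArr 0 (by decide)]; exact hr v
    rw [WP, branchTest_holds hG₁ hC₁ hr₁ (show (NatExpr.reg 2).eval s₁ = a from ha)
      (show (NatExpr.reg 3).eval s₁ = b from hb)]
    refine ⟨fun hp => ?_, fun hp => ⟨h.lt, fun p hpC hp' => ?_, ?_⟩⟩
    · refine poolAdd_spec hb fun s₂ f₂ e1 e2 e3 => ?_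
      have hsub : poolSet n s₁ ⊆ poolSet n s₂ := by
        rintro v ⟨i, hi, hv⟩
        exact ⟨i, by omega, by rw [e2 i hi, hv]⟩
      refine ⟨fun i hi => ?_, fun p hpC hp' => ?_, ?_⟩
      · rw [e1] at hi
        rcases Nat.lt_succ_iff_lt_or_eq.1 hi with hi | rfl
        · rw [e2 i hi]; exact h.lt i hi
        · rw [e3]; exact b.2
      · rcases Set.mem_insert_iff.1 hpC with rfl | hpC
        · exact ⟨s₁.natReg 7, by omega, e3⟩
        · exact hsub (h.mem p hpC hp')
      · rw [e1]
        -- Repeated entries are not filtered out. The size is bounded by the number of pairs, and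
        -- `(a, b)` is visited only once.
        refine le_trans ?_ (Finset.card_le_card
          (s := insert (a, b) (Finset.univ.filter fun p => p ∈ C ∧ BranchPair G p)) fun p hpi => ?_)
        · rw [Finset.card_insert_of_notMem (by simp [hab])]
          exact Nat.succ_le_succ h.size
        · simp only [Finset.mem_filter, Finset.mem_univ, true_and, Set.mem_insert_iff,
            Finset.mem_insert] at hpi ⊢
          rcases hpi with rfl | h
          · exact ⟨Or.inl rfl, hp⟩
          · exact ⟨Or.inr h.1, h.2⟩
    · rcases Set.mem_insert_iff.1 hpC with rfl | hpC
      · exact absurd hp' hp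
      · exact h.mem p hpC hp'
    · refine h.size.trans (Finset.card_le_card fun p => ?_)
      simp only [Finset.mem_filter, Finset.mem_univ, true_and, Set.mem_insert_iff]
      tauto

/-- The longest edge with label `l` among the pairs in `C` is stored. -/
def LongestInv (G : SimpleGraph (Fin n)) (l : ℕ) (C : Set (Fin n × Fin n)) (s : State) : Prop :=
  (s.realReg 2 = -1 ∧ ∀ u v : Fin n, (u, v) ∈ C → (chainGraph G).Adj u v → s.natArr 3 u ≠ l) ∨
  ∃ b c : Fin n, s.natReg 9 = b ∧ s.natReg 10 = c ∧ (chainGraph G).Adj b c ∧ s.natArr 3 b = l ∧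
    s.realReg 2 = storedDist s b c ∧ ∀ u v : Fin n, (u, v) ∈ C → (chainGraph G).Adj u v →
      s.natArr 3 u = l → storedDist s u v ≤ storedDist s b c

lemma storedDist_nonneg (s : State) (u v : ℕ) : 0 ≤ storedDist s u v := Real.sqrt_nonneg _

lemma longestEdge_spec (hM : n ≤ M) (hG : StoresGraph G s) (hC : StoresCore G s) :
    WP M longestEdge (LongestInv G (s.natReg 8) Set.univ) s := by
  simp only [longestEdge, WP, RealExpr.eval]
  refine WP_pairs (Inv := LongestInv G (s.natReg 8)) (by decide) (by decide) (by decide)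
    (by simpa using hG.size) hM ?_ ?_ ?_ fun s' _ h => h
  · intro C s v h
    exact ⟨h, h⟩
  · left; simp
  · intro C a b s₁ hab f ha hb h
    have hG₁ : StoresGraph G s₁ :=
      StoresGraph.of_frame (s := s.setR 2 _) ⟨hG.size, hG.adj⟩ f
    have hC₁ : StoresCore G s₁ :=
      hC.of_eq (f.natArr 1 (by decide)) (f.natArr 2 (by decide))
    have e8 : s₁.natReg 8 = s.natReg 8 := f.natReg 8 (by decide)
    simp only [WP, Test.Holds, hG₁.chainTest hC₁ (show (NatExpr.reg 2).eval s₁ = a from ha)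
      (show (NatExpr.reg 3).eval s₁ = b from hb), eqTest_holds, NatExpr.eval, RealExpr.eval, ha, hb,
      e8, distExpr_eval, not_le, setR_natReg, setN_natReg]
    refine ⟨fun hp => ?_, fun hp => ?_⟩
    · right
      refine ⟨a, b, by simp, by simp, hp.1, hp.2.1, rfl, ?_⟩
      intro u v huv hj hl
      change storedDist s₁ u v ≤ storedDist s₁ a b
      rcases Set.mem_insert_iff.1 huv with e | huv
      · obtain ⟨rfl, rfl⟩ := Prod.mk.inj e
        exact le_refl _
      · rcases h with ⟨h1, h2⟩ | ⟨b', c', h1, h2, h3, h4, h5, h6⟩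
        · exact absurd hl (h2 u v huv hj)
        · exact (h6 u v huv hj hl).trans (by rw [← h5]; exact hp.2.2.le)
    · rcases h with ⟨h1, h2⟩ | ⟨b', c', h1, h2, h3, h4, h5, h6⟩
      · left
        refine ⟨h1, fun u v huv hj hl => ?_⟩
        rcases Set.mem_insert_iff.1 huv with e | huv
        · obtain ⟨rfl, rfl⟩ := Prod.mk.inj e
          refine hp ⟨hj, hl, ?_⟩
          rw [h1]
          linarith [storedDist_nonneg s₁ u v]
        · exact h2 u v huv hj hl
      · right
        refine ⟨b', c', h1, h2, h3, h4, h5, fun u v huv hj hl => ?_⟩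
        rcases Set.mem_insert_iff.1 huv with e | huv
        · obtain ⟨rfl, rfl⟩ := Prod.mk.inj e
          rw [← h5]
          by_contra hlt
          exact hp ⟨hj, hl, not_le.1 hlt⟩
        · exact h6 u v huv hj hl

/-- The labels of the chains. -/
noncomputable def chainLabels (G : SimpleGraph (Fin n)) (lab : ℕ → ℕ) : Finset ℕ :=
  (Finset.univ.filter fun p : Fin n × Fin n => (chainGraph G).Adj p.1 p.2).image fun p => lab p.1

/-- The pool has an entry for each branch pair and the longest edge for each label below `i`. -/
structure PoolInv (G : SimpleGraph (Fin n)) (i : ℕ) (s : State) : Prop where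
  lt : ∀ i < s.natReg 7, s.natArr 4 i < n
  branch : ∀ p, BranchPair G p → p.2 ∈ poolSet n s
  chain : ∀ u v : Fin n, (chainGraph G).Adj u v → s.natArr 3 u < i →
    ∃ b c : Fin n, (chainGraph G).Adj b c ∧ s.natArr 3 b = s.natArr 3 u ∧ b ∈ poolSet n s ∧
      c ∈ poolSet n s ∧ storedDist s u v ≤ storedDist s b c
  size : s.natReg 7 ≤ (Finset.univ.filter (BranchPair G)).card +
    2 * ((chainLabels G (s.natArr 3)).filter (· < i)).card

theorem chainPool_spec (hM : n ≤ M) (hG : StoresGraph G s) (hC : StoresCore G s)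
    (hB : BranchInv G Set.univ s) : WP M chainPool (PoolInv G n) s := by
  refine WP.count (Inv := PoolInv G) (by decide) (by decide) (by decide)
    (by rw [hG.size]; exact hM) ?_ ?_ ?_
  · refine ⟨hB.lt, fun p hp => hB.mem p (Set.mem_univ p) hp, fun _ _ _ h => absurd h (by simp), ?_⟩
    have := hB.size
    simp only [Set.mem_univ, true_and] at this
    simpa using this
  · intro l hl s₁ f hl₁ h
    have hG₁ := hG.of_frame f
    have hC₁ : StoresCore G s₁ :=
      hC.of_eq (f.natArr 1 (by decide)) (f.natArr 2 (by decide))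
    refine (longestEdge_spec hM hG₁ hC₁).mono fun s₂ f₂ h₂ => ?_
    have e7 := f₂.natReg 7 (by decide)
    have a4 := f₂.natArr 4 (by decide)
    have a3 := f₂.natArr 3 (by decide)
    have hd : ∀ u v, storedDist s₂ u v = storedDist s₁ u v := fun u v => by
      rw [storedDist, storedDist, f₂.realArr 1 (by decide), f₂.realArr 2 (by decide)]
    have hpool : poolSet n s₂ = poolSet n s₁ := by rw [poolSet, poolSet, e7, a4]
    rw [hl₁] at h₂
    simp only [WP, Test.Holds, RealExpr.eval, Nat.cast_zero]
    refine ⟨fun hp => ?_, fun hp => ?_⟩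
    · rcases h₂ with ⟨h1, -⟩ | ⟨b, c, h1, h2, h3, h4, h5, h6⟩
      · rw [h1] at hp; norm_num at hp
      refine poolAdd_spec h1 fun s₃ f₃ e1 e2 e3 => ?_
      refine poolAdd_spec (v := c) (by rw [← h2]; exact f₃.natReg 10 (by decide))
        fun s₄ f₄ g1 g2 g3 => ?_
      have a3' : s₄.natArr 3 = s₁.natArr 3 := by
        rw [f₄.natArr 3 (by decide), f₃.natArr 3 (by decide), a3]
      have hd' : ∀ u v, storedDist s₄ u v = storedDist s₁ u v := fun u v => by
        rw [storedDist, f₄.realArr 1 (by decide), f₄.realArr 2 (by decide),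
          f₃.realArr 1 (by decide), f₃.realArr 2 (by decide), ← storedDist, hd]
      have hsub : poolSet n s₁ ⊆ poolSet n s₄ := by
        rintro v ⟨i, hi, hv⟩
        exact ⟨i, by omega, by rw [g2 i (by omega), e2 i (by omega), a4, hv]⟩
      have hbp : b ∈ poolSet n s₄ := ⟨s₂.natReg 7, by omega, by rw [g2 _ (by omega), e3]⟩
      have hcp : c ∈ poolSet n s₄ := ⟨s₃.natReg 7, by omega, g3⟩
      refine ⟨fun i hi => ?_, fun p hp => hsub (h.branch p hp), fun u v huv hlt => ?_, ?_⟩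
      · change i < s₄.natReg 7 at hi
        change s₄.natArr 4 i < n
        rcases lt_trichotomy i (s₂.natReg 7) with hi' | hi' | hi'
        · rw [g2 i (by omega), e2 i hi', a4]
          exact h.lt i (by omega)
        · rw [g2 i (by omega), hi', e3]
          exact b.2
        · obtain rfl : i = s₃.natReg 7 := by omega
          rw [g3]
          exact c.2
      · change s₄.natArr 3 u < l + 1 at hlt
        change ∃ b c : Fin n, _ ∧ s₄.natArr 3 b = s₄.natArr 3 u ∧ b ∈ poolSet n s₄ ∧
          c ∈ poolSet n s₄ ∧ storedDist s₄ u v ≤ storedDist s₄ b c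
        simp only [a3', hd'] at hlt ⊢
        rcases Nat.lt_succ_iff_lt_or_eq.1 hlt with hlt | hlt
        · obtain ⟨b', c', i1, i2, i3, i4, i5⟩ := h.chain u v huv hlt
          exact ⟨b', c', i1, i2, hsub i3, hsub i4, i5⟩
        · refine ⟨b, c, h3, by rw [hlt, ← a3, h4], hbp, hcp, ?_⟩
          have := h6 u v (Set.mem_univ _) huv (by rw [a3, hlt])
          rwa [hd, hd] at this
      · change s₄.natReg 7 ≤ _ + 2 * ((chainLabels G (s₄.natArr 3)).filter (· < l + 1)).card
        rw [a3']
        -- The edge just stored shows that `l` is a label of a chain; this label pays for the two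
        -- new entries.
        have hins : insert l ((chainLabels G (s₁.natArr 3)).filter (· < l)) ⊆
            (chainLabels G (s₁.natArr 3)).filter (· < l + 1) := by
          intro j hj
          rcases Finset.mem_insert.1 hj with rfl | hj
          · rw [Finset.mem_filter]
            refine ⟨Finset.mem_image.2 ⟨(b, c), by simpa using h3, ?_⟩, by omega⟩
            rw [← a3]; exact h4
          · rw [Finset.mem_filter] at hj ⊢
            exact ⟨hj.1, by omega⟩
        have := Finset.card_le_card hins
        rw [Finset.card_insert_of_notMem (by simp)] at this
        have := h.size
        omega
    · rcases h₂ with ⟨h1, h2⟩ | ⟨b, c, h1, h2, h3, h4, h5, h6⟩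
      · refine ⟨?_, ?_, fun u v huv hlt => ?_, ?_⟩
        · change ∀ i < s₂.natReg 7, s₂.natArr 4 i < n
          rw [e7, a4]; exact h.lt
        · change ∀ p, BranchPair G p → p.2 ∈ poolSet n s₂
          rw [hpool]; exact h.branch
        · change s₂.natArr 3 u < l + 1 at hlt
          change ∃ b c : Fin n, _ ∧ s₂.natArr 3 b = s₂.natArr 3 u ∧ b ∈ poolSet n s₂ ∧
            c ∈ poolSet n s₂ ∧ storedDist s₂ u v ≤ storedDist s₂ b c
          have := h2 u v (Set.mem_univ _) huv
          rw [hpool, a3]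
          rw [a3] at this hlt
          simp only [hd]
          exact h.chain u v huv (by omega)
        · change s₂.natReg 7 ≤ _ + 2 * ((chainLabels G (s₂.natArr 3)).filter (· < l + 1)).card
          rw [e7, a3]
          refine h.size.trans (Nat.add_le_add_left (Nat.mul_le_mul_left _
            (Finset.card_le_card fun j hj => ?_)) _)
          rw [Finset.mem_filter] at hj ⊢
          exact ⟨hj.1, by omega⟩
      · exact absurd (h5 ▸ storedDist_nonneg s₂ b c) hp
  · intro s' _ h
    rwa [hG.size] at h

end Pool
end DiskShrinking

namespace DiskShrinking
open RealRAM

/-! ### Decoding candidate solutions -/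

/-- Split off the last digit in the base of register 12 from register 16. -/
def readDigit : Program :=
  .setNat 17 (.reg 16) ;; .setNat 16 (.lit 0) ;;
  .loop (.natLe (.reg 12) (.reg 17))
    (.setNat 17 (.sub (.reg 17) (.reg 12)) ;; .setNat 16 (.add (.reg 16) (.lit 1)))

/-- Read the next vertex of the walk and update the amount. -/
def walkProgram : Program :=
  readDigit ;; .setNat 23 (.arr 4 (.reg 17)) ;;
  .ite (eqTest (.reg 23) (.reg 22)) .skip
    (.setReal 3 (.sub (.sub (.lit 2) (distExpr (.reg 22) (.reg 23))) (.reg 3)) ;;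
      .setNat 22 (.reg 23))

/-- Read the description of one shrunken disk. -/
def blockProgram : Program :=
  readDigit ;;
  .ite (.natLe (.reg 17) (.lit 0)) (.setReal 3 (.lit 0))
    (.setReal 3 (.sub (.lit 1) (.reg 0))) ;;
  readDigit ;; .setNat 22 (.arr 4 (.reg 17)) ;;
  .count 21 14 walkProgram ;;
  readDigit ;;
  .ite (.natLe (.reg 17) (.lit 0)) .skip (.setReal 3 (.div (.reg 3) (.lit 2)))

def decodeProgram : Program :=
  .count 20 0 (.storeNat 0 (.reg 20) (.lit 0) ;; .storeReal 0 (.reg 20) (.lit 1)) ;;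
  .count 20 1 (blockProgram ;; .storeNat 0 (.reg 22) (.lit 1) ;;
    .storeReal 0 (.reg 22) (.sub (.lit 1) (.reg 3)))

section Decode
open Classical

/-- The data that the decoding depends on. -/
structure Decoder where
  base : ℕ
  pool : ℕ → ℕ
  demand : ℕ → ℕ → ℝ
  maxShrink : ℝ
  walkLength : ℕ

namespace Decoder
variable (δ : Decoder)

/-- One step of the walk, with the digits that are left. -/
noncomputable def step (x : (ℕ × ℝ) × ℕ) : (ℕ × ℝ) × ℕ :=
  (walkStep δ.demand x.1 (δ.pool (x.2 % δ.base)), x.2 / δ.base)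

/-- The start of the walk. -/
noncomputable def start (q : ℕ) : (ℕ × ℝ) × ℕ :=
  ((δ.pool (q / δ.base % δ.base), if q % δ.base = 0 then 0 else δ.maxShrink),
    q / δ.base / δ.base)

/-- The vertex and the amount described by the last digits of `q`, and the other digits. -/
noncomputable def block (q : ℕ) : (ℕ × ℝ) × ℕ :=
  let x := δ.step^[δ.walkLength] (δ.start q)
  ((x.1.1, if x.2 % δ.base = 0 then x.1.2 else x.1.2 / 2), x.2 / δ.base)

/-- Marks, radii and remaining digits after one more disk. -/
noncomputable def next (x : (ℕ → ℕ) × (ℕ → ℝ) × ℕ) : (ℕ → ℕ) × (ℕ → ℝ) × ℕ :=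
  (Function.update x.1 (δ.block x.2.2).1.1 1,
    Function.update x.2.1 (δ.block x.2.2).1.1 (1 - (δ.block x.2.2).1.2), (δ.block x.2.2).2)

/-- Marks, radii and remaining digits after `i` disks. -/
noncomputable def decode (i t : ℕ) : (ℕ → ℕ) × (ℕ → ℝ) × ℕ :=
  δ.next^[i] (fun _ => 0, fun _ => 1, t)

end Decoder

/-- The decoder is stored in memory. -/
structure StoresDecoder (δ : Decoder) (s : State) : Prop where
  base : s.natReg 12 = δ.base
  pool : s.natArr 4 = δ.pool
  demand : ∀ u v, 2 - storedDist s u v = δ.demand u v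
  maxShrink : 1 - s.realReg 0 = δ.maxShrink
  walkLength : s.natReg 14 = δ.walkLength

variable {M : ℕ} {s s' : State} {δ : Decoder}

lemma StoresDecoder.of_frame {p : Program} (h : StoresDecoder δ s) (f : Frame p s s')
    (h0 : 12 ∉ p.natWrites := by decide) (h1 : 14 ∉ p.natWrites := by decide)
    (h2 : 0 ∉ p.realWrites := by decide) (h3 : 4 ∉ p.natArrWrites := by decide)
    (h4 : 1 ∉ p.realArrWrites := by decide) (h5 : 2 ∉ p.realArrWrites := by decide) :
    StoresDecoder δ s' :=
  ⟨by rw [f.natReg 12 h0, h.base], by rw [f.natArr 4 h3, h.pool],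
    fun u v => by rw [storedDist, f.realArr 1 h4, f.realArr 2 h5, ← storedDist, h.demand],
    by rw [f.realReg 0 h2, h.maxShrink], by rw [f.natReg 14 h1, h.walkLength]⟩

lemma readDigit_spec {Q : State → Prop} {D : ℕ} (hD : s.natReg 12 = D) (hpos : 0 < D)
    (hM : s.natReg 16 ≤ M) (hQ : ∀ s', Frame readDigit s s' →
      s'.natReg 17 = s.natReg 16 % D → s'.natReg 16 = s.natReg 16 / D → Q s') :
    WP M readDigit Q s := by
  have h : WP M readDigit (fun s' => s'.natReg 17 = s.natReg 16 % D ∧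
      s'.natReg 16 = s.natReg 16 / D) s := by
    set q := s.natReg 16 with hq
    -- Integers cannot be divided, so the quotient is the number of subtractions. This costs up to
    -- the value of the code, which `M` dominates.
    refine ⟨q / D, (Nat.div_le_self _ _).trans hM, fun i s' => s'.natReg 16 = i ∧
      s'.natReg 17 + D * i = q ∧ s'.natReg 12 = D, ?_, ?_, ?_⟩
    · simp [hD, hq]
    · rintro i hi s₁ ⟨h1, h2, h3⟩
      have hle : D ≤ s₁.natReg 17 := by
        have : D * (i + 1) ≤ D * (q / D) := Nat.mul_le_mul_left _ hi
        have h4 := Nat.mul_div_le q D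
        rw [Nat.mul_succ] at this
        omega
      simp only [Test.Holds, NatExpr.eval, h3, WP, setN_natReg, h1]
      norm_num
      refine ⟨hle, ?_⟩
      rw [Nat.mul_succ]
      omega
    · rintro s₁ ⟨h1, h2, h3⟩
      have h4 := Nat.div_add_mod q D
      have h5 := Nat.mod_lt q hpos
      simp only [Test.Holds, NatExpr.eval, h3]
      refine ⟨by omega, by omega, h1⟩
  exact h.mono fun s' f h => hQ s' f h.1 h.2

lemma walkProgram_spec (h : StoresDecoder δ s) (hpos : 0 < δ.base) (hM : s.natReg 16 ≤ M) :
    WP M walkProgram (fun s' => ((s'.natReg 22, s'.realReg 3), s'.natReg 16) =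
      δ.step ((s.natReg 22, s.realReg 3), s.natReg 16)) s := by
  refine readDigit_spec h.base hpos hM fun s₁ f h1 h2 => ?_
  have e22 := f.natReg 22 (by decide)
  have e3 := f.realReg 3 (by decide)
  have hd := (h.of_frame f).demand
  have ha := (h.of_frame f).pool
  have hd' : ∀ v u w, storedDist (s₁.setN v u) w = storedDist s₁ w := fun _ _ _ => rfl
  simp only [WP, NatExpr.eval, eqTest_holds, RealExpr.eval, distExpr_eval, setN_natReg,
    setR_natReg, setN_realReg, setR_realReg, h1, h2, e22, e3, ha, Decoder.step, walkStep, hd']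
  norm_num
  refine ⟨fun h => ?_, fun h => ?_⟩
  · exact fun h' => absurd h h'
  · rw [if_neg h, ← hd]

lemma blockProgram_spec (h : StoresDecoder δ s) (hpos : 0 < δ.base) (hM : s.natReg 16 ≤ M)
    (hM' : δ.walkLength ≤ M) :
    WP M blockProgram (fun s' => ((s'.natReg 22, s'.realReg 3), s'.natReg 16) =
      δ.block (s.natReg 16) ∧ s'.natReg 16 ≤ M) s := by
  refine readDigit_spec h.base hpos hM fun s₁ f₁ h1 h2 => ?_
  have hd₁ := h.of_frame f₁
  have hM₁ : s₁.natReg 16 ≤ M := by rw [h2]; exact (Nat.div_le_self _ _).trans hM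
  have hanchor : WP M (.ite (.natLe (.reg 17) (.lit 0)) (.setReal 3 (.lit 0))
      (.setReal 3 (.sub (.lit 1) (.reg 0)))) (fun s' => s'.realReg 3 =
        if s.natReg 16 % δ.base = 0 then 0 else δ.maxShrink) s₁ := by
    simp only [WP, Test.Holds, NatExpr.eval, RealExpr.eval, h1, Nat.le_zero, setR_realReg, if_true]
    refine ⟨fun h => by rw [if_pos h]; simp, fun h => by rw [if_neg h, ← hd₁.maxShrink]; simp⟩
  refine hanchor.mono fun s₂ f₂ h3 => ?_
  have hd₂ := hd₁.of_frame f₂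
  have e16 := f₂.natReg 16 (by decide)
  refine readDigit_spec hd₂.base hpos (by rw [e16]; exact hM₁) fun s₃ f₃ h4 h5 => ?_
  have hd₃ := hd₂.of_frame f₃
  have e3 := f₃.realReg 3 (by decide)
  simp only [WP, NatExpr.eval]
  set s₄ := s₃.setN 22 (s₃.natArr 4 (s₃.natReg 17)) with hs₄
  have hd₄ : StoresDecoder δ s₄ :=
    ⟨by simpa [hs₄] using hd₃.base, hd₃.pool, hd₃.demand, hd₃.maxShrink,
      by simpa [hs₄] using hd₃.walkLength⟩
  have hstart : ((s₄.natReg 22, s₄.realReg 3), s₄.natReg 16) = δ.start (s.natReg 16) := by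
    simp only [hs₄, setN_natReg, setN_realReg, hd₃.pool, h4, h5, e16, h2, e3, h3, Decoder.start]
    norm_num
  have hM₄ : s₄.natReg 16 ≤ M := by
    have : s₄.natReg 16 = s₃.natReg 16 := by simp [hs₄]
    rw [this, h5, e16]
    exact (Nat.div_le_self _ _).trans hM₁
  refine WP.count (Inv := fun i s' => ((s'.natReg 22, s'.realReg 3), s'.natReg 16) =
      δ.step^[i] (δ.start (s.natReg 16)) ∧ s'.natReg 16 ≤ M)
    (by decide) (by decide) (by decide) (by rw [hd₄.walkLength]; exact hM') ?_ ?_ ?_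
  · simpa using ⟨hstart, hM₄⟩
  · rintro i hi s₅ f₅ hi₅ ⟨h6, h7⟩
    have hd₅ := hd₄.of_frame f₅
    refine (walkProgram_spec hd₅ hpos h7).mono fun s₆ f₆ h8 => ?_
    rw [Function.iterate_succ_apply', ← h6]
    refine ⟨h8, ?_⟩
    have := congrArg Prod.snd h8
    change s₆.natReg 16 = s₅.natReg 16 / δ.base at this
    change s₆.natReg 16 ≤ M
    rw [this]
    exact (Nat.div_le_self _ _).trans h7
  · rintro s₅ f₅ ⟨h6, h7⟩
    rw [hd₄.walkLength] at h6
    have hd₅ := hd₄.of_frame f₅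
    refine readDigit_spec hd₅.base hpos h7 fun s₆ f₆ h8 h9 => ?_
    have e22 := f₆.natReg 22 (by decide)
    have e3 := f₆.realReg 3 (by decide)
    have hM₆ : s₆.natReg 16 ≤ M := by rw [h9]; exact (Nat.div_le_self _ _).trans h7
    simp only [Test.Holds, NatExpr.eval, RealExpr.eval, setR_natReg, setR_realReg, if_true,
      Nat.le_zero]
    refine ⟨fun hz => ⟨?_, hM₆⟩, fun hz => ⟨?_, hM₆⟩⟩
    · rw [h8] at hz
      rw [Decoder.block, ← h6, h9, e22, e3]
      simp [hz]
    · rw [h8] at hz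
      rw [Decoder.block, ← h6, h9, e22, e3]
      simp [hz]

theorem decodeProgram_spec {n : ℕ} (h : StoresDecoder δ s) (hpos : 0 < δ.base)
    (hM : s.natReg 16 ≤ M) (hM' : δ.walkLength ≤ M) (hk : s.natReg 1 ≤ M) (hn : s.natReg 0 = n)
    (hnM : n ≤ M) :
    WP M decodeProgram (fun s' => ∀ v < n,
      s'.natArr 0 v = (δ.decode (s.natReg 1) (s.natReg 16)).1 v ∧
      s'.realArr 0 v = (δ.decode (s.natReg 1) (s.natReg 16)).2.1 v) s := by
  refine (WP.count (Q := fun s' => ∀ v < n, s'.natArr 0 v = 0 ∧ s'.realArr 0 v = 1)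
    (Inv := fun i s' => ∀ j < i, s'.natArr 0 j = 0 ∧ s'.realArr 0 j = 1)
    (by decide) (by decide) (by decide) (by rw [hn]; exact hnM) (by simp) ?_ ?_).mono ?_
  · intro i hi s₁ f hi₁ h j hj
    simp only [NatExpr.eval, RealExpr.eval, putN_natReg, hi₁, setN_natArr, setN_realArr,
      putN_natArr, putR_natArr, putR_realArr, putN_realArr, if_true]
    by_cases e : j = i
    · simp [e]
    · rw [Function.update_of_ne e, Function.update_of_ne e]; exact h j (by omega)
  · intro s₁ f h
    rwa [hn] at h
  intro s₁ f₁ h₁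
  have hd₁ := h.of_frame f₁
  have e1 := f₁.natReg 1 (by decide)
  have e16 := f₁.natReg 16 (by decide)
  refine WP.count (Inv := fun i s' => (∀ v < n,
      s'.natArr 0 v = (δ.decode i (s.natReg 16)).1 v ∧
      s'.realArr 0 v = (δ.decode i (s.natReg 16)).2.1 v) ∧
      s'.natReg 16 = (δ.decode i (s.natReg 16)).2.2 ∧ s'.natReg 16 ≤ M)
    (by decide) (by decide) (by decide) (by rw [e1]; exact hk) ?_ ?_ ?_
  · refine ⟨h₁, ?_, ?_⟩
    · simpa [Decoder.decode] using e16
    · simpa [e16] using hM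
  · rintro i hi s₂ f₂ hi₂ ⟨h2, h3, h4⟩
    have hd₂ := hd₁.of_frame f₂
    refine (blockProgram_spec hd₂ hpos h4 hM').mono fun s₃ f₃ h5 => ?_
    obtain ⟨h5, h6⟩ := h5
    have a0 := f₃.natArr 0 (by decide)
    have r0 := f₃.realArr 0 (by decide)
    have hdec : δ.decode (i + 1) (s.natReg 16) = δ.next (δ.decode i (s.natReg 16)) := by
      rw [Decoder.decode, Function.iterate_succ_apply', ← Decoder.decode]
    rw [hdec, Decoder.next, ← h3, ← h5]
    simp only [WP, NatExpr.eval, RealExpr.eval, putN_natReg, putR_natReg, putN_natArr, putN_realReg,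
      setN_natArr, setN_realArr, putR_natArr, putR_realArr, putN_realArr, if_true, setN_natReg, a0,
      r0]
    refine ⟨fun v hv => ?_, by simp, by simpa using h6⟩
    by_cases e : v = s₃.natReg 22
    · simp [e]
    · rw [Function.update_of_ne e, Function.update_of_ne e, Function.update_of_ne e,
        Function.update_of_ne e]
      exact h2 v hv
  · rintro s₂ f₂ ⟨h2, -, -⟩
    rwa [e1] at h2

end Decode
end DiskShrinking

namespace DiskShrinking
open RealRAM

/-! ### Encoding walk solutions -/

namespace Decoder
open Classical
variable {δ : Decoder}

lemma decode_succ (i t : ℕ) : δ.decode (i + 1) t = δ.next (δ.decode i t) := by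
  rw [decode, Function.iterate_succ_apply', ← decode]

lemma card_decode_le (n i t : ℕ) :
    (Finset.univ.filter fun v : Fin n => (δ.decode i t).1 v ≠ 0).card ≤ i := by
  induction i with
  | zero => simp [decode]
  | succ i ih =>
    rw [decode_succ]
    set x := δ.decode i t
    by_cases hb : (δ.block x.2.2).1.1 < n
    · refine le_trans (Finset.card_le_card
        (t := insert ⟨_, hb⟩ (Finset.univ.filter fun v : Fin n => x.1 v ≠ 0)) fun v hv => ?_)
        ((Finset.card_insert_le _ _).trans (Nat.succ_le_succ ih))
      rw [Finset.mem_insert]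
      by_cases e : (v : ℕ) = (δ.block x.2.2).1.1
      · exact Or.inl (Fin.ext e)
      · right
        rw [Finset.mem_filter] at hv
        simpa [next, Function.update_of_ne e] using hv
    · refine le_trans (Finset.card_le_card fun v hv => ?_) (ih.trans (Nat.le_succ i))
      have e : (v : ℕ) ≠ (δ.block x.2.2).1.1 := fun h => hb (h ▸ v.2)
      rw [Finset.mem_filter] at hv
      simpa [next, Function.update_of_ne e] using hv

/-- A block marks a vertex whenever it changes its radius. Together with the bound on the number of
marks, this makes every code a candidate with at most as many shrunken disks as blocks. -/
lemma decode_radius (i t v : ℕ) (h : (δ.decode i t).1 v = 0) : (δ.decode i t).2.1 v = 1 := by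
  induction i with
  | zero => simp [decode]
  | succ i ih =>
    rw [decode_succ] at h ⊢
    set x := δ.decode i t
    by_cases e : v = (δ.block x.2.2).1.1
    · simp [next, e] at h
    · simp only [next, Function.update_of_ne e] at h ⊢
      exact ih h

lemma add_mul_mod_div {D d c : ℕ} (hd : d < D) :
    (d + D * c) % D = d ∧ (d + D * c) / D = c := by
  have hD : 0 < D := by omega
  constructor
  · rw [Nat.add_mul_mod_self_left, Nat.mod_eq_of_lt hd]
  · rw [Nat.add_mul_div_left _ _ hD, Nat.div_eq_of_lt hd, zero_add]

lemma exists_walk_code (l : List ℕ) (hl : ∀ v ∈ l, ∃ d < δ.base, δ.pool d = v) (x : ℕ × ℝ) :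
    ∃ c < δ.base ^ l.length, ∀ q,
      δ.step^[l.length] (x, c + δ.base ^ l.length * q) = (l.foldl (walkStep δ.demand) x, q) := by
  induction l generalizing x with
  | nil => exact ⟨0, by simp, fun q => by simp⟩
  | cons v l ih =>
    obtain ⟨d, hd, hdv⟩ := hl v (by simp)
    obtain ⟨c, hc, h⟩ := ih (fun u hu => hl u (by simp [hu])) (walkStep δ.demand x v)
    refine ⟨d + δ.base * c, ?_, fun q => ?_⟩
    · have := Nat.mul_le_mul_left δ.base (Nat.succ_le_of_lt hc)
      rw [Nat.mul_succ] at this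
      rw [List.length_cons, pow_succ, mul_comm (_ ^ _)]
      omega
    · have e : d + δ.base * c + δ.base ^ (v :: l).length * q =
          d + δ.base * (c + δ.base ^ l.length * q) := by
        rw [List.length_cons]; ring
      obtain ⟨h1, h2⟩ := add_mul_mod_div (c := c + δ.base ^ l.length * q) hd
      rw [List.length_cons] at e
      rw [List.length_cons, e, Function.iterate_succ_apply, step, h1, h2, hdv, h,
        List.foldl_cons]

/-- The amount `x` for the vertex `p` can be encoded. -/
def Coded (δ : Decoder) (p : ℕ) (x : ℝ) : Prop :=
  ∃ c < δ.base ^ (δ.walkLength + 3), ∀ q,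
    δ.block (c + δ.base ^ (δ.walkLength + 3) * q) = ((p, x), q)

/-- From the lowest digit upwards a block holds the anchor, the first vertex, the vertices of the
walk and the halving flag. Base at least two is needed for the two values of the anchor and of the
flag. -/
lemma coded_of_walk (hD : 2 ≤ δ.base) {p v : ℕ} {x y y' : ℝ} {l : List ℕ}
    (hp : ∃ d < δ.base, δ.pool d = p) (hv : ∃ d < δ.base, δ.pool d = v)
    (hl : ∀ v ∈ l, ∃ d < δ.base, δ.pool d = v) (hlen : l.length ≤ δ.walkLength)
    (hy : y = 0 ∨ y = δ.maxShrink) (hfold : l.foldl (walkStep δ.demand) (v, y) = (p, y'))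
    (hx : x = y' ∨ x = y' / 2) : δ.Coded p x := by
  obtain ⟨d₁, hd₁, hdv⟩ := hv
  obtain ⟨d₀, hd₀, hy'⟩ : ∃ d₀ < δ.base, (if d₀ = 0 then 0 else δ.maxShrink) = y := by
    rcases hy with rfl | rfl
    · exact ⟨0, by omega, by simp⟩
    · exact ⟨1, by omega, by simp⟩
  obtain ⟨d₂, hd₂, hx'⟩ : ∃ d₂ < δ.base, (if d₂ = 0 then y' else y' / 2) = x := by
    rcases hx with rfl | rfl
    · exact ⟨0, by omega, by simp⟩
    · exact ⟨1, by omega, by simp⟩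
  -- Walks shorter than `walkLength` are filled up with copies of their last vertex `p`.
  have hpad : ∀ j, (List.replicate j p).foldl (walkStep δ.demand) (p, y') = (p, y') := by
    intro j
    induction j with
    | zero => rfl
    | succ j ih =>
      rw [List.replicate_succ, List.foldl_cons]
      have : walkStep δ.demand (p, y') p = (p, y') := if_pos rfl
      rw [this, ih]
  obtain ⟨c, hc, h⟩ := exists_walk_code (l ++ List.replicate (δ.walkLength - l.length) p)
    (fun u hu => by
      rcases List.mem_append.1 hu with hu | hu
      · exact hl u hu
      · rw [List.eq_of_mem_replicate hu]; exact hp) (v, y)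
  have hlen' : (l ++ List.replicate (δ.walkLength - l.length) p).length = δ.walkLength := by
    rw [List.length_append, List.length_replicate]; omega
  rw [hlen'] at hc
  simp only [hlen', List.foldl_append, hfold, hpad] at h
  refine ⟨d₀ + δ.base * (d₁ + δ.base * (c + δ.base ^ δ.walkLength * d₂)), ?_, fun q => ?_⟩
  · have h1 : c + δ.base ^ δ.walkLength * d₂ + 1 ≤ δ.base ^ δ.walkLength * δ.base := by
      have := Nat.mul_le_mul_left (δ.base ^ δ.walkLength) (Nat.succ_le_of_lt hd₂)
      rw [Nat.mul_succ] at this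
      omega
    have h2 := Nat.mul_le_mul_left δ.base h1
    rw [Nat.mul_succ] at h2
    have h3 : d₁ + δ.base * (c + δ.base ^ δ.walkLength * d₂) + 1 ≤
        δ.base * (δ.base ^ δ.walkLength * δ.base) := by omega
    have h4 := Nat.mul_le_mul_left δ.base h3
    rw [Nat.mul_succ] at h4
    have h5 : δ.base ^ (δ.walkLength + 3) =
        δ.base * (δ.base * (δ.base ^ δ.walkLength * δ.base)) := by ring
    omega
  · have e : d₀ + δ.base * (d₁ + δ.base * (c + δ.base ^ δ.walkLength * d₂)) +
        δ.base ^ (δ.walkLength + 3) * q = d₀ + δ.base * (d₁ + δ.base *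
        (c + δ.base ^ δ.walkLength * (d₂ + δ.base * q))) := by ring
    have hs : δ.start (d₀ + δ.base * (d₁ + δ.base *
        (c + δ.base ^ δ.walkLength * (d₂ + δ.base * q)))) =
        ((v, y), c + δ.base ^ δ.walkLength * (d₂ + δ.base * q)) := by
      rw [start, (add_mul_mod_div hd₀).1, (add_mul_mod_div hd₀).2, (add_mul_mod_div hd₁).1,
        (add_mul_mod_div hd₁).2, hdv, hy']
    rw [e, block, hs, h]
    simp only [(add_mul_mod_div hd₂).1, (add_mul_mod_div hd₂).2, hx']

/-- The list may repeat vertices, because each occurrence of a vertex assigns the same radius. -/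
lemma exists_decode_code {z : ℕ → ℝ} (l : List ℕ) (hl : ∀ p ∈ l, δ.Coded p (z p))
    (S : ℕ → ℕ) (r : ℕ → ℝ) :
    ∃ t < δ.base ^ ((δ.walkLength + 3) * l.length), ∀ v,
      (δ.next^[l.length] (S, r, t)).2.1 v = if v ∈ l then 1 - z v else r v := by
  induction l generalizing S r with
  | nil => exact ⟨0, by simp, fun v => by simp⟩
  | cons p l ih =>
    obtain ⟨c, hc, h⟩ := hl p (by simp)
    obtain ⟨t, ht, h'⟩ := ih (fun u hu => hl u (by simp [hu])) (Function.update S p 1)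
      (Function.update r p (1 - z p))
    refine ⟨c + δ.base ^ (δ.walkLength + 3) * t, ?_, fun v => ?_⟩
    · have := Nat.mul_le_mul_left (δ.base ^ (δ.walkLength + 3)) (Nat.succ_le_of_lt ht)
      rw [Nat.mul_succ] at this
      have e : δ.base ^ ((δ.walkLength + 3) * (p :: l).length) =
          δ.base ^ (δ.walkLength + 3) * δ.base ^ ((δ.walkLength + 3) * l.length) := by
        rw [List.length_cons, ← pow_add]
        congr 1
        ring
      omega
    · rw [List.length_cons, Function.iterate_succ_apply, next]
      simp only [h]
      rw [h']
      by_cases e : v = p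
      · subst e; simp
      · simp [e]

end Decoder

open Classical in
/-- Some code below the number of all codes yields a solution that is at least as good as any given
solution. -/
theorem exists_code (I : Instance) {δ : Decoder} (hD : 2 ≤ δ.base)
    (hw : ∀ u v : Fin I.n, δ.demand u v = demand I u v) (ha : δ.maxShrink = 1 - I.α)
    (hm : 2 * I.k ≤ δ.walkLength) (pool : Set (Fin I.n))
    (hpool : ∀ v ∈ pool, ∃ d < δ.base, δ.pool d = v)
    (hbranch : ∀ p, BranchPair (diskGraph I.P fun _ => 1) p → p.2 ∈ pool)
    (hchain : ∀ u v, (chainGraph (diskGraph I.P fun _ => 1)).Adj u v →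
      ∃ b c, (chainGraph (diskGraph I.P fun _ => 1)).Adj b c ∧
      (chainGraph (diskGraph I.P fun _ => 1)).Reachable u b ∧ b ∈ pool ∧ c ∈ pool ∧
      dist (I.P u) (I.P v) ≤ dist (I.P b) (I.P c))
    {S : Finset (Fin I.n)} {r : Fin I.n → ℝ} (h : IsSolution I S r) :
    ∃ t < δ.base ^ ((δ.walkLength + 3) * I.k),
      (∀ v : Fin I.n, I.α ≤ (δ.decode I.k t).2.1 v ∧ (δ.decode I.k t).2.1 v ≤ 1) ∧
      (diskGraph I.P fun v => (δ.decode I.k t).2.1 v).IsAcyclic ∧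
      ∑ v : Fin I.n, (1 - (δ.decode I.k t).2.1 v) ≤ cost S r := by
  obtain ⟨T, z, hT, hz0, hz, hac, hcost, hwalk⟩ := exists_walk_solution I pool
    (fun u v h1 h2 h3 => hbranch (u, v) ⟨h1, h2, h3⟩) hchain h
  set z' : ℕ → ℝ := fun v => if h : v < I.n then z ⟨v, h⟩ else 0 with hz'
  have hz'v : ∀ v : Fin I.n, z' v = z v := fun v => by simp [hz']
  have hfold : ∀ (l : List (Fin I.n)) (v : Fin I.n) (y : ℝ),
      (l.map Fin.val).foldl (walkStep δ.demand) ((v : ℕ), y) =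
        (((l.foldl (walkStep (demand I)) (v, y)).1 : ℕ),
          (l.foldl (walkStep (demand I)) (v, y)).2) := by
    intro l
    induction l with
    | nil => intro v y; rfl
    | cons u l ih =>
      intro v y
      rw [List.map_cons, List.foldl_cons, List.foldl_cons]
      by_cases e : u = v
      · subst e
        simp only [walkStep, if_true]
        exact ih u y
      · have e' : (u : ℕ) ≠ v := fun h => e (Fin.ext h)
        simp only [walkStep, if_neg e, if_neg e']
        rw [hw]
        exact ih u _
  have hcoded : ∀ p ∈ T, δ.Coded p (z' p) := by
    intro p hp
    obtain ⟨hpp, v, hv, y, y', l, h1, h2, h3, h4, h5⟩ := hwalk p hp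
    refine Decoder.coded_of_walk (l := l.map Fin.val) hD (hpool p hpp) (hpool v hv) ?_ ?_
      (by rw [ha]; exact h1) (by rw [hfold, h4]) (by rw [hz'v]; exact h5)
    · intro u hu
      obtain ⟨u, hu', rfl⟩ := List.mem_map.1 hu
      exact hpool u (h2 u hu')
    · rw [List.length_map]; omega
  have hlist : ∃ l : List ℕ, l.length = I.k ∧ (∀ p ∈ l, δ.Coded p (z' p)) ∧
      ∀ v : Fin I.n, (v : ℕ) ∉ l → z v = 0 := by
    -- Decoding always reads exactly `k` blocks, so the list is filled up: with a repeated vertex of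
    -- `T`, or, if `T` is empty, with whatever the pool array holds at index 0 and amount 0.
    rcases T.eq_empty_or_nonempty with hTe | ⟨p, hp⟩
    · refine ⟨List.replicate I.k (δ.pool 0), by simp, fun p hp => ?_, fun v _ =>
        hz0 v (by simp [hTe])⟩
      rw [List.eq_of_mem_replicate hp]
      have hzz : z' (δ.pool 0) = 0 := by
        simp only [hz']
        split_ifs
        · exact hz0 _ (by simp [hTe])
        · rfl
      rw [hzz]
      exact Decoder.coded_of_walk (l := []) (y := 0) hD ⟨0, by omega, rfl⟩ ⟨0, by omega, rfl⟩
        (by simp) (by simp) (Or.inl rfl) rfl (Or.inl rfl)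
    · refine ⟨T.toList.map Fin.val ++ List.replicate (I.k - T.card) (p : ℕ), ?_, ?_, ?_⟩
      · rw [List.length_append, List.length_map, Finset.length_toList, List.length_replicate]
        omega
      · intro q hq
        rcases List.mem_append.1 hq with hq | hq
        · obtain ⟨u, hu, rfl⟩ := List.mem_map.1 hq
          exact hcoded u (Finset.mem_toList.1 hu)
        · rw [List.eq_of_mem_replicate hq]
          exact hcoded p hp
      · intro v hv
        refine hz0 v fun hvT => hv (List.mem_append_left _ (List.mem_map.2 ⟨v, ?_, rfl⟩))
        exact Finset.mem_toList.2 hvT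
  obtain ⟨l, hl1, hl2, hl3⟩ := hlist
  obtain ⟨t, ht, h'⟩ := Decoder.exists_decode_code l hl2 (fun _ => 0) (fun _ => 1)
  rw [hl1] at ht h'
  have hrad : ∀ v : Fin I.n, (δ.decode I.k t).2.1 v = 1 - z v := by
    intro v
    have := h' v
    rw [← Decoder.decode] at this
    rw [this]
    split_ifs with hv
    · rw [hz'v]
    · rw [hl3 v hv, sub_zero]
  refine ⟨t, ht, fun v => ?_, ?_, ?_⟩
  · rw [hrad]
    have := hz v
    constructor <;> linarith
  · simpa only [hrad] using hac
  · simpa only [hrad, sub_sub_cancel] using hcost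

end DiskShrinking

namespace DiskShrinking
open RealRAM

/-! ### The search for the best code -/

/-- Test the radii and the graph, and compute the cost. -/
def checkProgram : Program :=
  .setNat 24 (.lit 1) ;; .setReal 4 (.lit 0) ;;
  .count 20 0 (.setReal 4 (.add (.reg 4) (.sub (.lit 1) (.arr 0 (.reg 20)))) ;;
    .ite (.conj (.realLe (.reg 0) (.arr 0 (.reg 20))) (.realLe (.arr 0 (.reg 20)) (.lit 1)))
      .skip (.setNat 24 (.lit 0))) ;;
  coreProgram ;;
  .count 20 0 (.ite (.natLe (.lit 1) (.arr 1 (.reg 20))) (.setNat 24 (.lit 0)) .skip)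

/-- Decode the code in register 15 and compare the result with the best one so far. -/
def tryCode : Program :=
  .setNat 16 (.reg 15) ;; decodeProgram ;; checkProgram ;;
  .ite (.conj (.natLe (.lit 1) (.reg 24)) (.realLe (.reg 4) (.reg 5)))
    (.setReal 5 (.reg 4) ;; .setNat 18 (.reg 15) ;; .setNat 19 (.lit 1)) .skip

/-- The power of the register 12 with the product of the registers 1 and 27 as exponent. -/
def powerProgram : Program :=
  .setNat 13 (.lit 1) ;;
  .count 2 1 (.count 3 27 (.setNat 26 (.lit 0) ;;
    .count 25 12 (.setNat 26 (.add (.reg 26) (.reg 13))) ;; .setNat 13 (.reg 26)))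

/-- Register 12 holds the base, pool size plus two, so the digits 0 and 1 exist even for an empty
pool. Register 27 holds the number of digits per disk and register 13 the number of codes. The best
code is decoded again at the end to restore its output. -/
def searchProgram : Program :=
  .setNat 12 (.add (.reg 7) (.lit 2)) ;; .setNat 14 (.add (.reg 1) (.reg 1)) ;;
  .setNat 27 (.add (.reg 14) (.lit 3)) ;; powerProgram ;;
  -- The budget is the first value to match, so codes that exceed it are never accepted.
  .setReal 5 (.reg 1) ;; .setNat 18 (.lit 0) ;; .setNat 19 (.lit 0) ;;
  .count 15 13 tryCode ;;
  .setNat 16 (.reg 18) ;; decodeProgram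

section Search
open Classical
variable {M : ℕ} {I : Instance} {s s' : State} {δ : Decoder}

/-- The instance is stored in memory. -/
structure Loaded (I : Instance) (s : State) : Prop where
  n : s.natReg 0 = I.n
  k : s.natReg 1 = I.k
  α : s.realReg 0 = I.α
  μ : s.realReg 1 = I.μ
  x : ∀ v : Fin I.n, s.realArr 2 v = I.P v 0
  y : ∀ v : Fin I.n, s.realArr 1 v = I.P v 1

lemma Loaded.of_frame {p : Program} (h : Loaded I s) (f : Frame p s s')
    (h0 : 0 ∉ p.natWrites := by decide) (h1 : 1 ∉ p.natWrites := by decide)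
    (h2 : 0 ∉ p.realWrites := by decide) (h3 : 1 ∉ p.realWrites := by decide)
    (h4 : 1 ∉ p.realArrWrites := by decide) (h5 : 2 ∉ p.realArrWrites := by decide) :
    Loaded I s' :=
  ⟨by rw [f.natReg 0 h0, h.n], by rw [f.natReg 1 h1, h.k], by rw [f.realReg 0 h2, h.α],
    by rw [f.realReg 1 h3, h.μ], fun v => by rw [f.realArr 2 h5, h.x],
    fun v => by rw [f.realArr 1 h4, h.y]⟩

lemma Loaded.storedDist (h : Loaded I s) (u v : Fin I.n) :
    storedDist s u v = dist (I.P u) (I.P v) := by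
  rw [DiskShrinking.storedDist, plane_dist, h.x, h.x, h.y, h.y]

/-- Two vertices are adjacent if their distance is less than the sum of their radii. -/
def sumGraph (I : Instance) (r : Fin I.n → ℝ) : SimpleGraph (Fin I.n) where
  Adj u v := u ≠ v ∧ dist (I.P u) (I.P v) < r u + r v
  symm := ⟨fun u v h => ⟨h.1.symm, by rw [dist_comm, add_comm]; exact h.2⟩⟩
  loopless := ⟨fun _ h => h.1 rfl⟩

/-- Decoded radii can be negative before they are checked. The core is therefore computed for the
graph of radius sums, which matters only when the radii turn out admissible. -/
lemma sumGraph_eq {r : Fin I.n → ℝ} (hr : ∀ v, 0 ≤ r v) : sumGraph I r = diskGraph I.P r := by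
  ext u v
  exact (diskGraph_adj I.P_injective hr).symm

lemma Loaded.storesGraph (h : Loaded I s) {r : Fin I.n → ℝ}
    (hr : ∀ v : Fin I.n, s.realArr 0 v = r v) : StoresGraph (sumGraph I r) s :=
  ⟨h.n, fun u v => by rw [h.storedDist, hr, hr]; rfl⟩

/-- The radii are admissible and the graph is acyclic. -/
def Good (I : Instance) (r : Fin I.n → ℝ) : Prop :=
  (∀ v, I.α ≤ r v ∧ r v ≤ 1) ∧ (diskGraph I.P r).IsAcyclic

theorem checkProgram_spec (h : Loaded I s) (hM : I.n ≤ M) {r : Fin I.n → ℝ}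
    (hr : ∀ v : Fin I.n, s.realArr 0 v = r v) :
    WP M checkProgram (fun s' => (1 ≤ s'.natReg 24 ↔ Good I r) ∧
      s'.realReg 4 = ∑ v, (1 - r v)) s := by
  simp only [checkProgram, WP, NatExpr.eval, RealExpr.eval]
  refine (WP.count (Q := fun s' => (1 ≤ s'.natReg 24 ↔ ∀ v, I.α ≤ r v ∧ r v ≤ 1) ∧
      s'.realReg 4 = ∑ v, (1 - r v))
    (Inv := fun i s' => (1 ≤ s'.natReg 24 ↔ ∀ v : Fin I.n, (v : ℕ) < i → I.α ≤ r v ∧ r v ≤ 1) ∧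
      s'.realReg 4 = ∑ j ∈ Finset.range i, (1 - s.realArr 0 j))
    (by decide) (by decide) (by decide) (by simpa [h.n] using hM) (by simp) ?_ ?_).mono ?_
  · rintro i hi s₁ f hi₁ ⟨h1, h2⟩
    have hi : i < I.n := by simpa [h.n] using hi
    have r0 := f.realArr 0 (by decide)
    have α0 := f.realReg 0 (by decide)
    simp only [setR_realArr, setN_realArr, setR_realReg, setN_realReg] at r0 α0
    norm_num at α0
    have hri : s₁.realArr 0 i = r ⟨i, hi⟩ := by rw [r0]; exact hr ⟨i, hi⟩
    have hstep : ∀ p : Fin I.n → Prop, (∀ v : Fin I.n, (v : ℕ) < i + 1 → p v) ↔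
        (∀ v : Fin I.n, (v : ℕ) < i → p v) ∧ p ⟨i, hi⟩ := by
      intro p
      refine ⟨fun h => ⟨fun v hv => h v (by omega), h _ (by simp)⟩, fun h v hv => ?_⟩
      rcases Nat.lt_succ_iff_lt_or_eq.1 hv with hv | hv
      · exact h.1 v hv
      · have : v = ⟨i, hi⟩ := Fin.ext hv
        rw [this]; exact h.2
    have hsum : s₁.realReg 4 + (1 - s₁.realArr 0 i) =
        ∑ j ∈ Finset.range (i + 1), (1 - s.realArr 0 j) := by
      rw [Finset.sum_range_succ, h2, r0]
    simp only [WP, Test.Holds, NatExpr.eval, RealExpr.eval, setR_natReg, setN_natReg, setR_realReg,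
      setN_realReg, setR_realArr, hi₁, hstep, hri, α0, h.α]
    rw [hri] at hsum
    generalize ∑ j ∈ Finset.range (i + 1), (1 - s.realArr 0 j) = c at hsum ⊢
    norm_num
    exact ⟨fun a b => ⟨by simp [h1, a, b], hsum⟩, fun hn => ⟨fun _ => hn, hsum⟩⟩
  · rintro s₁ f ⟨h1, h2⟩
    have e : ((s.setN 24 1).setR 4 ((0 : ℕ) : ℝ)).natReg 0 = I.n := by simpa using h.n
    rw [e] at h1 h2
    refine ⟨by rw [h1]; simp, ?_⟩
    rw [h2, Finset.sum_range]
    exact Finset.sum_congr rfl fun v _ => by rw [hr]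
  rintro s₁ f₁ ⟨h1, h2⟩
  have hl₁ : Loaded I s₁ := by
    refine Loaded.of_frame (s := (s.setN 24 1).setR 4 ((0 : ℕ) : ℝ)) ?_ f₁
    exact ⟨by simpa using h.n, by simpa using h.k, by simpa using h.α, by simpa using h.μ, h.x, h.y⟩
  have hr₁ : ∀ v : Fin I.n, s₁.realArr 0 v = r v := fun v => by
    rw [f₁.realArr 0 (by decide)]; exact hr v
  refine (coreProgram_spec hM (hl₁.storesGraph hr₁)).mono fun s₂ f₂ hc => ?_
  have hl₂ := hl₁.of_frame f₂
  have e24 := f₂.natReg 24 (by decide)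
  have e4 := f₂.realReg 4 (by decide)
  refine WP.count (Inv := fun i s' => (1 ≤ s'.natReg 24 ↔ (∀ v, I.α ≤ r v ∧ r v ≤ 1) ∧
      ∀ v : Fin I.n, (v : ℕ) < i → v ∉ core (sumGraph I r)) ∧ s'.realReg 4 = ∑ v, (1 - r v))
    (by decide) (by decide) (by decide) (by rw [hl₂.n]; exact hM) ?_ ?_ ?_
  · simp [e24, h1, e4, h2]
  · rintro i hi s₃ f₃ hi₃ ⟨h3, h4⟩
    rw [hl₂.n] at hi
    have a1 := f₃.natArr 1 (by decide)
    have hstep : (∀ v : Fin I.n, (v : ℕ) < i + 1 → v ∉ core (sumGraph I r)) ↔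
        (∀ v : Fin I.n, (v : ℕ) < i → v ∉ core (sumGraph I r)) ∧
          (⟨i, hi⟩ : Fin I.n) ∉ core (sumGraph I r) := by
      refine ⟨fun h => ⟨fun v hv => h v (by omega), h _ (by simp)⟩, fun h v hv => ?_⟩
      rcases Nat.lt_succ_iff_lt_or_eq.1 hv with hv | hv
      · exact h.1 v hv
      · have : v = ⟨i, hi⟩ := Fin.ext hv
        rw [this]; exact h.2
    have hmem : 1 ≤ s₂.natArr 1 i ↔ (⟨i, hi⟩ : Fin I.n) ∈ core (sumGraph I r) := hc.mem ⟨i, hi⟩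
    simp only [WP, Test.Holds, NatExpr.eval, hi₃, a1, hstep, hmem, setN_natReg, setN_realReg, h4]
    norm_num
    refine ⟨fun hin => ?_, fun hnin => ?_⟩
    · tauto
    · rw [h3]; tauto
  · rintro s₃ f₃ ⟨h3, h4⟩
    rw [hl₂.n] at h3
    refine ⟨?_, h4⟩
    rw [h3, Good]
    refine and_congr_right fun hv => ?_
    rw [← sumGraph_eq fun v => I.α_nonneg.trans (hv v).1, isAcyclic_iff_core_eq_empty,
      Set.eq_empty_iff_forall_notMem]
    simp

/-- The radii encoded by `t`. -/
noncomputable def codeRadii (I : Instance) (δ : Decoder) (t : ℕ) : Fin I.n → ℝ :=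
  fun v => (δ.decode I.k t).2.1 v

/-- The best of the codes below `T` is stored. -/
def SearchInv (I : Instance) (δ : Decoder) (T : ℕ) (s : State) : Prop :=
  (s.natReg 19 = 0 ∧ s.natReg 18 = 0 ∧ s.realReg 5 = I.μ ∧
    ∀ t < T, Good I (codeRadii I δ t) → I.μ < ∑ v, (1 - codeRadii I δ t v)) ∨
  (s.natReg 19 = 1 ∧ s.natReg 18 < T ∧ Good I (codeRadii I δ (s.natReg 18)) ∧
    s.realReg 5 = ∑ v, (1 - codeRadii I δ (s.natReg 18) v) ∧ s.realReg 5 ≤ I.μ ∧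
    ∀ t < T, Good I (codeRadii I δ t) → s.realReg 5 ≤ ∑ v, (1 - codeRadii I δ t v))

theorem tryCode_spec (h : Loaded I s) (hδ : StoresDecoder δ s) (hpos : 0 < δ.base) (hM : I.n ≤ M)
    (hk : I.k ≤ M) (hw : δ.walkLength ≤ M) (ht : s.natReg 15 ≤ M)
    (hs : SearchInv I δ (s.natReg 15) s) :
    WP M tryCode (SearchInv I δ (s.natReg 15 + 1)) s := by
  set t := s.natReg 15 with ht'
  simp only [tryCode, WP, NatExpr.eval, ← ht']
  have hl₁ : Loaded I (s.setN 16 t) :=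
    ⟨by simpa using h.n, by simpa using h.k, h.α, h.μ, h.x, h.y⟩
  have hδ₁ : StoresDecoder δ (s.setN 16 t) :=
    ⟨by simpa using hδ.base, hδ.pool, hδ.demand, hδ.maxShrink, by simpa using hδ.walkLength⟩
  refine (decodeProgram_spec hδ₁ hpos (by simpa using ht) hw (by rw [hl₁.k]; exact hk) hl₁.n
    hM).mono fun s₂ f₂ h₂ => ?_
  have hl₂ := hl₁.of_frame f₂
  have hr : ∀ v : Fin I.n, s₂.realArr 0 v = codeRadii I δ t v := by
    intro v
    rw [(h₂ v v.2).2, hl₁.k]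
    simp [codeRadii]
  refine (checkProgram_spec hl₂ hM hr).mono fun s₃ f₃ h₃ => ?_
  obtain ⟨h3, h4⟩ := h₃
  have e15 : s₃.natReg 15 = t := by
    rw [f₃.natReg 15 (by decide), f₂.natReg 15 (by decide)]; simp [ht']
  have e18 : s₃.natReg 18 = s.natReg 18 := by
    rw [f₃.natReg 18 (by decide), f₂.natReg 18 (by decide)]; simp
  have e19 : s₃.natReg 19 = s.natReg 19 := by
    rw [f₃.natReg 19 (by decide), f₂.natReg 19 (by decide)]; simp
  have e5 : s₃.realReg 5 = s.realReg 5 := by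
    rw [f₃.realReg 5 (by decide), f₂.realReg 5 (by decide)]; simp
  simp only [Test.Holds, NatExpr.eval, RealExpr.eval, h3, h4, e5, setR_natReg, e15]
  refine ⟨fun hb => ?_, fun hb => ?_⟩
  · have key : ∀ t' < t + 1, Good I (codeRadii I δ t') →
        ∑ v, (1 - codeRadii I δ t v) ≤ ∑ v, (1 - codeRadii I δ t' v) := by
      intro t' ht'' hg
      rcases Nat.lt_succ_iff_lt_or_eq.1 ht'' with hlt | rfl
      · rcases hs with ⟨_, _, a3, a4⟩ | ⟨_, _, _, _, _, a6⟩
        · exact hb.2.trans (a3.trans_le (a4 t' hlt hg).le)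
        · exact hb.2.trans (a6 t' hlt hg)
      · exact le_rfl
    have hμ : s.realReg 5 ≤ I.μ := by
      rcases hs with ⟨_, _, a3, _⟩ | ⟨_, _, _, _, a5, _⟩
      exacts [a3.le, a5]
    simp only [SearchInv, setN_natReg, setN_realReg, setR_realReg, setR_natReg, if_true,
      show (18 : ℕ) ≠ 19 by decide, if_false]
    exact Or.inr ⟨trivial, t.lt_succ_self, hb.1, trivial, hb.2.trans hμ, key⟩
  · have hlast : Good I (codeRadii I δ t) → s.realReg 5 < ∑ v, (1 - codeRadii I δ t v) := by
      intro hg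
      by_contra hle
      exact hb ⟨hg, not_lt.1 hle⟩
    rw [SearchInv, e18, e19, e5]
    rcases hs with ⟨a1, a2, a3, a4⟩ | ⟨a1, a2, a3, a4, a5, a6⟩
    · left
      refine ⟨a1, a2, a3, fun t' ht'' hg => ?_⟩
      rcases Nat.lt_succ_iff_lt_or_eq.1 ht'' with hlt | rfl
      · exact a4 t' hlt hg
      · rw [← a3]; exact hlast hg
    · right
      refine ⟨a1, by omega, a3, a4, a5, fun t' ht'' hg => ?_⟩
      rcases Nat.lt_succ_iff_lt_or_eq.1 ht'' with hlt | rfl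
      · exact a6 t' hlt hg
      · exact (hlast hg).le

theorem powerProgram_spec {D k L : ℕ} (hD : s.natReg 12 = D) (hk : s.natReg 1 = k)
    (hL : s.natReg 27 = L) (hDM : D ≤ M) (hkM : k ≤ M) (hLM : L ≤ M) :
    WP M powerProgram (fun s' => s'.natReg 13 = D ^ (L * k)) s := by
  simp only [powerProgram, WP, NatExpr.eval]
  have hk' : (s.setN 13 1).natReg 1 = k := by simpa using hk
  refine WP.count (Inv := fun i s' => s'.natReg 13 = D ^ (L * i))
    (by decide) (by decide) (by decide) (by rw [hk']; exact hkM) (by simp) ?_ ?_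
  · intro i hi s₁ f₁ hi₁ h₁
    have eL : s₁.natReg 27 = L := by rw [f₁.natReg 27 (by decide), ← hL]; simp
    have eD : s₁.natReg 12 = D := by rw [f₁.natReg 12 (by decide), ← hD]; simp
    refine WP.count (Inv := fun j s' => s'.natReg 13 = D ^ (L * i + j))
      (by decide) (by decide) (by decide) (by rw [eL]; exact hLM) (by simpa using h₁) ?_ ?_
    · intro j hj s₂ f₂ hj₂ h₂
      have eD₂ : s₂.natReg 12 = D := by rw [f₂.natReg 12 (by decide), eD]
      simp only [WP, NatExpr.eval]
      refine WP.count (Inv := fun l s' => s'.natReg 26 = l * D ^ (L * i + j))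
        (by decide) (by decide) (by decide) (by simpa [eD₂] using hDM) (by simp) ?_ ?_
      · intro l hl s₃ f₃ hl₃ h₃
        have e13 : s₃.natReg 13 = D ^ (L * i + j) := by
          rw [f₃.natReg 13 (by decide), ← h₂]; simp
        simp only [WP, NatExpr.eval, setN_natReg, h₃, e13]
        norm_num
        ring
      · intro s₃ f₃ h₃
        simp only [setN_natReg, h₃]
        norm_num [eD₂]
        ring
    · intro s₂ f₂ h₂
      rw [eL] at h₂
      simp only [setN_natReg, h₂]
      norm_num
      ring
  · intro s₁ f₁ h₁
    rw [h₁, hk']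

/-- Either there is no code with an admissible result, or the radii of the best one are stored. -/
def SearchResult (I : Instance) (δ : Decoder) (N : ℕ) (s : State) : Prop :=
  (s.natReg 19 = 0 ∧
    ∀ t < N, Good I (codeRadii I δ t) → I.μ < ∑ v, (1 - codeRadii I δ t v)) ∨
  (s.natReg 19 = 1 ∧ ∃ t, Good I (codeRadii I δ t) ∧ ∑ v, (1 - codeRadii I δ t v) ≤ I.μ ∧
    (∀ t' < N, Good I (codeRadii I δ t') →
      ∑ v, (1 - codeRadii I δ t v) ≤ ∑ v, (1 - codeRadii I δ t' v)) ∧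
    ∀ v : Fin I.n, s.natArr 0 v = (δ.decode I.k t).1 v ∧ s.realArr 0 v = codeRadii I δ t v)

/-- The decoder for the pool in memory. -/
noncomputable def poolDecoder (I : Instance) (s : State) : Decoder where
  base := s.natReg 7 + 2
  pool := s.natArr 4
  demand u v := 2 - storedDist s u v
  maxShrink := 1 - I.α
  walkLength := I.k + I.k

theorem searchProgram_spec (h : Loaded I s) (hM : I.n ≤ M) (hL : I.k + I.k + 3 ≤ M)
    (hD : s.natReg 7 + 2 ≤ M) (hN : (s.natReg 7 + 2) ^ ((I.k + I.k + 3) * I.k) ≤ M) :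
    WP M searchProgram (SearchResult I (poolDecoder I s)
      ((s.natReg 7 + 2) ^ ((I.k + I.k + 3) * I.k))) s := by
  simp only [searchProgram, WP, NatExpr.eval, RealExpr.eval]
  set δ := poolDecoder I s with hδ
  set s₁ := ((s.setN 12 (s.natReg 7 + 2)).setN 14 ((s.setN 12 (s.natReg 7 + 2)).natReg 1 +
    (s.setN 12 (s.natReg 7 + 2)).natReg 1)) with hs₁
  set s₂ := s₁.setN 27 (s₁.natReg 14 + 3) with hs₂
  have hl₂ : Loaded I s₂ :=
    ⟨by simpa [hs₁, hs₂] using h.n, by simpa [hs₁, hs₂] using h.k, h.α, h.μ, h.x, h.y⟩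
  have hδ₂ : StoresDecoder δ s₂ :=
    ⟨by simp [hs₁, hs₂, hδ, poolDecoder], rfl, fun _ _ => rfl, by
      rw [hl₂.α]; rfl, by simp [hs₁, hs₂, h.k, hδ, poolDecoder]⟩
  refine (powerProgram_spec (s := s₂) (D := s.natReg 7 + 2) (k := I.k) (L := I.k + I.k + 3)
    (by simp [hs₁, hs₂]) hl₂.k (by simp [hs₁, hs₂, h.k]) hD (by omega) hL).mono fun s₃ f₃ h13 => ?_
  set N := (s.natReg 7 + 2) ^ ((I.k + I.k + 3) * I.k) with hNdef
  have hl₃ := hl₂.of_frame f₃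
  have hδ₃ := hδ₂.of_frame f₃
  set s₄ := ((s₃.setR 5 (s₃.realReg 1)).setN 18 0).setN 19 0 with hs₄
  have hl₄ : Loaded I s₄ :=
    ⟨by simpa [hs₄] using hl₃.n, by simpa [hs₄] using hl₃.k, by simpa [hs₄] using hl₃.α,
      by simpa [hs₄] using hl₃.μ, hl₃.x, hl₃.y⟩
  have hδ₄ : StoresDecoder δ s₄ :=
    ⟨by simpa [hs₄] using hδ₃.base, hδ₃.pool, hδ₃.demand, by simpa [hs₄] using hδ₃.maxShrink,
      by simpa [hs₄] using hδ₃.walkLength⟩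
  have h13' : s₄.natReg 13 = N := by simpa [hs₄] using h13
  refine (WP.count (Q := fun s' => SearchInv I δ N s') (Inv := fun t s' => SearchInv I δ t s')
    (by decide) (by decide) (by decide) (by rw [h13']; exact hN) ?_ ?_ ?_).mono ?_
  · left
    simp [hs₄, hl₃.μ]
  · intro t ht s₅ f₅ ht₅ h₅
    rw [h13'] at ht
    have := tryCode_spec (M := M) (hl₄.of_frame f₅) (hδ₄.of_frame f₅)
      (by simp [hδ, poolDecoder]) hM (by omega) (by simp only [hδ, poolDecoder]; omega)
      (by omega) (by rw [ht₅]; exact h₅)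
    rw [ht₅] at this
    exact this.mono fun s' _ h => h
  · intro s₅ _ h₅
    rwa [h13'] at h₅
  intro s₅ f₅ h₅
  have hl₅ := hl₄.of_frame f₅
  have hδ₅ := hδ₄.of_frame f₅
  have hl₆ : Loaded I (s₅.setN 16 (s₅.natReg 18)) :=
    ⟨by simpa using hl₅.n, by simpa using hl₅.k, hl₅.α, hl₅.μ, hl₅.x, hl₅.y⟩
  have hδ₆ : StoresDecoder δ (s₅.setN 16 (s₅.natReg 18)) :=
    ⟨by simpa using hδ₅.base, hδ₅.pool, hδ₅.demand, hδ₅.maxShrink, by simpa using hδ₅.walkLength⟩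
  -- If nothing was found, this register is 0 and the final decoding is harmless.
  have h18 : s₅.natReg 18 ≤ M := by
    rcases h₅ with ⟨-, a, -⟩ | ⟨-, a, -⟩ <;> omega
  refine (decodeProgram_spec hδ₆ (by simp [hδ, poolDecoder]) (by simpa using h18)
    (by simp only [hδ, poolDecoder]; omega) (by rw [hl₆.k]; omega) hl₆.n hM).mono
    fun s₇ f₇ h₇ => ?_
  have e19 : s₇.natReg 19 = s₅.natReg 19 := by rw [f₇.natReg 19 (by decide)]; simp
  rw [hl₆.k] at h₇
  simp only [setN_natReg, if_true] at h₇
  rcases h₅ with ⟨a1, a2, a3, a4⟩ | ⟨a1, a2, a3, a4, a5, a6⟩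
  · exact Or.inl ⟨by rw [e19, a1], a4⟩
  · refine Or.inr ⟨by rw [e19, a1], s₅.natReg 18, a3, by rw [← a4]; exact a5, fun t' ht' hg => ?_,
      fun v => h₇ v v.2⟩
    rw [← a4]
    exact a6 t' ht' hg

end Search
end DiskShrinking

namespace DiskShrinking
open RealRAM

/-! ### The main program -/

/-- Store unit disks and compute the pool. -/
def poolProgram : Program :=
  -- Real array 0 contains the first coordinates in the input but must hold the radii in the output,
  -- so the coordinates move to array 2.
  .count 2 0 (.storeReal 2 (.reg 2) (.arr 0 (.reg 2))) ;;
  .count 2 0 (.storeReal 0 (.reg 2) (.lit 1)) ;;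
  coreProgram ;; labelProgram ;; branchPool ;; chainPool

/-- Compute the bound on the size of the pool of a solvable instance in register 11. -/
def boundProgram : Program :=
  .setNat 14 (.add (.reg 1) (.lit 32)) ;;
  -- Tripling followed by three doublings multiplies by 24, the product of 12 from `pool_card_le`
  -- and 2 from `card_removed_le`.
  .setNat 14 (.add (.reg 14) (.add (.reg 14) (.reg 14))) ;;
  .setNat 14 (.add (.reg 14) (.reg 14)) ;; .setNat 14 (.add (.reg 14) (.reg 14)) ;;
  .setNat 14 (.add (.reg 14) (.reg 14)) ;;
  .setNat 11 (.lit 0) ;; .count 2 1 (.setNat 11 (.add (.reg 11) (.reg 14)))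

def mainProgram : Program :=
  -- Register 19 is the answer; its value 0 is the correct output when the pool is too large and the
  -- search is skipped.
  poolProgram ;; boundProgram ;; .setNat 19 (.lit 0) ;;
  .ite (.natLe (.reg 7) (.reg 11)) searchProgram .skip ;; .setNat 0 (.reg 19)

/-- The bound on the size of the pool. -/
def poolBound (k : ℕ) : ℕ := k * (24 * (k + 32))

section Main
open Classical
variable {M : ℕ} {I : Instance} {s : State}

/-- The pool of the instance is stored. -/
structure PoolReady (I : Instance) (s : State) : Prop where
  loaded : Loaded I s
  label : LabelInv (diskGraph I.P fun _ => 1) Set.univ s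
  pool : PoolInv (diskGraph I.P fun _ => 1) I.n s

theorem poolProgram_spec (hM : I.n ≤ M) : WP M poolProgram (PoolReady I) (input I) := by
  have hx : ∀ v : Fin I.n, (input I).realArr 0 v = I.P v 0 := fun v => by simp [input]
  have hy : ∀ v : Fin I.n, (input I).realArr 1 v = I.P v 1 := fun v => by simp [input]
  have hn : (input I).natReg 0 = I.n := by simp [input]
  refine (WP.count (Q := Loaded I) (Inv := fun i s' => ∀ j < i, s'.realArr 2 j =
    (input I).realArr 0 j) (by decide) (by decide) (by decide) (by rw [hn]; exact hM) (by simp)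
    ?_ ?_).mono ?_
  · intro i hi s₁ f hi₁ h j hj
    have e0 := f.realArr 0 (by decide)
    simp only [NatExpr.eval, RealExpr.eval, hi₁, setN_realArr, putR_realArr, if_true, e0]
    by_cases e : j = i
    · simp [e]
    · rw [Function.update_of_ne e]; exact h j (by omega)
  · intro s₁ f h
    rw [hn] at h
    refine ⟨by rw [f.natReg 0 (by decide), hn], ?_, ?_, ?_, fun v => by rw [h v v.2, hx],
      fun v => by rw [f.realArr 1 (by decide), hy]⟩
    · rw [f.natReg 1 (by decide)]; simp [input]
    · rw [f.realReg 0 (by decide)]; simp [input]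
    · rw [f.realReg 1 (by decide)]; simp [input]
  intro s₁ _ h₁
  refine (WP.count (Q := fun s' => ∀ v : Fin I.n, s'.realArr 0 v = 1)
    (Inv := fun i s' => ∀ j < i, s'.realArr 0 j = 1)
    (by decide) (by decide) (by decide) (by rw [h₁.n]; exact hM) (by simp) ?_ ?_).mono ?_
  · intro i hi s₂ f hi₂ h j hj
    simp only [NatExpr.eval, RealExpr.eval, hi₂, setN_realArr, putR_realArr, if_true]
    by_cases e : j = i
    · simp [e]
    · rw [Function.update_of_ne e]; exact h j (by omega)
  · intro s₂ f h v
    exact h v (by rw [h₁.n]; exact v.2)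
  intro s₂ f₂ h1
  have hl₂ := h₁.of_frame f₂
  have hG₂ := hl₂.storesGraph (r := fun _ => 1) h1
  rw [sumGraph_eq fun _ => zero_le_one] at hG₂
  refine (coreProgram_spec hM hG₂).mono fun s₃ f₃ hC₃ => ?_
  have hG₃ := hG₂.of_frame f₃
  refine (labelProgram_spec hM hG₃ hC₃).mono fun s₄ f₄ hL₄ => ?_
  have hG₄ := hG₃.of_frame f₄
  have hC₄ := hC₃.of_eq (f₄.natArr 1 (by decide)) (f₄.natArr 2 (by decide))
  refine (branchPool_spec hM hG₄ hC₄ fun v => ?_).mono fun s₅ f₅ hB₅ => ?_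
  · rw [f₄.realArr 0 (by decide), f₃.realArr 0 (by decide), h1]
    exact one_pos
  have hG₅ := hG₄.of_frame f₅
  have hC₅ := hC₄.of_eq (f₅.natArr 1 (by decide)) (f₅.natArr 2 (by decide))
  refine (chainPool_spec hM hG₅ hC₅ hB₅).mono fun s₆ f₆ hP₆ => ?_
  have e3 : s₆.natArr 3 = s₄.natArr 3 := by
    rw [f₆.natArr 3 (by decide), f₅.natArr 3 (by decide)]
  exact ⟨(((hl₂.of_frame f₃).of_frame f₄).of_frame f₅).of_frame f₆,
    ⟨by rw [e3]; exact hL₄.lt, by rw [e3]; exact hL₄.reach, by rw [e3]; exact hL₄.eq⟩, hP₆⟩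

theorem boundProgram_spec {k : ℕ} (hk : s.natReg 1 = k) (hM : k ≤ M) :
    WP M boundProgram (fun s' => s'.natReg 11 = poolBound k) s := by
  simp only [boundProgram, WP, NatExpr.eval]
  refine WP.count (Inv := fun i s' => s'.natReg 11 = i * (24 * (k + 32)))
    (by decide) (by decide) (by decide) (by simpa [hk] using hM) (by simp) ?_ ?_
  · intro i hi s₁ f hi₁ h
    have e14 := f.natReg 14 (by decide)
    simp only [setN_natReg, hk] at e14
    norm_num at e14
    simp only [WP, NatExpr.eval, setN_natReg, h, e14]
    norm_num
    ring
  · intro s₁ f h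
    rw [h]
    simp [hk, poolBound]

/-- The pool of a solvable instance is small. -/
theorem PoolReady.card_le (h : PoolReady I s) {S : Finset (Fin I.n)} {r : Fin I.n → ℝ}
    (hS : IsSolution I S r) : s.natReg 7 ≤ poolBound I.k := by
  have h1 := h.pool.size
  have h2 := pool_card_le (G := diskGraph I.P fun _ => 1) hS.acyclic
    (fun v : Fin I.n => s.natArr 3 v) fun u v => h.label.eq u v (Set.mem_univ _)
  have h3 := card_removed_le I hS
  have h4 : ((chainLabels (diskGraph I.P fun _ => 1) (s.natArr 3)).filter (· < I.n)).card ≤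
      (chainLabels (diskGraph I.P fun _ => 1) (s.natArr 3)).card :=
    Finset.card_le_card (Finset.filter_subset _ _)
  have h5 : s.natReg 7 ≤ 12 * (removed (diskGraph I.P fun _ => 1) (diskGraph I.P r)).card :=
    (h1.trans (Nat.add_le_add_left (Nat.mul_le_mul_left 2 h4) _)).trans <| le_trans
      (le_of_eq <| by unfold chainLabels BranchPair; congr!) h2
  rw [poolBound]
  nlinarith

/-- Every solution is dominated by a code. -/
theorem PoolReady.exists_code (h : PoolReady I s) {S : Finset (Fin I.n)} {r : Fin I.n → ℝ}
    (hS : IsSolution I S r) : ∃ t < (s.natReg 7 + 2) ^ ((I.k + I.k + 3) * I.k),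
      Good I (codeRadii I (poolDecoder I s) t) ∧
      ∑ v, (1 - codeRadii I (poolDecoder I s) t v) ≤ cost S r := by
  obtain ⟨t, ht, h1, h2, h3⟩ := DiskShrinking.exists_code I (δ := poolDecoder I s)
    (by simp [poolDecoder]) (fun u v => by simp only [poolDecoder, demand, h.loaded.storedDist]) rfl
    (by simp only [poolDecoder]; omega) (poolSet I.n s)
    (fun v ⟨i, hi, hv⟩ => ⟨i, by simp only [poolDecoder]; omega, hv⟩) h.pool.branch
    (fun u v huv => by
      obtain ⟨b, c, hbc, hl, hb, hc, hd⟩ := h.pool.chain u v huv (h.label.lt u)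
      rw [h.loaded.storedDist, h.loaded.storedDist] at hd
      exact ⟨b, c, hbc, h.label.reach u b hl.symm, hb, hc, hd⟩) hS
  exact ⟨t, ht, ⟨h1, h2⟩, h3⟩

/-- The search yields a correct answer. -/
theorem PoolReady.correctOutput (h : PoolReady I s) {s' : State}
    (hs : SearchResult I (poolDecoder I s) ((s.natReg 7 + 2) ^ ((I.k + I.k + 3) * I.k)) s') :
    CorrectOutput I (s'.setN 0 (s'.natReg 19)) := by
  rcases hs with ⟨h0, hno⟩ | ⟨h1, t, hg, hμ, hopt, hv⟩
  · refine Or.inl ⟨by simpa using h0, ?_⟩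
    rintro ⟨S, r, hS⟩
    obtain ⟨t, ht, hg, hc⟩ := h.exists_code hS
    exact absurd (hc.trans hS.cost_le) (not_le.2 (hno t ht hg))
  refine Or.inr ⟨by simpa using h1, ?_⟩
  set δ := poolDecoder I s
  have hr : outputRadii I.n (s'.setN 0 (s'.natReg 19)) = codeRadii I δ t :=
    funext fun v => (hv v).2
  have hset : outputSet I.n (s'.setN 0 (s'.natReg 19)) =
      Finset.univ.filter fun v : Fin I.n => (δ.decode I.k t).1 v ≠ 0 := by
    ext v
    rw [outputSet, Finset.mem_filter, Finset.mem_filter, setN_natArr, (hv v).1]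
  have hone : ∀ v : Fin I.n, v ∉ Finset.univ.filter (fun v : Fin I.n =>
      (δ.decode I.k t).1 v ≠ 0) → codeRadii I δ t v = 1 := by
    intro v hv
    exact Decoder.decode_radius I.k t v (by simpa using hv)
  have hcost : cost (Finset.univ.filter fun v : Fin I.n => (δ.decode I.k t).1 v ≠ 0)
      (codeRadii I δ t) = ∑ v, (1 - codeRadii I δ t v) :=
    Finset.sum_subset (Finset.subset_univ _) fun v _ hv => by rw [hone v hv, sub_self]
  rw [hr, hset]
  refine ⟨⟨Decoder.card_decode_le I.n I.k t, hone, fun v _ => hg.1 v, hg.2, hcost ▸ hμ⟩,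
    fun S' r' hS' => ?_⟩
  obtain ⟨t', ht', hg', hc'⟩ := h.exists_code hS'
  rw [hcost]
  exact (hopt t' ht' hg').trans hc'

/-- A bound on the number of rounds of every loop, without the number of points. -/
def roundBound (k : ℕ) : ℕ :=
  (poolBound k + 2) + (poolBound k + 2) ^ ((k + k + 3) * k) + (k + k + 3)

theorem mainProgram_spec (I : Instance) :
    WP (I.n + roundBound I.k) mainProgram (CorrectOutput I) (input I) := by
  have hM : I.n ≤ I.n + roundBound I.k := Nat.le_add_right _ _
  have hM' : roundBound I.k ≤ I.n + roundBound I.k := Nat.le_add_left _ _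
  have hL : I.k + I.k + 3 ≤ roundBound I.k := Nat.le_add_left _ _
  generalize I.n + roundBound I.k = M at hM hM' ⊢
  refine (poolProgram_spec hM).mono fun s₁ _ h₁ => ?_
  refine (boundProgram_spec h₁.loaded.k (by omega)).mono fun s₂ f₂ h11 => ?_
  have e7 : s₂.natReg 7 = s₁.natReg 7 := f₂.natReg 7 (by decide)
  have h₂ : PoolReady I (s₂.setN 19 0) := by
    have hl := h₁.loaded.of_frame f₂
    have e3 := f₂.natArr 3 (by decide)
    have e4 := f₂.natArr 4 (by decide)
    have hp : poolSet I.n (s₂.setN 19 0) = poolSet I.n s₁ := by simp [poolSet, e4, e7]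
    have hd : ∀ u v, storedDist (s₂.setN 19 0) u v = storedDist s₁ u v := fun u v => by
      simp only [storedDist, setN_realArr, f₂.realArr 1 (by decide), f₂.realArr 2 (by decide)]
    refine ⟨⟨by simpa using hl.n, by simpa using hl.k, hl.α, hl.μ, hl.x, hl.y⟩,
      ⟨by simpa [e3] using h₁.label.lt, by simpa [e3] using h₁.label.reach,
        by simpa [e3] using h₁.label.eq⟩, ⟨?_, ?_, ?_, ?_⟩⟩
    · simpa [e7, e4] using h₁.pool.lt
    · rw [hp]; exact h₁.pool.branch
    · simp only [hp, hd, setN_natArr, e3]; exact h₁.pool.chain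
    · simp only [setN_natReg, setN_natArr, e3]
      simpa [e7] using h₁.pool.size
  simp only [WP, NatExpr.eval, Test.Holds]
  refine ⟨fun hle => ?_, fun hgt => ?_⟩
  · simp only [setN_natReg] at hle
    norm_num at hle
    rw [h11] at hle
    have hD : (s₂.setN 19 0).natReg 7 + 2 ≤ poolBound I.k + 2 := by simpa using hle
    have hN := Nat.pow_le_pow_left hD ((I.k + I.k + 3) * I.k)
    have hb : poolBound I.k + 2 ≤ roundBound I.k := by rw [roundBound]; omega
    have hb' : (poolBound I.k + 2) ^ ((I.k + I.k + 3) * I.k) ≤ roundBound I.k := by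
      rw [roundBound]; omega
    exact (searchProgram_spec h₂.loaded hM (by omega) (by omega) (by omega)).mono
      fun s₃ _ h₃ => h₂.correctOutput h₃
  · simp only [setN_natReg] at hgt
    norm_num at hgt
    refine Or.inl ⟨by simp, ?_⟩
    rintro ⟨S, r, hS⟩
    have := h₁.card_le hS
    omega

end Main

/-! ### The running time -/

/-- For `k ≥ 2` the base is at most `512 * k ^ 2`, hence at most `k ^ 11`, and `11 * (2 * k + 3) *
k` is at most `20 * k ^ 3`. The exponent is really quadratic in `k`; the cubic bound has room to
spare. Each of the three summands is bounded by the same power. -/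
lemma roundBound_le {k : ℕ} (hk : 2 ≤ k) : roundBound k + 1 ≤ 3 * k ^ (20 * k ^ 3) := by
  have hb : poolBound k + 2 ≤ k ^ 11 := by
    have h9 : 2 ^ 9 ≤ k ^ 9 := Nat.pow_le_pow_left hk 9
    calc poolBound k + 2 ≤ 2 ^ 9 * k ^ 2 := by rw [poolBound]; nlinarith
      _ ≤ k ^ 9 * k ^ 2 := Nat.mul_le_mul_right _ h9
      _ = k ^ 11 := by rw [← pow_add]
  have h3 : 4 * k ≤ k ^ 3 := by nlinarith [sq_nonneg k]
  have hk3 : 2 * k ^ 2 ≤ k ^ 3 := by nlinarith [sq_nonneg k]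
  have h1 : k ^ 11 ≤ k ^ (20 * k ^ 3) := Nat.pow_le_pow_right (by omega) (by omega)
  have h2 : k + k + 4 ≤ k ^ (20 * k ^ 3) :=
    le_trans (by omega) (Nat.pow_le_pow_right (by omega) (show 3 ≤ 20 * k ^ 3 by omega))
  have h4 : (poolBound k + 2) ^ ((k + k + 3) * k) ≤ k ^ (20 * k ^ 3) :=
    calc (poolBound k + 2) ^ ((k + k + 3) * k) ≤ (k ^ 11) ^ ((k + k + 3) * k) :=
          Nat.pow_le_pow_left hb _
      _ = k ^ (11 * ((k + k + 3) * k)) := (pow_mul _ _ _).symm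
      _ ≤ k ^ (20 * k ^ 3) := Nat.pow_le_pow_right (by omega) (by nlinarith)
  rw [roundBound]
  omega

lemma exists_roundBound_le : ∃ C : ℕ, ∀ k : ℕ, (roundBound k + 1 : ℝ) ≤
    C * (2 : ℝ) ^ ((C : ℝ) * ((k : ℝ) ^ 3 * Real.logb 2 k)) := by
  refine ⟨roundBound 0 + 1 + (roundBound 1 + 1) + 20, fun k => ?_⟩
  generalize h0 : roundBound 0 + 1 = c₀
  generalize h1 : roundBound 1 + 1 = c₁
  rcases Nat.lt_or_ge k 2 with hk | hk
  -- For `k = 0` and `k = 1` the exponent vanishes, and the constant alone must bound the number of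
  -- rounds.
  · have e : (k : ℝ) ^ 3 * Real.logb 2 k = 0 := by interval_cases k <;> simp
    rw [e, mul_zero, Real.rpow_zero, mul_one]
    have : roundBound k + 1 ≤ c₀ + c₁ + 20 := by interval_cases k <;> omega
    exact_mod_cast this
  · have hk0 : (0 : ℝ) < k := by exact_mod_cast (show 0 < k by omega)
    have hlog : 0 ≤ (k : ℝ) ^ 3 * Real.logb 2 k :=
      mul_nonneg (by positivity) (Real.logb_nonneg one_lt_two (by exact_mod_cast (by omega)))
    have e : ((k ^ (20 * k ^ 3) : ℕ) : ℝ) = (2 : ℝ) ^ (20 * ((k : ℝ) ^ 3 * Real.logb 2 k)) := by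
      rw [show 20 * ((k : ℝ) ^ 3 * Real.logb 2 k) = Real.logb 2 k * ((20 * k ^ 3 : ℕ) : ℝ) by
        push_cast; ring, Real.rpow_mul zero_le_two, Real.rpow_logb two_pos (by norm_num) hk0,
        Real.rpow_natCast, Nat.cast_pow]
    have h := roundBound_le hk
    have h' : (roundBound k + 1 : ℝ) ≤ 3 * ((k ^ (20 * k ^ 3) : ℕ) : ℝ) := by exact_mod_cast h
    rw [e] at h'
    refine h'.trans (mul_le_mul ?_ (Real.rpow_le_rpow_of_exponent_le one_le_two
      (mul_le_mul_of_nonneg_right ?_ hlog)) (by positivity) (by positivity))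
    · exact_mod_cast (show 3 ≤ c₀ + c₁ + 20 by omega)
    · exact_mod_cast (show 20 ≤ c₀ + c₁ + 20 by omega)

lemma exists_time_le (c : ℕ) : ∃ C : ℕ, ∀ n k : ℕ,
    ((c * (n + roundBound k + 1) ^ c : ℕ) : ℝ) ≤
      C * (2 : ℝ) ^ ((C : ℝ) * ((k : ℝ) ^ 3 * Real.logb 2 k)) * ((n : ℝ) + 1) ^ C := by
  obtain ⟨d, hd⟩ := exists_roundBound_le
  refine ⟨c * d ^ c + d * c + c, fun n k => ?_⟩
  set C := c * d ^ c + d * c + c with hC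
  set L := (k : ℝ) ^ 3 * Real.logb 2 k with hL
  have hL0 : 0 ≤ L := by
    refine mul_nonneg (by positivity) ?_
    rcases Nat.eq_zero_or_pos k with rfl | hk
    · simp
    · exact Real.logb_nonneg one_lt_two (by exact_mod_cast hk)
  have h1 : ((n + roundBound k + 1 : ℕ) : ℝ) ≤ d * (2 : ℝ) ^ ((d : ℝ) * L) * (n + 1) := by
    have h2 : ((n + roundBound k + 1 : ℕ) : ℝ) ≤ (roundBound k + 1) * (n + 1) := by
      push_cast
      nlinarith [mul_nonneg (Nat.cast_nonneg (α := ℝ) (roundBound k)) (Nat.cast_nonneg (α := ℝ) n)]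
    exact h2.trans (mul_le_mul_of_nonneg_right (hd k) (by positivity))
  calc ((c * (n + roundBound k + 1) ^ c : ℕ) : ℝ)
      = c * ((n + roundBound k + 1 : ℕ) : ℝ) ^ c := by push_cast; ring
    _ ≤ c * (d * (2 : ℝ) ^ ((d : ℝ) * L) * (n + 1)) ^ c := by gcongr
    _ = (c * d ^ c : ℕ) * (2 : ℝ) ^ (((d * c : ℕ) : ℝ) * L) * ((n : ℝ) + 1) ^ c := by
      rw [mul_pow, mul_pow, ← Real.rpow_natCast ((2 : ℝ) ^ _), ← Real.rpow_mul zero_le_two]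
      push_cast
      rw [show (d : ℝ) * L * c = d * c * L by ring]
      ring
    _ ≤ C * (2 : ℝ) ^ ((C : ℝ) * L) * ((n : ℝ) + 1) ^ C := by
      have e1 : ((c * d ^ c : ℕ) : ℝ) ≤ C := Nat.cast_le.2 (by omega)
      have e2 : ((d * c : ℕ) : ℝ) ≤ C := Nat.cast_le.2 (by omega)
      have e3 : ((n : ℝ) + 1) ^ c ≤ ((n : ℝ) + 1) ^ C :=
        pow_le_pow_right₀ (by linarith [Nat.cast_nonneg (α := ℝ) n]) (by omega)
      have e4 : (2 : ℝ) ^ (((d * c : ℕ) : ℝ) * L) ≤ (2 : ℝ) ^ ((C : ℝ) * L) :=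
        Real.rpow_le_rpow_of_exponent_le one_le_two (mul_le_mul_of_nonneg_right e2 hL0)
      gcongr

end DiskShrinking

theorem mainTheorem4 :
    ∃ (A : RealRAM.Program) (C : ℕ), ∀ I : DiskShrinking.Instance,
      ∃ (s : RealRAM.State) (t : ℕ),
        RealRAM.Runs A (DiskShrinking.input I) s t ∧
        (t : ℝ) ≤ C * (2 : ℝ) ^ ((C : ℝ) * ((I.k : ℝ) ^ 3 * Real.logb 2 (I.k : ℝ))) *
          ((I.n : ℝ) + 1) ^ C ∧
        DiskShrinking.CorrectOutput I s := by
  obtain ⟨c, hc⟩ := RealRAM.Program.timeBound_le DiskShrinking.mainProgram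
  obtain ⟨C, hC⟩ := DiskShrinking.exists_time_le c
  refine ⟨DiskShrinking.mainProgram, C, fun I => ?_⟩
  obtain ⟨s, t, hrun, ht, hs⟩ := (DiskShrinking.mainProgram_spec I).runs
  exact ⟨s, t, hrun, (Nat.cast_le.2 (ht.trans (hc _))).trans (hC I.n I.k), hs⟩
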